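/- Let $\mathcal D$ be a flat abelian braided monoidal category: an abelian category with a braided monoidal structure $(\otimes,\mathbf 1,\Psi)$ such that $\otimes$ is additive in each variable and $Y\otimes-$ and $-\otimes Y$ are exact for every object $Y$. Let $\mathcal D^{\mathbb N_0}$ be the category of sequences $(Y_0,Y_1,\dots)$ of objects of $\mathcal D$, with tensor product $(Y\otimes Z)_j=\bigoplus_{k+l=j}Y_k\otimes Z_l$ and braiding $\bigoplus_{k+l=j}(-1)^{kl}\Psi_{Y_k,Z_l}$. Let $X$ be an object of $\mathcal D$. For a permutation $\sigma\in S_j$ of length $l(\sigma)$ let $\sigma_{\mathcal D}(X)\in\mathrm{Aut}(X^{\otimes j})$ be the composite $\Psi_{i_1}\circ\cdots\circ\Psi_{i_r}$ along a reduced word $\sigma=s_{i_1}\cdots s_{i_r}$ in the adjacent transpositions, where $\Psi_i$ is $\Psi_{X,X}$ acting on the tensor factors $i,i+1$. Let $S_{(k,l)}\subset S_{k+l}$ be the set of those $\sigma$ for which $\sigma^{-1}$ is increasing on $\{1,\dots,k\}$ and on $\{k+1,\dots,k+l\}$, and let $S^{(k,l)}$ be the set of their inverses. Put $$A_j(X)=\sum_{\sigma\in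 S_j}(-1)^{l(\sigma)}\sigma_{\mathcal D}(X),\quad A_{(k,l)}(X)=\sum_{\sigma\in S_{(k,l)}}(-1)^{l(\sigma)}\sigma_{\mathcal D}(X),\quad A^{(k,l)}(X)=\sum_{\sigma\in S^{(k,l)}}(-1)^{l(\sigma)}\sigma_{\mathcal D}(X).$$ On the object $(\mathbf 1,X,X^{\otimes 2},\dots)$ of $\mathcal D^{\mathbb N_0}$ consider two sets of structure morphisms. In both, the unit and the counit are $\mathrm{id}_{\mathbf 1}$ in degree $0$ and zero in the other degrees, and the antipode is $S_j=(-1)^j(-1)^{l(\sigma_j^0)}(\sigma_j^0)_{\mathcal D}(X)=(-1)^{j(j+1)/2}(\sigma_j^0)_{\mathcal D}(X)$, where $\sigma_j^0$ is the order-reversing permutation. For $T(X)$, the product $X^{\otimes n}\otimes X^{\otimes m}\to X^{\otimes(n+m)}$ is the canonical isomorphism and the coproduct $X^{\otimes(n+m)}\to X^{\otimes n}\otimes X^{\otimes m}$ is $A_{(n,m)}(X)$. For $T^\circ(X)$, the product is $A^{(n,m)}(X)$ and the coproduct is the canonical isomorphism (both up to the canonical identification $X^{\otimes n}\otimes X^{\otimes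 m}\cong X^{\otimes(n+m)}$). Then $T(X)$ and $T^\circ(X)$ are Hopf algebras in $\mathcal D^{\mathbb N_0}$, and $\hat A(X)=(A_j(X))_{j\ge 0}:T(X)\to T^\circ(X)$ is a bialgebra morphism in $\mathcal D^{\mathbb N_0}$. Hence its coimage $T^\wedge(X)=\mathrm{coim}(\hat A(X))$ inherits a Hopf algebra structure in $\mathcal D^{\mathbb N_0}$: there is a Hopf algebra structure on $T^\wedge(X)$ for which the projection $T(X)\to T^\wedge(X)$ and the canonical monomorphism $T^\wedge(X)\to T^\circ(X)$, whose composite is $\hat A(X)$, are bialgebra morphisms, and it is the only Hopf algebra structure on $T^\wedge(X)$ for which the projection is a bialgebra morphism. -/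

import Mathlib

open CategoryTheory MonoidalCategory Limits
open scoped MonObj ComonObj

namespace BraidedExterior

set_option linter.unusedSectionVars false

noncomputable section

universe v u

/-! ### The category of `ℕ`-graded objects with the signed braiding -/

section Graded

variable {D : Type u} [Category.{v} D] [Abelian D] [MonoidalCategory D] [MonoidalPreadditive D]

instance preservesFiniteCoproducts_curriedTensor (X : D) :
    PreservesFiniteCoproducts ((curriedTensor D).obj X) :=
  inferInstanceAs (PreservesFiniteCoproducts (tensorLeft X))

instance preservesFiniteCoproducts_curriedTensor_flip (X : D) :
    PreservesFiniteCoproducts ((curriedTensor D).flip.obj X) :=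
  inferInstanceAs (PreservesFiniteCoproducts (tensorRight X))

instance (priority := 5000) hasTensor (X Y : GradedObject ℕ D) : GradedObject.HasTensor X Y :=
  inferInstance

variable (D) in
/-- The category of `ℕ`-graded objects of `D`: sequences of objects and sequences of morphisms.
This is Mathlib's `GradedObject ℕ D` together with Mathlib's tensor product
`(X ⊗ Y)ₖ = ⨁_{i + j = k} Xᵢ ⊗ Yⱼ`; it is a separate type because it carries the braiding with
signs, and not the unsigned one of Mathlib. -/
def NGraded : Type (max u 0) := GradedObject ℕ D

instance : Category (NGraded D) := inferInstanceAs (Category (GradedObject ℕ D))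

instance : MonoidalCategory (NGraded D) := inferInstanceAs (MonoidalCategory (GradedObject ℕ D))

/-- The automorphism of `X ⊗ Y` which is `(-1)^(ij)` on the summand `Xᵢ ⊗ Yⱼ`. -/
def signTwist (X Y : GradedObject ℕ D) :
    GradedObject.Monoidal.tensorObj X Y ≅ GradedObject.Monoidal.tensorObj X Y where
  hom k := GradedObject.Monoidal.tensorObjDesc fun i j h =>
    ((-1 : ℤ) ^ (i * j)) • GradedObject.Monoidal.ιTensorObj X Y i j k h
  inv k := GradedObject.Monoidal.tensorObjDesc fun i j h =>
    ((-1 : ℤ) ^ (i * j)) • GradedObject.Monoidal.ιTensorObj X Y i j k h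
  hom_inv_id := by
    funext k
    apply GradedObject.Monoidal.tensorObj_ext
    intro i j h
    simp [← mul_smul, ← mul_pow]
  inv_hom_id := by
    funext k
    apply GradedObject.Monoidal.tensorObj_ext
    intro i j h
    simp [← mul_smul, ← mul_pow]

lemma ι_signTwist (X Y : GradedObject ℕ D) (i j k : ℕ) (h : i + j = k) :
    GradedObject.Monoidal.ιTensorObj X Y i j k h ≫ (signTwist X Y).hom k =
      ((-1 : ℤ) ^ (i * j)) • GradedObject.Monoidal.ιTensorObj X Y i j k h := by
  simp [signTwist]

lemma ι_signTwist_assoc (X Y : GradedObject ℕ D) (i j k : ℕ) (h : i + j = k) {A : D}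
    (f : GradedObject.Monoidal.tensorObj X Y k ⟶ A) :
    GradedObject.Monoidal.ιTensorObj X Y i j k h ≫ (signTwist X Y).hom k ≫ f =
      ((-1 : ℤ) ^ (i * j)) • (GradedObject.Monoidal.ιTensorObj X Y i j k h ≫ f) := by
  rw [← Category.assoc, ι_signTwist, Preadditive.zsmul_comp]

lemma signTwist_natural {X X' Y Y' : GradedObject ℕ D} (f : X ⟶ X') (g : Y ⟶ Y') :
    GradedObject.Monoidal.tensorHom f g ≫ (signTwist X' Y').hom =
      (signTwist X Y).hom ≫ GradedObject.Monoidal.tensorHom f g := by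
  funext k
  apply GradedObject.Monoidal.tensorObj_ext
  intro i j h
  simp [ι_signTwist, ι_signTwist_assoc]

lemma zsmul_whiskerRight {A B : D} (n : ℤ) (f : A ⟶ B) (C : D) : (n • f) ▷ C = n • (f ▷ C) :=
  map_zsmul ((tensoringRight D).obj C).mapAddHom n f

lemma whiskerLeft_zsmul {A B : D} (n : ℤ) (f : A ⟶ B) (C : D) : C ◁ (n • f) = n • (C ◁ f) :=
  map_zsmul ((tensoringLeft D).obj C).mapAddHom n f

variable [BraidedCategory D]

/-- The braiding of graded objects: `(-1)^(ij) Ψ : Xᵢ ⊗ Yⱼ ⟶ Yⱼ ⊗ Xᵢ` on the summand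
`Xᵢ ⊗ Yⱼ`. -/
def signedBraiding (X Y : GradedObject ℕ D) :
    GradedObject.Monoidal.tensorObj X Y ≅ GradedObject.Monoidal.tensorObj Y X where
  hom k := GradedObject.Monoidal.tensorObjDesc fun i j h =>
    ((-1 : ℤ) ^ (i * j)) • ((β_ (X i) (Y j)).hom ≫
      GradedObject.Monoidal.ιTensorObj Y X j i k ((add_comm j i).trans h))
  inv k := GradedObject.Monoidal.tensorObjDesc fun j i h =>
    ((-1 : ℤ) ^ (i * j)) • ((β_ (X i) (Y j)).inv ≫
      GradedObject.Monoidal.ιTensorObj X Y i j k ((add_comm i j).trans h))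
  hom_inv_id := by
    funext k
    apply GradedObject.Monoidal.tensorObj_ext
    intro i j h
    simp [← mul_smul, ← mul_pow]
  inv_hom_id := by
    funext k
    apply GradedObject.Monoidal.tensorObj_ext
    intro i j h
    simp [← mul_smul, ← mul_pow]

lemma signedBraiding_eq (X Y : GradedObject ℕ D) :
    (signedBraiding X Y).hom =
      (signTwist X Y).hom ≫ (GradedObject.Monoidal.braiding X Y).hom := by
  funext k
  apply GradedObject.Monoidal.tensorObj_ext
  intro i j h
  simp [signedBraiding, ι_signTwist_assoc, GradedObject.Monoidal.braiding]

namespace Aux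

open GradedObject
open GradedObject.Monoidal (ιTensorObj ιTensorObj₃ ιTensorObj₃')

lemma naturality_left {X X' : GradedObject ℕ D} (f : X ⟶ X') (Y : GradedObject ℕ D) :
    Monoidal.whiskerRight f Y ≫ (signedBraiding X' Y).hom =
      (signedBraiding X Y).hom ≫ Monoidal.whiskerLeft Y f := by
  have := signTwist_natural f (𝟙 Y)
  rw [signedBraiding_eq, signedBraiding_eq, ← Category.assoc, this, Category.assoc,
    Category.assoc, Monoidal.braiding_naturality_left]

lemma naturality_right {X X' : GradedObject ℕ D} (f : X ⟶ X') (Y : GradedObject ℕ D) :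
    Monoidal.whiskerLeft Y f ≫ (signedBraiding Y X').hom =
      (signedBraiding Y X).hom ≫ Monoidal.whiskerRight f Y := by
  have := signTwist_natural (𝟙 Y) f
  rw [signedBraiding_eq, signedBraiding_eq, ← Category.assoc, this, Category.assoc,
    Category.assoc, Monoidal.braiding_naturality_right]

lemma e1 (X Y Z : GradedObject ℕ D) (i₁ i₂ i₃ k : ℕ) (h : i₁ + i₂ + i₃ = k) :
    ιTensorObj₃ X Y Z i₁ i₂ i₃ k h ≫ (signTwist X (Monoidal.tensorObj Y Z)).hom k =
      ((-1 : ℤ) ^ (i₁ * (i₂ + i₃))) • ιTensorObj₃ X Y Z i₁ i₂ i₃ k h := by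
  rw [Monoidal.ιTensorObj₃_eq X Y Z i₁ i₂ i₃ k h _ rfl, Category.assoc,
    ι_signTwist X (Monoidal.tensorObj Y Z) i₁ (i₂ + i₃) k _, Preadditive.comp_zsmul]

lemma e1' (X Y Z : GradedObject ℕ D) (i₁ i₂ i₃ k : ℕ) (h : i₁ + i₂ + i₃ = k) :
    ιTensorObj₃' X Y Z i₁ i₂ i₃ k h ≫ (signTwist (Monoidal.tensorObj X Y) Z).hom k =
      ((-1 : ℤ) ^ ((i₁ + i₂) * i₃)) • ιTensorObj₃' X Y Z i₁ i₂ i₃ k h := by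
  rw [Monoidal.ιTensorObj₃'_eq X Y Z i₁ i₂ i₃ k h _ rfl, Category.assoc,
    ι_signTwist (Monoidal.tensorObj X Y) Z (i₁ + i₂) i₃ k _, Preadditive.comp_zsmul]

lemma e2 (X Y Z : GradedObject ℕ D) (i₁ i₂ i₃ k : ℕ) (h : i₁ + i₂ + i₃ = k) :
    ιTensorObj₃' X Y Z i₁ i₂ i₃ k h ≫ Monoidal.whiskerRight (signTwist X Y).hom Z k =
      ((-1 : ℤ) ^ (i₁ * i₂)) • ιTensorObj₃' X Y Z i₁ i₂ i₃ k h := by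
  rw [Monoidal.ιTensorObj₃'_eq X Y Z i₁ i₂ i₃ k h _ rfl, Category.assoc, Monoidal.ι_tensorHom,
    categoryOfGradedObjects_id, tensorHom_id, ← comp_whiskerRight_assoc, ι_signTwist,
    zsmul_whiskerRight, Preadditive.zsmul_comp]

lemma e2' (X Y Z : GradedObject ℕ D) (i₁ i₂ i₃ k : ℕ) (h : i₁ + i₂ + i₃ = k) :
    ιTensorObj₃ X Y Z i₁ i₂ i₃ k h ≫ Monoidal.whiskerLeft X (signTwist Y Z).hom k =
      ((-1 : ℤ) ^ (i₂ * i₃)) • ιTensorObj₃ X Y Z i₁ i₂ i₃ k h := by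
  rw [Monoidal.ιTensorObj₃_eq X Y Z i₁ i₂ i₃ k h _ rfl, Category.assoc, Monoidal.ι_tensorHom,
    categoryOfGradedObjects_id, id_tensorHom, ← whiskerLeft_comp_assoc, ι_signTwist,
    whiskerLeft_zsmul, Preadditive.zsmul_comp]

lemma e3 (X Y Z : GradedObject ℕ D) (i₁ i₂ i₃ k : ℕ) (h : i₁ + i₂ + i₃ = k) :
    ιTensorObj₃' X Y Z i₁ i₂ i₃ k h ≫ Monoidal.whiskerRight (Monoidal.braiding X Y).hom Z k =
      (β_ (X i₁) (Y i₂)).hom ▷ Z i₃ ≫ ιTensorObj₃' Y X Z i₂ i₁ i₃ k (by omega) := by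
  rw [Monoidal.ιTensorObj₃'_eq X Y Z i₁ i₂ i₃ k h _ rfl, Category.assoc, Monoidal.ι_tensorHom,
    categoryOfGradedObjects_id, tensorHom_id, ← comp_whiskerRight_assoc,
    Monoidal.ιTensorObj₃'_eq Y X Z i₂ i₁ i₃ k _ (i₁ + i₂) (add_comm i₂ i₁),
    ← comp_whiskerRight_assoc]
  simp only [Monoidal.braiding, Monoidal.ι_tensorObjDesc]

lemma e3' (X Y Z : GradedObject ℕ D) (i₁ i₂ i₃ k : ℕ) (h : i₁ + i₂ + i₃ = k) :
    ιTensorObj₃ X Y Z i₁ i₂ i₃ k h ≫ Monoidal.whiskerLeft X (Monoidal.braiding Y Z).hom k =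
      X i₁ ◁ (β_ (Y i₂) (Z i₃)).hom ≫ ιTensorObj₃ X Z Y i₁ i₃ i₂ k (by omega) := by
  rw [Monoidal.ιTensorObj₃_eq X Y Z i₁ i₂ i₃ k h _ rfl, Category.assoc, Monoidal.ι_tensorHom,
    categoryOfGradedObjects_id, id_tensorHom, ← whiskerLeft_comp_assoc,
    Monoidal.ιTensorObj₃_eq X Z Y i₁ i₃ i₂ k _ (i₂ + i₃) (add_comm i₃ i₂),
    ← whiskerLeft_comp_assoc]
  simp only [Monoidal.braiding, Monoidal.ι_tensorObjDesc]

lemma whiskerRight_comp' {X Y W : GradedObject ℕ D} (f : X ⟶ Y) (g : Y ⟶ W)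
    (Z : GradedObject ℕ D) :
    Monoidal.whiskerRight (f ≫ g) Z = Monoidal.whiskerRight f Z ≫ Monoidal.whiskerRight g Z := by
  simp [Monoidal.tensorHom_comp_tensorHom]

lemma whiskerLeft_comp' {X Y W : GradedObject ℕ D} (f : X ⟶ Y) (g : Y ⟶ W)
    (Z : GradedObject ℕ D) :
    Monoidal.whiskerLeft Z (f ≫ g) = Monoidal.whiskerLeft Z f ≫ Monoidal.whiskerLeft Z g := by
  simp [Monoidal.tensorHom_comp_tensorHom]

lemma hexagon_forward (X Y Z : GradedObject ℕ D) :
    (Monoidal.associator X Y Z).hom ≫ (signedBraiding X (Monoidal.tensorObj Y Z)).hom ≫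
        (Monoidal.associator Y Z X).hom =
      Monoidal.whiskerRight (signedBraiding X Y).hom Z ≫ (Monoidal.associator Y X Z).hom ≫
        Monoidal.whiskerLeft Y (signedBraiding X Z).hom := by
  have H := Monoidal.hexagon_forward X Y Z
  rw [signedBraiding_eq, signedBraiding_eq, signedBraiding_eq, whiskerRight_comp',
    whiskerLeft_comp']
  funext k
  apply Monoidal.tensorObj₃'_ext
  intro i₁ i₂ i₃ h
  have Hk := congrArg (fun t => ((-1 : ℤ) ^ (i₁ * i₂ + i₁ * i₃)) •
    (ιTensorObj₃' X Y Z i₁ i₂ i₃ k h ≫ t k)) H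
  have E1 := e1 X Y Z i₁ i₂ i₃ k h
  have E2 := e2 X Y Z i₁ i₂ i₃ k h
  have E3 := e3 X Y Z i₁ i₂ i₃ k h
  have E4 := e2' Y X Z i₂ i₁ i₃ k (by omega)
  simp only [categoryOfGradedObjects_comp, Category.assoc] at Hk ⊢
  rw [Monoidal.ιTensorObj₃'_associator_hom_assoc, reassoc_of% E1, mul_add,
    Preadditive.zsmul_comp, Preadditive.comp_zsmul,
    ← Monoidal.ιTensorObj₃'_associator_hom_assoc, Hk,
    reassoc_of% E2, Preadditive.zsmul_comp, reassoc_of% E3, reassoc_of% E3,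
    Monoidal.ιTensorObj₃'_associator_hom_assoc, Monoidal.ιTensorObj₃'_associator_hom_assoc,
    reassoc_of% E4, Preadditive.zsmul_comp, Preadditive.comp_zsmul, Preadditive.comp_zsmul,
    ← mul_smul, ← pow_add]

lemma hexagon_reverse (X Y Z : GradedObject ℕ D) :
    (Monoidal.associator X Y Z).inv ≫ (signedBraiding (Monoidal.tensorObj X Y) Z).hom ≫
        (Monoidal.associator Z X Y).inv =
      Monoidal.whiskerLeft X (signedBraiding Y Z).hom ≫ (Monoidal.associator X Z Y).inv ≫
        Monoidal.whiskerRight (signedBraiding X Z).hom Y := by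
  have H := Monoidal.hexagon_reverse X Y Z
  rw [signedBraiding_eq, signedBraiding_eq, signedBraiding_eq, whiskerRight_comp',
    whiskerLeft_comp']
  funext k
  apply Monoidal.tensorObj₃_ext
  intro i₁ i₂ i₃ h
  have Hk := congrArg (fun t => ((-1 : ℤ) ^ (i₁ * i₃ + i₂ * i₃)) •
    (ιTensorObj₃ X Y Z i₁ i₂ i₃ k h ≫ t k)) H
  have E1 := e1' X Y Z i₁ i₂ i₃ k h
  have E2 := e2' X Y Z i₁ i₂ i₃ k h
  have E3 := e3' X Y Z i₁ i₂ i₃ k h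
  have E4 := e2 X Z Y i₁ i₃ i₂ k (by omega)
  simp only [categoryOfGradedObjects_comp, Category.assoc] at Hk ⊢
  rw [Monoidal.ιTensorObj₃_associator_inv_assoc, reassoc_of% E1, add_mul,
    Preadditive.zsmul_comp, Preadditive.comp_zsmul,
    ← Monoidal.ιTensorObj₃_associator_inv_assoc, Hk,
    reassoc_of% E2, Preadditive.zsmul_comp, reassoc_of% E3, reassoc_of% E3,
    Monoidal.ιTensorObj₃_associator_inv_assoc, Monoidal.ιTensorObj₃_associator_inv_assoc,
    reassoc_of% E4, Preadditive.zsmul_comp, Preadditive.comp_zsmul, Preadditive.comp_zsmul,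
    ← mul_smul, ← pow_add, add_comm (i₁ * i₃)]

end Aux

instance : BraidedCategory (NGraded D) where
  braiding X Y := signedBraiding X Y
  braiding_naturality_left f Y := Aux.naturality_left f Y
  braiding_naturality_right X _ _ f := Aux.naturality_right f X
  hexagon_forward X Y Z := Aux.hexagon_forward X Y Z
  hexagon_reverse X Y Z := Aux.hexagon_reverse X Y Z

end Graded

/-! ### Reduced words of permutations -/

section Words

/-- The adjacent transposition exchanging the places `i` and `i + 1` (counted from `0`). -/
def adjSwap (j : ℕ) (i : {i : ℕ // i + 1 < j}) : Equiv.Perm (Fin j) :=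
  Equiv.swap ⟨i.1, by omega⟩ ⟨i.1 + 1, i.2⟩

/-- The product `s_{i₁} s_{i₂} ⋯ s_{iᵣ}` of adjacent transpositions. -/
def wordPerm {j : ℕ} (w : List {i : ℕ // i + 1 < j}) : Equiv.Perm (Fin j) :=
  (w.map (adjSwap j)).prod

/-- `w` is a reduced word of `σ`. -/
def IsReducedWord {j : ℕ} (w : List {i : ℕ // i + 1 < j}) (σ : Equiv.Perm (Fin j)) : Prop :=
  wordPerm w = σ ∧ ∀ w' : List {i : ℕ // i + 1 < j}, wordPerm w' = σ → w.length ≤ w'.length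

lemma exists_wordPerm_eq {j : ℕ} (σ : Equiv.Perm (Fin j)) :
    ∃ w : List {i : ℕ // i + 1 < j}, wordPerm w = σ := by
  cases j with
  | zero => exact ⟨[], Subsingleton.elim _ _⟩
  | succ n =>
    have hσ : σ ∈ Submonoid.closure
        (Set.range fun i : Fin n => Equiv.swap i.castSucc i.succ) := by
      rw [Equiv.Perm.mclosure_swap_castSucc_succ]
      trivial
    induction hσ using Submonoid.closure_induction with
    | mem x hx =>
      obtain ⟨i, rfl⟩ := hx
      refine ⟨[⟨i.1, by omega⟩], ?_⟩
      simp only [wordPerm, adjSwap, List.map_cons, List.map_nil, List.prod_cons, List.prod_nil,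
        mul_one]
      rfl
    | one => exact ⟨[], rfl⟩
    | mul x y _ _ hx hy =>
      obtain ⟨a, rfl⟩ := hx
      obtain ⟨b, rfl⟩ := hy
      exact ⟨a ++ b, by simp [wordPerm]⟩

lemma exists_isReducedWord {j : ℕ} (σ : Equiv.Perm (Fin j)) :
    ∃ w : List {i : ℕ // i + 1 < j}, IsReducedWord w σ := by
  classical
  have h : ∃ n, ∃ w : List {i : ℕ // i + 1 < j}, wordPerm w = σ ∧ w.length = n := by
    obtain ⟨w, hw⟩ := exists_wordPerm_eq σ
    exact ⟨_, w, hw, rfl⟩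
  obtain ⟨w, hw, hn⟩ := Nat.find_spec h
  exact ⟨w, hw, fun w' hw' => hn.le.trans (Nat.find_min' h ⟨w', hw', rfl⟩)⟩

/-- A reduced word of `σ`. -/
def reducedWord {j : ℕ} (σ : Equiv.Perm (Fin j)) : List {i : ℕ // i + 1 < j} :=
  (exists_isReducedWord σ).choose

/-- The length `l(σ)` of a permutation. -/
def permLength {j : ℕ} (σ : Equiv.Perm (Fin j)) : ℕ := (reducedWord σ).length

open Classical in
/-- The shuffle permutations `S_{(k,l)}` in `S_{k+l}`. Since `σ⁻¹ p` is the number which `σ` brings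
to the place `p`, the conditions say that `σ` brings `k` numbers to the first `k` places and the
remaining `l` numbers to the last `l` places, in both cases without changing their order. -/
def shuffles (k l : ℕ) : Finset (Equiv.Perm (Fin (k + l))) :=
  Finset.univ.filter fun σ =>
    StrictMono (fun p : Fin k => σ⁻¹ (Fin.castAdd l p)) ∧
      StrictMono (fun p : Fin l => σ⁻¹ (Fin.natAdd k p))

open Classical in
/-- The permutations `S^{(k,l)}` inverse to the shuffle permutations `S_{(k,l)}`. -/
def inverseShuffles (k l : ℕ) : Finset (Equiv.Perm (Fin (k + l))) :=
  Finset.univ.filter fun σ => σ⁻¹ ∈ shuffles k l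

end Words

/-! ### Tensor powers and the braid group action -/

section Powers

variable {D : Type u} [Category.{v} D] [MonoidalCategory D]

/-- The tensor power `X^{⊗ j}`, bracketed to the left. -/
def tpow (X : D) : ℕ → D
  | 0 => 𝟙_ D
  | n + 1 => tpow X n ⊗ X

/-- The canonical isomorphism `X^{⊗ n} ⊗ X^{⊗ m} ≅ X^{⊗ (n + m)}`. -/
def tpowMul (X : D) (n : ℕ) : (m : ℕ) → (tpow X n ⊗ tpow X m ≅ tpow X (n + m))
  | 0 => ρ_ (tpow X n)
  | m + 1 => (α_ (tpow X n) (tpow X m) X).symm ≪≫ whiskerRightIso (tpowMul X n m) X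

variable [BraidedCategory D]

/-- The braiding `Ψ_{X,X}` applied to the tensor factors of `X^{⊗ j}` at the places `i` and `i + 1`
(counted from `0`); it is used for `i + 1 < j` only. -/
def adjBraiding (X : D) : (j : ℕ) → ℕ → (tpow X j ⟶ tpow X j)
  | 0, _ => 𝟙 _
  | 1, _ => 𝟙 _
  | k + 2, i =>
    if i = k then (α_ (tpow X k) X X).hom ≫ tpow X k ◁ (β_ X X).hom ≫ (α_ (tpow X k) X X).inv
    else adjBraiding X (k + 1) i ▷ X

/-- The composite `Ψ_{i₁} ∘ Ψ_{i₂} ∘ ⋯ ∘ Ψ_{iᵣ}` (the last letter acts first). -/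
def wordBraid (X : D) {j : ℕ} : List {i : ℕ // i + 1 < j} → (tpow X j ⟶ tpow X j)
  | [] => 𝟙 _
  | i :: w => wordBraid X w ≫ adjBraiding X j i.1

/-- The action on `X^{⊗ j}` of the section `S_j → B_j` at `σ`: the composite of the `Ψ_i` along a
reduced word of `σ`. As the `Ψ_i` satisfy the braid relations, any reduced word gives the same
morphism. -/
def permBraid (X : D) {j : ℕ} (σ : Equiv.Perm (Fin j)) : tpow X j ⟶ tpow X j :=
  wordBraid X (reducedWord σ)

variable [Preadditive D]

/-- `(-1)^{l(σ)} σ_D(X)`. -/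
def signedPermBraid (X : D) {j : ℕ} (σ : Equiv.Perm (Fin j)) : tpow X j ⟶ tpow X j :=
  ((-1 : ℤ) ^ permLength σ) • permBraid X σ

/-- The braided antisymmetrizer `A_j(X)`. -/
def antisymmetrizer (X : D) (j : ℕ) : tpow X j ⟶ tpow X j :=
  ∑ σ : Equiv.Perm (Fin j), signedPermBraid X σ

/-- `A_{(k,l)}(X)`, the signed sum over the shuffle permutations `S_{(k,l)}`. -/
def shuffleSum (X : D) (k l : ℕ) : tpow X (k + l) ⟶ tpow X (k + l) :=
  ∑ σ ∈ shuffles k l, signedPermBraid X σ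

/-- `A^{(k,l)}(X)`, the signed sum over the permutations `S^{(k,l)}`. -/
def inverseShuffleSum (X : D) (k l : ℕ) : tpow X (k + l) ⟶ tpow X (k + l) :=
  ∑ σ ∈ inverseShuffles k l, signedPermBraid X σ

end Powers

/-! ### The tensor Hopf algebra, the dual shuffle Hopf algebra, and the exterior algebra -/

section Algebras

variable {D : Type u} [Category.{v} D] [Abelian D] [MonoidalCategory D] [MonoidalPreadditive D]

/-- The morphism of graded objects `A ⊗ B ⟶ C` with the components `f n m : Aₙ ⊗ Bₘ ⟶ Cₙ₊ₘ`. -/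
def mulOfComponents {A B C : GradedObject ℕ D} (f : ∀ n m : ℕ, A n ⊗ B m ⟶ C (n + m)) :
    GradedObject.Monoidal.tensorObj A B ⟶ C :=
  fun _ => GradedObject.Monoidal.tensorObjDesc fun n m h => f n m ≫ eqToHom (congrArg C h)

/-- The morphism of graded objects `C ⟶ A ⊗ B` with the components `f n m : Cₙ₊ₘ ⟶ Aₙ ⊗ Bₘ`. -/
def comulOfComponents {A B C : GradedObject ℕ D} (f : ∀ n m : ℕ, C (n + m) ⟶ A n ⊗ B m) :
    C ⟶ GradedObject.Monoidal.tensorObj A B :=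
  fun k => ∑ n : Fin (k + 1),
    eqToHom (congrArg C (Nat.add_sub_cancel' n.is_le).symm) ≫ f n (k - n) ≫
      GradedObject.Monoidal.ιTensorObj A B n (k - n) k (Nat.add_sub_cancel' n.is_le)

/-- The object `(𝟙, X, X ⊗ X, …)` underlying the tensor Hopf algebra `T(X)`. -/
def tensorAlg (X : D) : NGraded D := fun j : ℕ => tpow X j

/-- The object `(𝟙, X, X ⊗ X, …)` underlying the dual shuffle Hopf algebra `T°(X)`. -/
def shuffleAlg (X : D) : NGraded D := fun j : ℕ => tpow X j

/-- The unit: the identity of `𝟙` in degree `0`, and `0` in the other degrees. -/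
def unitHom (X : D) :
    (GradedObject.Monoidal.tensorUnit : GradedObject ℕ D) ⟶ (fun j : ℕ => tpow X j)
  | 0 => GradedObject.Monoidal.tensorUnit₀.hom
  | _ + 1 => 0

/-- The counit: the identity of `𝟙` in degree `0`, and `0` in the other degrees. -/
def counitHom (X : D) :
    (fun j : ℕ => tpow X j) ⟶ (GradedObject.Monoidal.tensorUnit : GradedObject ℕ D)
  | 0 => GradedObject.Monoidal.tensorUnit₀.inv
  | _ + 1 => 0

/-- The unit of `T(X)`. -/
def tensorOne (X : D) : 𝟙_ (NGraded D) ⟶ tensorAlg X := unitHom X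

/-- The counit of `T(X)`. -/
def tensorCounit (X : D) : tensorAlg X ⟶ 𝟙_ (NGraded D) := counitHom X

/-- The unit of `T°(X)`. -/
def shuffleOne (X : D) : 𝟙_ (NGraded D) ⟶ shuffleAlg X := unitHom X

/-- The counit of `T°(X)`. -/
def shuffleCounit (X : D) : shuffleAlg X ⟶ 𝟙_ (NGraded D) := counitHom X

/-- The product of `T(X)`: concatenation. -/
def tensorMul (X : D) : tensorAlg X ⊗ tensorAlg X ⟶ tensorAlg X :=
  mulOfComponents (A := fun j => tpow X j) (B := fun j => tpow X j) (C := fun j => tpow X j)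
    fun n m => (tpowMul X n m).hom

/-- The coproduct of `T°(X)`: deconcatenation. -/
def shuffleComul (X : D) : shuffleAlg X ⟶ shuffleAlg X ⊗ shuffleAlg X :=
  comulOfComponents (A := fun j => tpow X j) (B := fun j => tpow X j) (C := fun j => tpow X j)
    fun n m => (tpowMul X n m).inv

variable [BraidedCategory D]

/-- The coproduct of `T(X)`, with the components `A_{(n,m)}(X)`. -/
def tensorComul (X : D) : tensorAlg X ⟶ tensorAlg X ⊗ tensorAlg X :=
  comulOfComponents (A := fun j => tpow X j) (B := fun j => tpow X j) (C := fun j => tpow X j)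
    fun n m => shuffleSum X n m ≫ (tpowMul X n m).inv

/-- The product of `T°(X)`, with the components `A^{(n,m)}(X)`. -/
def shuffleMul (X : D) : shuffleAlg X ⊗ shuffleAlg X ⟶ shuffleAlg X :=
  mulOfComponents (A := fun j => tpow X j) (B := fun j => tpow X j) (C := fun j => tpow X j)
    fun n m => (tpowMul X n m).hom ≫ inverseShuffleSum X n m

/-- The component `X^{⊗ j} ⟶ X^{⊗ j}` of the antipodes of `T(X)` and of `T°(X)`:
`(-1)^j (-1)^{l(σ)} σ_D(X)` for the order reversing permutation `σ`. -/
def antipodeComponent (X : D) (j : ℕ) : tpow X j ⟶ tpow X j :=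
  ((-1 : ℤ) ^ j) • signedPermBraid X (Fin.revPerm : Equiv.Perm (Fin j))

/-- The antipode of `T(X)`. -/
def tensorAntipode (X : D) : tensorAlg X ⟶ tensorAlg X := fun j : ℕ => antipodeComponent X j

/-- The antipode of `T°(X)`. -/
def shuffleAntipode (X : D) : shuffleAlg X ⟶ shuffleAlg X := fun j : ℕ => antipodeComponent X j

/-- The morphism `Â(X)` with the components `A_j(X)`. -/
def antisym (X : D) : tensorAlg X ⟶ shuffleAlg X := fun j : ℕ => antisymmetrizer X j

/-- The object `T^∧(X)`, the coimage of `Â(X)`, formed in each degree (as all limits and colimits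
of graded objects). -/
def exteriorAlg (X : D) : NGraded D := fun j : ℕ => Abelian.coimage (antisymmetrizer X j)

/-- The projection of `T(X)` onto the coimage of `Â(X)`. -/
def exteriorProj (X : D) : tensorAlg X ⟶ exteriorAlg X :=
  fun j : ℕ => Abelian.coimage.π (antisymmetrizer X j)

/-- The monomorphism from the coimage of `Â(X)` to `T°(X)` through which `Â(X)` factors. -/
def exteriorIncl (X : D) : exteriorAlg X ⟶ shuffleAlg X :=
  fun j : ℕ => Abelian.factorThruCoimage (antisymmetrizer X j)

end Algebras

end

end BraidedExterior

/-!
The proof rests on the fact that `T(X)` is generated by its part `X` of degree `1`: the iterated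
products of the inclusion `i : X ⟶ T(X)` are jointly epimorphic, also after tensoring with another
object (`Generates`, `generates_genIncl`). Hence a morphism out of `T(X)` is a morphism of algebras
as soon as it respects the products `a ⊗ x ↦ a x` with a generator `x` on the right
(`Generates.isMonHom`), and two morphisms of algebras which agree on the generators are equal
(`Generates.monHom_ext`).

Consequently the Hopf algebra axioms for `T(X)` reduce to rules for the values of the counit, the
coproduct and the antipode on `a x`; these rules are collected in `TensorHopfData`. The rule
for the coproduct, `Δ(a x) = Δ(a) (1 ⊗ x + x ⊗ 1)`, says in degree `(k, l)` that

  `A_{(k,l)} = A_{(k,l-1)} ⊗ id + (A_{(k-1,l)} ⊗ id)` followed by a signed cyclic braid,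

which is a Pascal rule: a shuffle brings the last number either to the last place or to the place
`k` (`shuffleSumAt_succ`). The rule for the antipode is the corresponding decomposition of the
order-reversing permutation. To decompose the braid of a permutation in this way one has to know
that all its reduced words give the same morphism. This is Matsumoto's theorem for the action of
the braid group (`IsReducedWord.wordBraid_eq`). It is proved with a canonical word, defined
by recursion from the place of the last number: if an adjacent transposition increases the length,
then the braid of the canonical word is multiplied by the corresponding generator, by the braid
relations (`canonicalWord_adjSwap_mul`).

The Hopf algebra `T°(X)` is obtained from the same abstract theorem in the opposite category, where
deconcatenation is a product and the projection `T°(X) ⟶ X` generates; the Pascal rule is then the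
one for the inverses of the shuffles (`shuffleHopfData`, `hopfObjOfOp`).

The morphism `Â(X)` respects products with a generator because of
`A_{n+1} = A^{(n,1)} ∘ (A_n ⊗ id)` (`antisymmetrizer_succ'`), so it is a morphism of algebras. Then
`Â ≫ Δ` and `Δ ≫ (Â ⊗ Â)` are morphisms of algebras which agree on `X`, so they are equal.

Finally `Â(X)` is an epimorphism `p` followed by a monomorphism `j`. Since the tensor product is
exact, `p ⊗ p` is an epimorphism and `j ⊗ j` a monomorphism, and the product, the coproduct
and the antipode of `T^∧(X)` are the diagonals of commutative squares with an epimorphism on one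
side and a monomorphism on the other (`nonempty_hopfFactorization`). The axioms, and the uniqueness,
follow by cancelling `j`, `p` or `p ⊗ p`.
-/

namespace BraidedExterior

set_option linter.unusedSectionVars false

noncomputable section

universe v u

/-! ### Monoid objects generated by an object -/

section Generation

variable {C : Type u} [Category.{v} C] [MonoidalCategory C]

/-- The monomials in the generators `i : x ⟶ T` of a monoid object `T`: the morphisms
`x ⊗ ⋯ ⊗ x ⟶ T` obtained by multiplying copies of `i`, bracketed to the left. -/
inductive Monomial {x T : C} [MonObj T] (i : x ⟶ T) : {P : C} → (P ⟶ T) → Prop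
  | one : Monomial i η[T]
  | mul {P : C} {p : P ⟶ T} (hp : Monomial i p) : Monomial i ((p ⊗ₘ i) ≫ μ[T])

/-- A monoid object `T` is generated by `i : x ⟶ T` if the monomials are jointly epimorphic,
also after tensoring with a further object on the left. -/
def Generates {x T : C} [MonObj T] (i : x ⟶ T) : Prop :=
  ∀ ⦃W B : C⦄ (f g : W ⊗ T ⟶ B),
    (∀ ⦃P : C⦄ (p : P ⟶ T), Monomial i p → W ◁ p ≫ f = W ◁ p ≫ g) → f = g

namespace Generates

variable {x T : C} [MonObj T] {i : x ⟶ T}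

lemma hom_ext (hi : Generates i) {B : C} {f g : T ⟶ B}
    (h : ∀ ⦃P : C⦄ (p : P ⟶ T), Monomial i p → p ≫ f = p ≫ g) : f = g := by
  rw [← cancel_epi (λ_ T).hom]
  apply hi
  intro P p hp
  simp [h p hp]

/-- A morphism out of `T` is a monoid morphism as soon as it respects products whose right factor
is a generator. -/
lemma isMonHom (hi : Generates i) {B : C} [MonObj B] (f : T ⟶ B) (h1 : η[T] ≫ f = η[B])
    (h2 : T ◁ i ≫ μ[T] ≫ f = (f ⊗ₘ (i ≫ f)) ≫ μ[B]) : IsMonHom f := by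
  refine ⟨h1, hi _ _ fun P p hp => ?_⟩
  suffices h : T ◁ p ≫ μ[T] ≫ f = (f ⊗ₘ (p ≫ f)) ≫ μ[B] by
    rw [h]; simp [MonoidalCategory.tensorHom_def, whisker_exchange_assoc]
  induction hp with
  | one => simp [h1, MonoidalCategory.tensorHom_def]
  | @mul P p hp ih =>
    have hs : ((p ⊗ₘ i) ≫ μ) ≫ f = ((p ≫ f) ⊗ₘ (i ≫ f)) ≫ μ[B] := by
      rw [MonoidalCategory.tensorHom_def, Category.assoc, Category.assoc, h2]
      simp [MonoidalCategory.tensorHom_def]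
    have e : T ◁ ((p ⊗ₘ i) ≫ μ) ≫ μ[T] ≫ f =
        (α_ T P x).inv ≫ ((T ◁ p ≫ μ[T]) ▷ x) ≫ T ◁ i ≫ μ[T] ≫ f := by
      simp only [MonoidalCategory.tensorHom_def, MonoidalCategory.whiskerLeft_comp, Category.assoc,
        MonObj.mul_assoc_flip_assoc, comp_whiskerRight]
      rw [associator_inv_naturality_right_assoc, associator_inv_naturality_middle_assoc,
        whisker_exchange_assoc]
    rw [hs, e, h2, MonoidalCategory.tensorHom_def f, Category.assoc, ← comp_whiskerRight_assoc,
      Category.assoc, ih]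
    simp only [MonoidalCategory.tensorHom_def, MonoidalCategory.whiskerLeft_comp, Category.assoc,
      MonObj.mul_assoc_flip, comp_whiskerRight]
    simp only [associator_inv_naturality_right_assoc, associator_inv_naturality_middle_assoc,
      associator_inv_naturality_left_assoc, whisker_exchange_assoc]

/-- Two monoid morphisms out of `T` which agree on the generators are equal. -/
lemma monHom_ext (hi : Generates i) {B : C} [MonObj B] (f g : T ⟶ B) [IsMonHom f] [IsMonHom g]
    (h : i ≫ f = i ≫ g) : f = g := by
  refine hi.hom_ext fun P p hp => ?_
  induction hp with
  | one => simp
  | mul hp ih => simp [IsMonHom.mul_hom, ih, h]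

end Generates

end Generation

/-! ### Products with a generator -/

section Products

variable {C : Type u} [Category.{v} C] [MonoidalCategory C]

/-- Right multiplication by a generator. -/
abbrev mulGen {x T : C} [MonObj T] (i : x ⟶ T) : T ⊗ x ⟶ T := T ◁ i ≫ μ[T]

/-- `(a ⊗ b) ⊗ x ↦ a ⊗ bx`. -/
abbrev mulSnd {x T : C} (m : T ⊗ x ⟶ T) : (T ⊗ T) ⊗ x ⟶ T ⊗ T :=
  (α_ T T x).hom ≫ T ◁ m

variable {x T : C} [MonObj T]

/-- Right multiplication by `x`, applied to the unit. -/
lemma one_mulGen (i : x ⟶ T) : (λ_ x).inv ≫ η[T] ▷ x ≫ mulGen i = i := by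
  rw [mulGen, ← whisker_exchange_assoc]
  simp

lemma one_mulSnd (m : T ⊗ x ⟶ T) :
    (λ_ x).inv ≫ ((λ_ (𝟙_ C)).inv ≫ (η[T] ⊗ₘ η[T])) ▷ x ≫ mulSnd m =
      ((λ_ x).inv ≫ η[T] ▷ x ≫ m) ≫ (λ_ T).inv ≫ η[T] ▷ T := by
  simp only [mulSnd, MonoidalCategory.tensorHom_def', comp_whiskerRight, Category.assoc,
    associator_naturality_left_assoc, ← whisker_exchange, leftUnitor_inv_naturality_assoc,
    MonoidalCategory.whiskerLeft_comp, associator_naturality_middle_assoc]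
  monoidal

variable [BraidedCategory C]

/-- `(a ⊗ b) ⊗ x ↦ a Ψ(b ⊗ x)`, the two tensor factors being multiplied separately. -/
abbrev mulFst {x T : C} (m : T ⊗ x ⟶ T) : (T ⊗ T) ⊗ x ⟶ T ⊗ T :=
  (α_ T T x).hom ≫ T ◁ (β_ T x).hom ≫ (α_ T x T).inv ≫ m ▷ T

lemma one_mulFst (m : T ⊗ x ⟶ T) :
    (λ_ x).inv ≫ ((λ_ (𝟙_ C)).inv ≫ (η[T] ⊗ₘ η[T])) ▷ x ≫ mulFst m =
      ((λ_ x).inv ≫ η[T] ▷ x ≫ m) ≫ (ρ_ T).inv ≫ T ◁ η[T] := by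
  simp only [mulFst, MonoidalCategory.tensorHom_def, comp_whiskerRight, Category.assoc,
    associator_naturality_middle_assoc, ← MonoidalCategory.whiskerLeft_comp_assoc,
    BraidedCategory.braiding_naturality_left]
  simp only [MonoidalCategory.whiskerLeft_comp, Category.assoc,
    associator_inv_naturality_right_assoc, whisker_exchange, rightUnitor_inv_naturality_assoc,
    braiding_tensorUnit_left]
  monoidal

lemma tensorμ_unit_left (T : C) :
    (T ⊗ T) ◁ (λ_ T).inv ≫ tensorμ T T (𝟙_ C) T ≫ (ρ_ T).hom ▷ (T ⊗ T) = (α_ T T T).hom := by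
  simp only [tensorμ, braiding_tensorUnit_right, comp_whiskerRight]
  monoidal

lemma tensorμ_unit_right (T : C) :
    (T ⊗ T) ◁ (ρ_ T).inv ≫ tensorμ T T T (𝟙_ C) ≫ (T ⊗ T) ◁ (ρ_ T).hom =
      (α_ T T T).hom ≫ T ◁ (β_ T T).hom ≫ (α_ T T T).inv := by
  simp only [tensorμ]
  monoidal

end Products

section Primitive

variable {C : Type u} [Category.{v} C] [MonoidalCategory C] [Preadditive C]

/-- `a ↦ 1 ⊗ a + a ⊗ 1`. -/
def prim (T : C) [MonObj T] : T ⟶ T ⊗ T :=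
  (λ_ T).inv ≫ η[T] ▷ T + (ρ_ T).inv ≫ T ◁ η[T]

lemma prim_naturality {A B : C} [MonObj A] [MonObj B] (f : A ⟶ B) [IsMonHom f] :
    prim A ≫ (f ⊗ₘ f) = f ≫ prim B := by
  rw [prim, prim, Preadditive.add_comp, Preadditive.comp_add, Category.assoc, Category.assoc]
  congr 1
  · rw [MonoidalCategory.tensorHom_def, ← comp_whiskerRight_assoc, IsMonHom.one_hom,
      leftUnitor_inv_naturality_assoc, whisker_exchange]
  · rw [MonoidalCategory.tensorHom_def', ← MonoidalCategory.whiskerLeft_comp_assoc,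
      IsMonHom.one_hom, rightUnitor_inv_naturality_assoc, whisker_exchange]

end Primitive

/-! ### Hopf monoids determined by products with a generator -/

section Hopf

lemma neg_whiskerRight {C : Type u} [Category.{v} C] [MonoidalCategory C] [Preadditive C]
    [MonoidalPreadditive C] {A B : C} (f : A ⟶ B) (Z : C) : (-f) ▷ Z = -(f ▷ Z) :=
  map_neg ((tensoringRight C).obj Z).mapAddHom f

lemma whiskerLeft_neg {C : Type u} [Category.{v} C] [MonoidalCategory C] [Preadditive C]
    [MonoidalPreadditive C] {A B : C} (f : A ⟶ B) (Z : C) : Z ◁ (-f) = -(Z ◁ f) :=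
  map_neg ((tensoringLeft C).obj Z).mapAddHom f

variable {C : Type u} [Category.{v} C] [MonoidalCategory C] [BraidedCategory C] [Preadditive C]
  [MonoidalPreadditive C]

/-- The counit, coproduct and antipode of a Hopf monoid `T` generated by `i : x ⟶ T`, described by
their values on the unit and on the products `a x` with a generator: `ε(a x) = 0`,
`Δ(a x) = Δ(a) (1 ⊗ x + x ⊗ 1)`, and `S(a x) = - x S(a)` with the factors exchanged by the
braiding. Nothing else is required; the Hopf monoid axioms are consequences. -/
structure TensorHopfData {x T : C} [MonObj T] (i : x ⟶ T) where
  generates : Generates i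
  counit : T ⟶ 𝟙_ C
  comul : T ⟶ T ⊗ T
  antipode : T ⟶ T
  one_counit : η[T] ≫ counit = 𝟙 _
  mulGen_counit : mulGen i ≫ counit = 0
  one_comul : η[T] ≫ comul = (λ_ _).inv ≫ (η[T] ⊗ₘ η[T])
  mulGen_comul : mulGen i ≫ comul = comul ▷ x ≫ (mulSnd (mulGen i) + mulFst (mulGen i))
  one_antipode : η[T] ≫ antipode = η[T]
  mulGen_antipode : mulGen i ≫ antipode = - (antipode ▷ x ≫ (β_ T x).hom ≫ i ▷ T ≫ μ[T])

namespace TensorHopfData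

variable {x T : C} [MonObj T] {i : x ⟶ T} (d : TensorHopfData i)

lemma gen_comul : i ≫ d.comul = i ≫ prim T := by
  have h := congrArg (· ≫ d.comul) (one_mulGen i).symm
  refine h.trans ?_
  rw [Category.assoc, Category.assoc, d.mulGen_comul, ← comp_whiskerRight_assoc,
    d.one_comul, Preadditive.comp_add, Preadditive.comp_add, one_mulSnd, one_mulFst,
    one_mulGen, prim, Preadditive.comp_add]

lemma gen_counit : i ≫ d.counit = 0 := by
  have h := congrArg (· ≫ d.counit) (one_mulGen i).symm
  refine h.trans ?_
  rw [Category.assoc, Category.assoc, d.mulGen_counit]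
  simp

/-- Right multiplication by `1 ⊗ a + a ⊗ 1` in the braided tensor product algebra `T ⊗ T`. -/
lemma prim_mul (T : C) [MonObj T] :
    (T ⊗ T) ◁ prim T ≫ μ[T ⊗ T] = mulSnd μ[T] + mulFst μ[T] := by
  rw [prim, MonoidalPreadditive.whiskerLeft_add, Preadditive.add_comp, MonObj.tensorObj.mul_def]
  congr 1
  · have h := tensorμ_natural_right T T η[T] (𝟙 T)
    rw [MonoidalCategory.tensorHom_id, MonoidalCategory.whiskerLeft_id,
      MonoidalCategory.tensorHom_id] at h
    rw [MonoidalCategory.whiskerLeft_comp, Category.assoc, reassoc_of% h,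
      MonoidalCategory.tensorHom_def, ← comp_whiskerRight_assoc, MonObj.mul_one, mulSnd,
      ← tensorμ_unit_left]
    simp only [Category.assoc]
  · have h := tensorμ_natural_right T T (𝟙 T) η[T]
    rw [MonoidalCategory.id_tensorHom, MonoidalCategory.whiskerLeft_id,
      MonoidalCategory.id_tensorHom] at h
    rw [MonoidalCategory.whiskerLeft_comp, Category.assoc, reassoc_of% h,
      MonoidalCategory.tensorHom_def', ← MonoidalCategory.whiskerLeft_comp_assoc, MonObj.mul_one,
      mulFst]
    have h' := tensorμ_unit_right T
    rw [← reassoc_of% h']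

lemma gen_prim_mul (i : x ⟶ T) :
    (T ⊗ T) ◁ (i ≫ prim T) ≫ μ[T ⊗ T] = mulSnd (mulGen i) + mulFst (mulGen i) := by
  rw [MonoidalCategory.whiskerLeft_comp, Category.assoc, prim_mul, Preadditive.comp_add]
  congr 1
  · simp [mulSnd, mulGen]
  · simp only [mulFst, mulGen, comp_whiskerRight, tensor_whiskerLeft, Category.assoc,
      Iso.inv_hom_id_assoc]
    rw [← MonoidalCategory.whiskerLeft_comp_assoc, BraidedCategory.braiding_naturality_right]
    simp only [MonoidalCategory.whiskerLeft_comp, Category.assoc,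
      associator_inv_naturality_middle_assoc]

lemma isMonHom_comul : IsMonHom d.comul := by
  refine d.generates.isMonHom _ ?_ ?_
  · exact d.one_comul
  · rw [d.gen_comul, ← Category.assoc, d.mulGen_comul, ← gen_prim_mul]
    simp [MonoidalCategory.tensorHom_def]

lemma isMonHom_counit : IsMonHom d.counit := by
  refine d.generates.isMonHom _ ?_ ?_
  · exact d.one_counit
  · rw [← Category.assoc, d.mulGen_counit, d.gen_counit]
    simp

/-- On `a x` the two parts of the coproduct give the terms `a₁ S(a₂ x)` and `a₁ Ψ(a₂ ⊗ x)` with `S`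
applied to the last factor; these cancel by the rule for `S(a₂ x)`, so the convolution vanishes on
all monomials but the unit. -/
lemma antipode_right : d.comul ≫ T ◁ d.antipode ≫ μ[T] = d.counit ≫ η[T] := by
  have key : mulGen i ≫ d.comul ≫ T ◁ d.antipode ≫ μ[T] = 0 := by
    have h1 : mulSnd (mulGen i) ≫ T ◁ d.antipode ≫ μ[T] =
        - ((α_ T T x).hom ≫ T ◁ (d.antipode ▷ x ≫ (β_ T x).hom ≫ i ▷ T ≫ μ[T]) ≫ μ[T]) := by
      rw [mulSnd, Category.assoc, ← MonoidalCategory.whiskerLeft_comp_assoc, d.mulGen_antipode,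
        whiskerLeft_neg, Preadditive.neg_comp, Preadditive.comp_neg]
    have h2 : mulFst (mulGen i) ≫ T ◁ d.antipode ≫ μ[T] =
        ((α_ T T x).hom ≫ T ◁ (d.antipode ▷ x ≫ (β_ T x).hom ≫ i ▷ T ≫ μ[T]) ≫ μ[T]) := by
      rw [BraidedCategory.braiding_naturality_left_assoc, whisker_exchange_assoc]
      simp only [mulFst, mulGen, MonoidalCategory.whiskerLeft_comp, comp_whiskerRight,
        Category.assoc, MonObj.mul_assoc_flip, ← whisker_exchange_assoc]
      simp only [associator_inv_naturality_right_assoc, associator_inv_naturality_middle_assoc]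
    rw [← Category.assoc, d.mulGen_comul, Category.assoc, Preadditive.add_comp, h1, h2]
    simp
  refine d.generates.hom_ext fun P p hp => ?_
  cases hp with
  | one =>
    rw [reassoc_of% d.one_comul, reassoc_of% d.one_counit]
    rw [MonoidalCategory.tensorHom_def, Category.assoc, ← MonoidalCategory.whiskerLeft_comp_assoc,
      d.one_antipode, MonObj.mul_one]
    simp [← unitors_equal]
  | @mul P p hp =>
    rw [MonoidalCategory.tensorHom_def]
    simp only [Category.assoc]
    have k1 := d.mulGen_counit
    simp only [mulGen, Category.assoc] at key k1
    rw [key, reassoc_of% k1]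
    simp

/-- By the rules for `Δ(a x)` and `S(a x)`, the convolution `S * id` maps `a x` to the braided
commutator of `(S * id)(a)` and `x`. As the unit commutes with `x`, it vanishes on all monomials but
the unit, by induction. -/
lemma antipode_left : d.comul ≫ d.antipode ▷ T ≫ μ[T] = d.counit ≫ η[T] := by
  have key : mulGen i ≫ d.comul ≫ d.antipode ▷ T ≫ μ[T] =
      (d.comul ≫ d.antipode ▷ T ≫ μ[T]) ▷ x ≫ (mulGen i - (β_ T x).hom ≫ i ▷ T ≫ μ[T]) := by
    have h1 : mulSnd (mulGen i) ≫ d.antipode ▷ T ≫ μ[T] =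
        (d.antipode ▷ T ≫ μ[T]) ▷ x ≫ mulGen i := by
      simp only [mulSnd, mulGen, MonoidalCategory.whiskerLeft_comp, comp_whiskerRight,
        Category.assoc, MonObj.mul_assoc_flip, whisker_exchange_assoc]
      rw [← associator_naturality_left_assoc, ← associator_naturality_right_assoc,
        Iso.hom_inv_id_assoc, whisker_exchange_assoc]
    have h2 : mulFst (mulGen i) ≫ d.antipode ▷ T ≫ μ[T] =
        - ((d.antipode ▷ T ≫ μ[T]) ▷ x ≫ (β_ T x).hom ≫ i ▷ T ≫ μ[T]) := by
      rw [mulFst, Category.assoc, Category.assoc, Category.assoc, ← comp_whiskerRight_assoc,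
        d.mulGen_antipode]
      simp only [neg_whiskerRight, Preadditive.neg_comp, Preadditive.comp_neg, neg_inj]
      rw [BraidedCategory.braiding_naturality_left_assoc d.antipode x,
        BraidedCategory.braiding_naturality_left_assoc (d.antipode ▷ T ≫ μ[T]) x,
        MonoidalCategory.whiskerLeft_comp_assoc]
      simp only [BraidedCategory.braiding_tensor_left_hom, comp_whiskerRight, Category.assoc,
        whisker_exchange_assoc]
      rw [← associator_naturality_left_assoc, ← associator_naturality_middle_assoc,
        ← MonObj.mul_assoc]
    rw [← Category.assoc, d.mulGen_comul, Category.assoc, Preadditive.add_comp, h1, h2,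
      Preadditive.comp_sub, sub_eq_add_neg, Preadditive.comp_add, Preadditive.comp_neg,
      ← comp_whiskerRight_assoc, ← comp_whiskerRight_assoc]
  refine d.generates.hom_ext fun P p hp => ?_
  induction hp with
  | one =>
    rw [reassoc_of% d.one_comul, reassoc_of% d.one_counit]
    rw [MonoidalCategory.tensorHom_def', Category.assoc, ← comp_whiskerRight_assoc,
      d.one_antipode, MonObj.one_mul]
    simp
  | @mul P p hp ih =>
    rw [MonoidalCategory.tensorHom_def]
    simp only [Category.assoc]
    have k1 := d.mulGen_counit
    simp only [mulGen, Category.assoc] at key k1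
    rw [key, reassoc_of% k1, ← comp_whiskerRight_assoc, ih]
    have h1 := one_mulGen i
    have h2 : (λ_ x).inv ≫ η[T] ▷ x ≫ (β_ T x).hom ≫ i ▷ T ≫ μ[T] = i := by
      rw [BraidedCategory.braiding_naturality_left_assoc, whisker_exchange_assoc]
      simp
    have h3 : η[T] ▷ x ≫ (T ◁ i ≫ μ[T] - (β_ T x).hom ≫ i ▷ T ≫ μ[T]) = 0 := by
      rw [← cancel_epi (λ_ x).inv, Preadditive.comp_sub, Preadditive.comp_sub, h2, h1, sub_self,
        comp_zero]
    rw [← Category.assoc p, comp_whiskerRight_assoc, h3]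
    simp

/-- The bimonoid structure described by its values on products with a generator. -/
abbrev toBimonObj : BimonObj T where
  counit := d.counit
  comul := d.comul
  counit_comul := by
    have := d.isMonHom_comul
    have := d.isMonHom_counit
    apply d.generates.monHom_ext
    rw [reassoc_of% d.gen_comul, prim, Preadditive.add_comp, Category.assoc, Category.assoc,
      ← comp_whiskerRight, d.one_counit, whisker_exchange, ← rightUnitor_inv_naturality_assoc,
      Preadditive.comp_add, reassoc_of% d.gen_counit]
    simp
  comul_counit := by
    have := d.isMonHom_comul
    have := d.isMonHom_counit
    apply d.generates.monHom_ext
    rw [reassoc_of% d.gen_comul, prim, Preadditive.add_comp, Category.assoc, Category.assoc,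
      ← MonoidalCategory.whiskerLeft_comp, d.one_counit, ← whisker_exchange,
      ← leftUnitor_inv_naturality_assoc, Preadditive.comp_add, reassoc_of% d.gen_counit]
    simp
  comul_assoc := by
    have := d.isMonHom_comul
    apply d.generates.monHom_ext
    rw [reassoc_of% d.gen_comul, reassoc_of% d.gen_comul]
    have e1 : prim T ≫ T ◁ d.comul = d.comul ≫ (λ_ _).inv ≫ η[T] ▷ _ +
        (ρ_ T).inv ≫ T ◁ ((λ_ _).inv ≫ (η[T] ⊗ₘ η[T])) := by
      rw [prim, Preadditive.add_comp, Category.assoc, Category.assoc,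
        ← MonoidalCategory.whiskerLeft_comp, d.one_comul, ← whisker_exchange,
        ← leftUnitor_inv_naturality_assoc]
    have e2 : prim T ≫ d.comul ▷ T = d.comul ≫ (ρ_ _).inv ≫ _ ◁ η[T] +
        (λ_ T).inv ≫ ((λ_ _).inv ≫ (η[T] ⊗ₘ η[T])) ▷ T := by
      rw [prim, Preadditive.add_comp, Category.assoc, Category.assoc, ← comp_whiskerRight,
        d.one_comul, whisker_exchange, ← rightUnitor_inv_naturality_assoc, add_comm]
    rw [e1, reassoc_of% e2, Preadditive.comp_add, Preadditive.add_comp, Preadditive.comp_add,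
      reassoc_of% d.gen_comul, Category.assoc, reassoc_of% d.gen_comul, prim]
    simp only [Preadditive.comp_add, Preadditive.add_comp, Category.assoc]
    rw [add_assoc, add_comm]
    congr 1
    · congr 1
      · rw [leftUnitor_inv_naturality_assoc, whisker_exchange]
        monoidal
      · rw [MonoidalCategory.tensorHom_def]
        monoidal
    · rw [MonoidalCategory.tensorHom_def']
      monoidal
  mul_comul := by
    have := d.isMonHom_comul
    exact IsMonHom.mul_hom d.comul
  one_comul := by
    have := d.isMonHom_comul
    exact IsMonHom.one_hom d.comul
  mul_counit := by
    have := d.isMonHom_counit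
    exact IsMonHom.mul_hom d.counit
  one_counit := d.one_counit

/-- The Hopf monoid structure described by its values on products with a generator. -/
abbrev toHopfObj : HopfObj T where
  toBimonObj := d.toBimonObj
  antipode := d.antipode
  antipode_left := d.antipode_left
  antipode_right := d.antipode_right

end TensorHopfData

end Hopf

/-! ### Permutations and their canonical words -/

section Permutations

/-- A letter for `j` places, seen as a letter for `j + 1` places. -/
def letterCastSucc {j : ℕ} (i : {i : ℕ // i + 1 < j}) : {i : ℕ // i + 1 < j + 1} :=
  ⟨i.1, by omega⟩

/-- The permutation which brings the last number to the place `k` and the others to the remaining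
places, arranged as by `σ`. -/
def insertLast {n : ℕ} (k : Fin (n + 1)) (σ : Equiv.Perm (Fin n)) : Equiv.Perm (Fin (n + 1)) :=
  (finSuccEquivLast.trans (Equiv.optionCongr σ)).trans (finSuccEquiv' k).symm

@[simp]
lemma insertLast_castSucc {n : ℕ} (k : Fin (n + 1)) (σ : Equiv.Perm (Fin n)) (p : Fin n) :
    insertLast k σ p.castSucc = k.succAbove (σ p) := by
  simp [insertLast]

@[simp]
lemma insertLast_last {n : ℕ} (k : Fin (n + 1)) (σ : Equiv.Perm (Fin n)) :
    insertLast k σ (Fin.last n) = k := by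
  simp [insertLast]

@[simp]
lemma insertLast_inv_succAbove {n : ℕ} (k : Fin (n + 1)) (σ : Equiv.Perm (Fin n)) (p : Fin n) :
    (insertLast k σ)⁻¹ (k.succAbove p) = (σ⁻¹ p).castSucc := by
  rw [Equiv.Perm.inv_eq_iff_eq]
  simp

@[simp]
lemma insertLast_inv_self {n : ℕ} (k : Fin (n + 1)) (σ : Equiv.Perm (Fin n)) :
    (insertLast k σ)⁻¹ k = Fin.last n := by
  rw [Equiv.Perm.inv_eq_iff_eq]
  simp

lemma eq_insertLast {n : ℕ} {τ : Equiv.Perm (Fin (n + 1))} {k : Fin (n + 1)}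
    {σ : Equiv.Perm (Fin n)} (h : τ (Fin.last n) = k)
    (h' : ∀ p : Fin n, τ p.castSucc = k.succAbove (σ p)) : τ = insertLast k σ := by
  ext p
  induction p using Fin.lastCases with
  | last => simp [h]
  | cast p => simp [h']

lemma insertLast_bijective (n : ℕ) : Function.Bijective
    (fun p : Fin (n + 1) × Equiv.Perm (Fin n) => insertLast p.1 p.2) := by
  rw [Fintype.bijective_iff_injective_and_card]
  constructor
  · rintro ⟨k, σ⟩ ⟨k', σ'⟩ h
    have hk : k = k' := by
      have := congrArg (fun τ : Equiv.Perm _ => τ (Fin.last n)) h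
      simpa using this
    subst hk
    have : σ = σ' := by
      ext p
      have := congrArg (fun τ : Equiv.Perm _ => τ p.castSucc) h
      have := k.succAbove_right_injective (by simpa using this)
      rw [this]
    rw [this]
  · simp [Fintype.card_perm, Nat.factorial_succ]

/-- Permutations of `n + 1` numbers, in terms of the place of the last number and a permutation of
the others. -/
def insertLastEquiv (n : ℕ) : Fin (n + 1) × Equiv.Perm (Fin n) ≃ Equiv.Perm (Fin (n + 1)) :=
  Equiv.ofBijective _ (insertLast_bijective n)

lemma exists_eq_insertLast {n : ℕ} (τ : Equiv.Perm (Fin (n + 1))) :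
    ∃ k σ, τ = insertLast k σ := by
  obtain ⟨⟨k, σ⟩, h⟩ := (insertLast_bijective n).2 τ
  exact ⟨k, σ, h.symm⟩

/-- The word `k, k + 1, …, n - 1`, whose permutation brings the last of `n + 1` numbers to the
place `k`. -/
def cycleWord : (n k : ℕ) → List {i : ℕ // i + 1 < n + 1}
  | 0, _ => []
  | n + 1, k => if k ≤ n then (cycleWord n k).map letterCastSucc ++ [⟨n, by omega⟩] else []

lemma cycleWord_of_le {n k : ℕ} (h : n ≤ k) : cycleWord n k = [] := by
  cases n with
  | zero => rfl
  | succ n => simp [cycleWord]; omega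

lemma cycleWord_succ {n k : ℕ} (h : k ≤ n) :
    cycleWord (n + 1) k = (cycleWord n k).map letterCastSucc ++ [⟨n, by omega⟩] := by
  simp [cycleWord, h]

lemma cycleWord_eq_cons {n k : ℕ} (h : k < n) :
    cycleWord n k = ⟨k, by omega⟩ :: cycleWord n (k + 1) := by
  induction n with
  | zero => omega
  | succ n ih =>
    rw [cycleWord_succ (by omega)]
    rcases Nat.lt_or_ge k n with hk | hk
    · rw [ih hk, cycleWord_succ hk]
      simp [letterCastSucc]
    · obtain rfl : k = n := by omega
      rw [cycleWord_of_le le_rfl, cycleWord_of_le le_rfl]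
      simp

lemma length_cycleWord (n k : ℕ) : (cycleWord n k).length = n - k := by
  induction n with
  | zero => simp [cycleWord]
  | succ n ih =>
    rcases Nat.lt_or_ge n k with h | h
    · rw [cycleWord_of_le h]
      simp; omega
    · rw [cycleWord_succ h]
      simp [ih]; omega

/-- The canonical word of a permutation. It is reduced by `isReducedWord_canonicalWord`. -/
def canonicalWord : (n : ℕ) → Equiv.Perm (Fin n) → List {i : ℕ // i + 1 < n}
  | 0, _ => []
  | n + 1, τ => cycleWord n ((insertLastEquiv n).symm τ).1 ++
      (canonicalWord n ((insertLastEquiv n).symm τ).2).map letterCastSucc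

lemma canonicalWord_insertLast {n : ℕ} (k : Fin (n + 1)) (σ : Equiv.Perm (Fin n)) :
    canonicalWord (n + 1) (insertLast k σ) =
      cycleWord n k ++ (canonicalWord n σ).map letterCastSucc := by
  have : (insertLastEquiv n).symm (insertLast k σ) = (k, σ) := by
    rw [Equiv.symm_apply_eq]; rfl
  rw [canonicalWord, this]

lemma adjSwap_mul_insertLast_of_lt {n : ℕ} (k : Fin (n + 1)) (σ : Equiv.Perm (Fin n)) (i : ℕ)
    (h : i + 1 < n + 1) (hi : i + 1 < k) :
    adjSwap (n + 1) ⟨i, h⟩ * insertLast k σ =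
      insertLast k (adjSwap n ⟨i, by omega⟩ * σ) := by
  apply eq_insertLast
  · simp only [Equiv.Perm.mul_apply, insertLast_last, adjSwap]
    rw [Equiv.swap_apply_of_ne_of_ne] <;> simp [Fin.ext_iff] <;> omega
  · intro p
    simp only [Equiv.Perm.mul_apply, insertLast_castSucc, adjSwap, Equiv.swap_apply_def,
      Fin.succAbove, Fin.lt_def, Fin.ext_iff]
    split_ifs <;> simp at * <;> omega

lemma adjSwap_mul_insertLast_of_gt {n : ℕ} (k : Fin (n + 1)) (σ : Equiv.Perm (Fin n)) (i : ℕ)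
    (h : i + 1 + 1 < n + 1) (hi : k ≤ i) :
    adjSwap (n + 1) ⟨i + 1, h⟩ * insertLast k σ =
      insertLast k (adjSwap n ⟨i, by omega⟩ * σ) := by
  apply eq_insertLast
  · simp only [Equiv.Perm.mul_apply, insertLast_last, adjSwap]
    rw [Equiv.swap_apply_of_ne_of_ne] <;> simp [Fin.ext_iff] <;> omega
  · intro p
    simp only [Equiv.Perm.mul_apply, insertLast_castSucc, adjSwap, Equiv.swap_apply_def,
      Fin.succAbove, Fin.lt_def, Fin.ext_iff]
    split_ifs <;> simp at * <;> omega

lemma adjSwap_mul_insertLast_succ {n : ℕ} (σ : Equiv.Perm (Fin n)) (i : ℕ) (h : i + 1 < n + 1) :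
    adjSwap (n + 1) ⟨i, h⟩ * insertLast ⟨i + 1, h⟩ σ = insertLast ⟨i, by omega⟩ σ := by
  apply eq_insertLast
  · simp [adjSwap]
  · intro p
    simp only [Equiv.Perm.mul_apply, insertLast_castSucc, adjSwap, Equiv.swap_apply_def,
      Fin.succAbove, Fin.lt_def, Fin.ext_iff]
    split_ifs <;> simp at * <;> omega

lemma insertLast_last_one (n : ℕ) : insertLast (Fin.last n) 1 = 1 := by
  symm
  apply eq_insertLast <;> simp

lemma wordPerm_cons {j : ℕ} (i : {i : ℕ // i + 1 < j}) (w : List {i : ℕ // i + 1 < j}) :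
    wordPerm (i :: w) = adjSwap j i * wordPerm w := by
  simp [wordPerm]

lemma wordPerm_append {j : ℕ} (w w' : List {i : ℕ // i + 1 < j}) :
    wordPerm (w ++ w') = wordPerm w * wordPerm w' := by
  simp [wordPerm]

lemma wordPerm_map_letterCastSucc {n : ℕ} (w : List {i : ℕ // i + 1 < n}) :
    wordPerm (w.map letterCastSucc) = insertLast (Fin.last n) (wordPerm w) := by
  induction w with
  | nil => exact (insertLast_last_one n).symm
  | cons i w ih =>
    rw [List.map_cons, wordPerm_cons, wordPerm_cons, ih]
    exact adjSwap_mul_insertLast_of_lt _ _ i.1 _ (by simpa using i.2)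

lemma wordPerm_cycleWord_mul {n : ℕ} (k : Fin (n + 1)) (σ : Equiv.Perm (Fin n)) :
    wordPerm (cycleWord n k) * insertLast (Fin.last n) σ = insertLast k σ := by
  obtain ⟨k, hk⟩ := k
  obtain ⟨d, hd⟩ : ∃ d, k + d = n := ⟨n - k, by omega⟩
  induction d generalizing k with
  | zero =>
    obtain rfl : k = n := hd
    rw [cycleWord_of_le le_rfl]
    exact one_mul _
  | succ d ih =>
    rw [cycleWord_eq_cons (by simp; omega), wordPerm_cons, mul_assoc, ih (k + 1) (by omega)
      (by omega), adjSwap_mul_insertLast_succ]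

lemma wordPerm_canonicalWord {n : ℕ} (σ : Equiv.Perm (Fin n)) :
    wordPerm (canonicalWord n σ) = σ := by
  induction n with
  | zero => exact Subsingleton.elim _ _
  | succ n ih =>
    obtain ⟨k, σ, rfl⟩ := exists_eq_insertLast σ
    rw [canonicalWord_insertLast, wordPerm_append, wordPerm_map_letterCastSucc, ih,
      wordPerm_cycleWord_mul]

lemma adjSwap_mul_self {j : ℕ} (i : {i : ℕ // i + 1 < j}) : adjSwap j i * adjSwap j i = 1 :=
  Equiv.swap_mul_self _ _

lemma wordPerm_reverse {j : ℕ} (w : List {i : ℕ // i + 1 < j}) :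
    wordPerm w.reverse = (wordPerm w)⁻¹ := by
  induction w with
  | nil => simp [wordPerm]
  | cons i w ih =>
    rw [List.reverse_cons, wordPerm_append, ih, wordPerm_cons i w, mul_inv_rev]
    congr 1

lemma IsReducedWord.reverse {j : ℕ} {w : List {i : ℕ // i + 1 < j}} {σ : Equiv.Perm (Fin j)}
    (h : IsReducedWord w σ) : IsReducedWord w.reverse σ⁻¹ := by
  refine ⟨by rw [wordPerm_reverse, h.1], fun w' hw' => ?_⟩
  have := h.2 w'.reverse (by rw [wordPerm_reverse, hw', inv_inv])
  simpa using this

end Permutations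

/-! ### The action of the braid group -/

section Braids

variable {D : Type u} [Category.{v} D] [MonoidalCategory D] (X : D)

/-- The morphism `f ▷ X`, seen as a morphism of tensor powers. As `tpow X (n + 1)` is the object
`tpow X n ⊗ X` only after unfolding, identities between such morphisms are often first proved for
the tensor product, or for arbitrary objects, and then applied up to definitional equality. -/
def addStrand {m n : ℕ} (f : tpow X m ⟶ tpow X n) : tpow X (m + 1) ⟶ tpow X (n + 1) := f ▷ X

lemma addStrand_id (n : ℕ) : addStrand X (𝟙 (tpow X n)) = 𝟙 _ := id_whiskerRight _ _

lemma addStrand_comp {m n k : ℕ} (f : tpow X m ⟶ tpow X n) (g : tpow X n ⟶ tpow X k) :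
    addStrand X (f ≫ g) = addStrand X f ≫ addStrand X g := comp_whiskerRight _ _ _

variable [BraidedCategory D]

lemma adjBraiding_last (k : ℕ) : adjBraiding X (k + 2) k =
    (α_ (tpow X k) X X).hom ≫ tpow X k ◁ (β_ X X).hom ≫ (α_ (tpow X k) X X).inv :=
  if_pos rfl

lemma adjBraiding_succ {k i : ℕ} (h : i + 1 < k) :
    adjBraiding X (k + 1) i = addStrand X (adjBraiding X k i) := by
  obtain ⟨k, rfl⟩ : ∃ l, k = l + 1 := ⟨k - 1, by omega⟩
  exact if_neg (by omega)

/-- The far commutation relation for the exchange of the last two factors. -/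
lemma addStrand_addStrand_adjBraiding_last {k : ℕ} (f : tpow X k ⟶ tpow X k) :
    addStrand X (addStrand X f) ≫ adjBraiding X (k + 2) k =
      adjBraiding X (k + 2) k ≫ addStrand X (addStrand X f) := by
  have : f ▷ X ▷ X ≫ (α_ (tpow X k) X X).hom ≫ tpow X k ◁ (β_ X X).hom ≫
      (α_ (tpow X k) X X).inv = ((α_ (tpow X k) X X).hom ≫ tpow X k ◁ (β_ X X).hom ≫
      (α_ (tpow X k) X X).inv) ≫ f ▷ X ▷ X := by
    simp only [Category.assoc]
    rw [associator_naturality_left_assoc, ← whisker_exchange_assoc,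
      associator_inv_naturality_left]
  rw [adjBraiding_last]
  exact this

lemma adjBraiding_comm {n i j : ℕ} (hij : i + 1 < j) (hj : j + 1 < n) :
    adjBraiding X n i ≫ adjBraiding X n j = adjBraiding X n j ≫ adjBraiding X n i := by
  induction n with
  | zero => omega
  | succ n ih =>
    rcases Nat.lt_or_ge (j + 1) n with h | h
    · rw [adjBraiding_succ X h, adjBraiding_succ X (by omega), ← addStrand_comp, ih h,
        addStrand_comp]
    · obtain rfl : n = j + 1 := by omega
      rw [adjBraiding_succ X (i := i) (by omega), adjBraiding_succ X (i := i) hij,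
        addStrand_addStrand_adjBraiding_last]

/-- The Yang–Baxter equation for the last three factors of `((A ⊗ X) ⊗ X) ⊗ X`. -/
lemma braid_last (A : D) :
    (((α_ A X X).hom ≫ A ◁ (β_ X X).hom ≫ (α_ A X X).inv) ▷ X) ≫
      ((α_ (A ⊗ X) X X).hom ≫ (A ⊗ X) ◁ (β_ X X).hom ≫ (α_ (A ⊗ X) X X).inv) ≫
      (((α_ A X X).hom ≫ A ◁ (β_ X X).hom ≫ (α_ A X X).inv) ▷ X) =
    ((α_ (A ⊗ X) X X).hom ≫ (A ⊗ X) ◁ (β_ X X).hom ≫ (α_ (A ⊗ X) X X).inv) ≫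
      (((α_ A X X).hom ≫ A ◁ (β_ X X).hom ≫ (α_ A X X).inv) ▷ X) ≫
      ((α_ (A ⊗ X) X X).hom ≫ (A ⊗ X) ◁ (β_ X X).hom ≫ (α_ (A ⊗ X) X X).inv) := by
  have := congrArg (fun f => (α_ A X X).hom ▷ X ≫ (α_ A (X ⊗ X) X).hom ≫ A ◁ (α_ X X X).hom ≫
    A ◁ f ≫ A ◁ (α_ X X X).inv ≫ (α_ A (X ⊗ X) X).inv ≫ (α_ A X X).inv ▷ X)
    (BraidedCategory.yang_baxter X X X)
  simp only [MonoidalCategory.whiskerLeft_comp, Category.assoc] at this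
  convert this using 1 <;> monoidal

lemma adjBraiding_braid {n i : ℕ} (h : i + 2 < n) :
    adjBraiding X n i ≫ adjBraiding X n (i + 1) ≫ adjBraiding X n i =
      adjBraiding X n (i + 1) ≫ adjBraiding X n i ≫ adjBraiding X n (i + 1) := by
  induction n with
  | zero => omega
  | succ n ih =>
    rcases Nat.lt_or_ge (i + 2) n with h' | h'
    · rw [adjBraiding_succ X (i := i) (by omega), adjBraiding_succ X (i := i + 1) (by omega)]
      simp only [← addStrand_comp]
      rw [ih h']
    · obtain rfl : n = i + 2 := by omega
      rw [adjBraiding_succ X (i := i) (by omega), adjBraiding_last, adjBraiding_last]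
      exact braid_last X (tpow X i)

lemma wordBraid_append {j : ℕ} (w w' : List {i : ℕ // i + 1 < j}) :
    wordBraid X (w ++ w') = wordBraid X w' ≫ wordBraid X w := by
  induction w with
  | nil => simp [wordBraid]
  | cons i w ih => simp [wordBraid, ih]

lemma wordBraid_singleton {j : ℕ} (i : {i : ℕ // i + 1 < j}) :
    wordBraid X [i] = adjBraiding X j i := by
  simp [wordBraid]

lemma wordBraid_map_letterCastSucc {j : ℕ} (w : List {i : ℕ // i + 1 < j}) :
    wordBraid X (w.map letterCastSucc) = addStrand X (wordBraid X w) := by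
  induction w with
  | nil => exact (addStrand_id X j).symm
  | cons i w ih =>
    rw [List.map_cons, wordBraid, ih, wordBraid, addStrand_comp]
    congr 1
    exact adjBraiding_succ X i.2

/-- The braid on `n + 1` strands which brings the last factor to the place `k`. -/
def cycleBraid (n k : ℕ) : tpow X (n + 1) ⟶ tpow X (n + 1) := wordBraid X (cycleWord n k)

lemma cycleBraid_of_le {n k : ℕ} (h : n ≤ k) : cycleBraid X n k = 𝟙 _ := by
  rw [cycleBraid, cycleWord_of_le h, wordBraid]

lemma cycleBraid_succ {n k : ℕ} (h : k ≤ n) :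
    cycleBraid X (n + 1) k = adjBraiding X (n + 2) n ≫ addStrand X (cycleBraid X n k) := by
  rw [cycleBraid, cycleWord_succ h, wordBraid_append, wordBraid_singleton,
    wordBraid_map_letterCastSucc]
  rfl

lemma cycleBraid_eq {n k : ℕ} (h : k < n) :
    cycleBraid X n k = cycleBraid X n (k + 1) ≫ adjBraiding X (n + 1) k := by
  rw [cycleBraid, cycleWord_eq_cons h, wordBraid, cycleBraid]

lemma adjBraiding_cycleBraid_of_lt {n k i : ℕ} (hi : i + 1 < k) (hk : k ≤ n) :
    adjBraiding X (n + 1) i ≫ cycleBraid X n k = cycleBraid X n k ≫ adjBraiding X (n + 1) i := by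
  obtain ⟨d, hd⟩ : ∃ d, k + d = n := ⟨n - k, by omega⟩
  induction d generalizing k with
  | zero =>
    rw [cycleBraid_of_le X (by omega), Category.comp_id, Category.id_comp]
  | succ d ih =>
    rw [cycleBraid_eq X (by omega), ← Category.assoc, ih (by omega) (by omega) (by omega),
      Category.assoc, Category.assoc, adjBraiding_comm X hi (by omega)]

lemma adjBraiding_cycleBraid_of_ge {n k i : ℕ} (hi : k ≤ i) (hn : i + 2 ≤ n) :
    adjBraiding X (n + 1) i ≫ cycleBraid X n k =
      cycleBraid X n k ≫ adjBraiding X (n + 1) (i + 1) := by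
  induction n with
  | zero => omega
  | succ n ih =>
    rcases Nat.lt_or_ge (i + 1) n with h | h
    · rw [cycleBraid_succ X (by omega), ← Category.assoc, adjBraiding_comm X h (by omega),
        Category.assoc, Category.assoc, adjBraiding_succ X (i := i) (by omega),
        adjBraiding_succ X (i := i + 1) (by omega), ← addStrand_comp, ih (by omega),
        addStrand_comp]
    · obtain rfl : n = i + 1 := by omega
      have := adjBraiding_braid X (n := i + 3) (i := i) (by omega)
      rw [cycleBraid_succ X (by omega), cycleBraid_succ X hi, addStrand_comp,
        ← adjBraiding_succ X (by omega)]
      simp only [Category.assoc]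
      rw [reassoc_of% this, addStrand_addStrand_adjBraiding_last]

/-! ### Independence of the reduced word -/

lemma wordBraid_canonicalWord_insertLast {n : ℕ} (k : Fin (n + 1)) (σ : Equiv.Perm (Fin n)) :
    wordBraid X (canonicalWord (n + 1) (insertLast k σ)) =
      addStrand X (wordBraid X (canonicalWord n σ)) ≫ cycleBraid X n k := by
  rw [canonicalWord_insertLast, wordBraid_append, wordBraid_map_letterCastSucc, cycleBraid]

lemma length_canonicalWord_insertLast {n : ℕ} (k : Fin (n + 1)) (σ : Equiv.Perm (Fin n)) :
    (canonicalWord (n + 1) (insertLast k σ)).length = (n - k) + (canonicalWord n σ).length := by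
  simp [canonicalWord_insertLast, length_cycleWord]

lemma castSucc_inv_lt {n : ℕ} {k : Fin (n + 1)} {σ : Equiv.Perm (Fin n)} {p q : Fin n}
    (h : (insertLast k σ)⁻¹ (k.succAbove p) < (insertLast k σ)⁻¹ (k.succAbove q)) :
    σ⁻¹ p < σ⁻¹ q := by
  simpa using h

/-- The exchange of two neighbouring places whose entries are in increasing order makes the
canonical word longer by one letter, and multiplies its braid by the generator `Ψ_i`. -/
lemma canonicalWord_adjSwap_mul {n : ℕ} (σ : Equiv.Perm (Fin n)) (i : ℕ) (h : i + 1 < n)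
    (hi : σ⁻¹ ⟨i, by omega⟩ < σ⁻¹ ⟨i + 1, h⟩) :
    (canonicalWord n (adjSwap n ⟨i, h⟩ * σ)).length = (canonicalWord n σ).length + 1 ∧
      wordBraid X (canonicalWord n (adjSwap n ⟨i, h⟩ * σ)) =
        wordBraid X (canonicalWord n σ) ≫ adjBraiding X n i := by
  induction n generalizing i with
  | zero => omega
  | succ n ih =>
    obtain ⟨k, σ, rfl⟩ := exists_eq_insertLast σ
    obtain h1 | h1 | h1 | h1 : i + 1 < k ∨ k.1 = i + 1 ∨ k.1 = i ∨ k < i := by omega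
    -- Both places come before the place `k` of the last number.
    · have hin : i + 1 < n := by omega
      have e1 : (⟨i, by omega⟩ : Fin (n + 1)) = k.succAbove ⟨i, by omega⟩ := by
        rw [Fin.succAbove_of_castSucc_lt _ _ (Fin.lt_def.2 (by simp; omega))]; rfl
      have e2 : (⟨i + 1, h⟩ : Fin (n + 1)) = k.succAbove ⟨i + 1, hin⟩ := by
        rw [Fin.succAbove_of_castSucc_lt _ _ (Fin.lt_def.2 (by simpa using h1))]; rfl
      rw [e1, e2] at hi
      obtain ⟨l, b⟩ := ih σ i hin (castSucc_inv_lt hi)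
      rw [adjSwap_mul_insertLast_of_lt k σ i h h1, length_canonicalWord_insertLast,
        length_canonicalWord_insertLast, wordBraid_canonicalWord_insertLast,
        wordBraid_canonicalWord_insertLast, l, b, addStrand_comp, ← adjBraiding_succ X hin,
        Category.assoc, Category.assoc, adjBraiding_cycleBraid_of_lt X h1 (by omega)]
      exact ⟨by omega, rfl⟩
    -- The last number is moved from `i + 1` to `i`: the cycle becomes longer by one letter.
    · obtain rfl : k = ⟨i + 1, h⟩ := Fin.ext h1
      rw [adjSwap_mul_insertLast_succ, length_canonicalWord_insertLast,
        length_canonicalWord_insertLast, wordBraid_canonicalWord_insertLast,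
        wordBraid_canonicalWord_insertLast, Category.assoc, ← cycleBraid_eq X (by omega)]
      exact ⟨by simp; omega, rfl⟩
    -- The last number cannot be the smaller of two entries.
    · rw [show (⟨i, by omega⟩ : Fin (n + 1)) = k from Fin.ext h1.symm, insertLast_inv_self] at hi
      exact absurd hi (Fin.le_last _).not_gt
    -- Both places come after `k`, so the cycle shifts the generator by one place.
    · obtain ⟨i, rfl⟩ : ∃ l, i = l + 1 := ⟨i - 1, by omega⟩
      have e1 : (⟨i + 1, by omega⟩ : Fin (n + 1)) = k.succAbove ⟨i, by omega⟩ := by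
        rw [Fin.succAbove_of_le_castSucc _ _ (Fin.le_def.2 (by simp; omega))]; rfl
      have e2 : (⟨i + 1 + 1, h⟩ : Fin (n + 1)) = k.succAbove ⟨i + 1, by omega⟩ := by
        rw [Fin.succAbove_of_le_castSucc _ _ (Fin.le_def.2 (by simp; omega))]; rfl
      rw [e1, e2] at hi
      obtain ⟨l, b⟩ := ih σ i (by omega) (castSucc_inv_lt hi)
      rw [adjSwap_mul_insertLast_of_gt k σ i h (by omega), length_canonicalWord_insertLast,
        length_canonicalWord_insertLast, wordBraid_canonicalWord_insertLast,
        wordBraid_canonicalWord_insertLast, l, b, addStrand_comp,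
        ← adjBraiding_succ X (by omega), Category.assoc, Category.assoc,
        adjBraiding_cycleBraid_of_ge X (by omega) (by omega)]
      exact ⟨by omega, rfl⟩

lemma canonicalWord_adjSwap_mul_length {n : ℕ} (σ : Equiv.Perm (Fin n))
    (i : {i : ℕ // i + 1 < n}) :
    ((canonicalWord n (adjSwap n i * σ)).length = (canonicalWord n σ).length + 1 ∧
      wordBraid X (canonicalWord n (adjSwap n i * σ)) =
        wordBraid X (canonicalWord n σ) ≫ adjBraiding X n i) ∨
    (canonicalWord n (adjSwap n i * σ)).length + 1 = (canonicalWord n σ).length := by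
  obtain ⟨i, h⟩ := i
  rcases lt_trichotomy (σ⁻¹ ⟨i, by omega⟩) (σ⁻¹ ⟨i + 1, h⟩) with hi | hi | hi
  · exact Or.inl (canonicalWord_adjSwap_mul X σ i h hi)
  · simp at hi
  · refine Or.inr ?_
    have := (canonicalWord_adjSwap_mul X (adjSwap n ⟨i, h⟩ * σ) i h
      (by simpa [mul_inv_rev, adjSwap] using hi)).1
    rw [← mul_assoc, adjSwap_mul_self, one_mul] at this
    exact this.symm

/-- The canonical word of the permutation of `w` is not longer than `w`, and if it is as long as
`w`, then both give the same braid. This is an induction on `w`: each letter lengthens the canonical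
word by one letter or shortens it, and in a word of minimal length it always lengthens it. -/
lemma canonicalWord_wordPerm {n : ℕ} (w : List {i : ℕ // i + 1 < n}) :
    (canonicalWord n (wordPerm w)).length ≤ w.length ∧
      (w.length ≤ (canonicalWord n (wordPerm w)).length →
        wordBraid X w = wordBraid X (canonicalWord n (wordPerm w))) := by
  induction w with
  | nil =>
    have : canonicalWord n (wordPerm []) = [] := by
      induction n with
      | zero => rfl
      | succ n ih =>
        have : wordPerm ([] : List {i : ℕ // i + 1 < n + 1}) =
          insertLast (Fin.last n) (wordPerm []) := (insertLast_last_one n).symm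
        rw [this, canonicalWord_insertLast, ih, cycleWord_of_le (by simp)]
        rfl
    rw [this]
    exact ⟨le_rfl, fun _ => rfl⟩
  | cons i w ih =>
    rw [wordPerm_cons, List.length_cons]
    rcases canonicalWord_adjSwap_mul_length X (wordPerm w) i with ⟨l, b⟩ | l
    · rw [l, b, wordBraid]
      exact ⟨by omega, fun h => by rw [ih.2 (by omega)]⟩
    · exact ⟨by omega, fun h => by omega⟩

lemma isReducedWord_canonicalWord {n : ℕ} (σ : Equiv.Perm (Fin n)) :
    IsReducedWord (canonicalWord n σ) σ := by
  refine ⟨wordPerm_canonicalWord σ, fun w hw => ?_⟩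
  -- Only lengths matter here, so the braids may be formed in the trivial braided category.
  have := (canonicalWord_wordPerm (D := Discrete.{0} PUnit.{1}) ⟨⟨⟩⟩ w).1
  rwa [hw] at this

/-- Matsumoto's theorem for the braid group action: any reduced word computes `permBraid`. -/
lemma IsReducedWord.wordBraid_eq {n : ℕ} {w : List {i : ℕ // i + 1 < n}}
    {σ : Equiv.Perm (Fin n)} (h : IsReducedWord w σ) : wordBraid X w = permBraid X σ := by
  have key : ∀ {w : List {i : ℕ // i + 1 < n}}, IsReducedWord w σ →
      wordBraid X w = wordBraid X (canonicalWord n σ) := fun {w} h => by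
    have := (canonicalWord_wordPerm X w).2
    rw [h.1] at this
    exact this (h.2 _ (wordPerm_canonicalWord σ))
  have h' : IsReducedWord (reducedWord σ) σ := (exists_isReducedWord σ).choose_spec
  rw [permBraid, key h, key h']

lemma IsReducedWord.length_eq {n : ℕ} {w : List {i : ℕ // i + 1 < n}}
    {σ : Equiv.Perm (Fin n)} (h : IsReducedWord w σ) : w.length = permLength σ := by
  have h' : IsReducedWord (reducedWord σ) σ := (exists_isReducedWord σ).choose_spec
  exact le_antisymm (h.2 _ h'.1) (h'.2 _ h.1)

end Braids

/-! ### Braids of permutations with signs -/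

section SignedSums

variable {D : Type u} [Category.{v} D] [MonoidalCategory D] [BraidedCategory D] (X : D)

/-- The braid of the inverse of `cycleWord n k`. It brings the factor at the place `k` to the last
place. -/
def cycleBraid' (n k : ℕ) : tpow X (n + 1) ⟶ tpow X (n + 1) :=
  wordBraid X (cycleWord n k).reverse

lemma cycleBraid'_of_le {n k : ℕ} (h : n ≤ k) : cycleBraid' X n k = 𝟙 _ := by
  rw [cycleBraid', cycleWord_of_le h, List.reverse_nil, wordBraid]

lemma cycleBraid'_succ {n k : ℕ} (h : k ≤ n) :
    cycleBraid' X (n + 1) k = addStrand X (cycleBraid' X n k) ≫ adjBraiding X (n + 2) n := by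
  rw [cycleBraid', cycleWord_succ h, List.reverse_append, wordBraid_append, List.reverse_singleton,
    wordBraid_singleton, ← List.map_reverse, wordBraid_map_letterCastSucc]
  rfl

lemma permLength_insertLast {n : ℕ} (k : Fin (n + 1)) (σ : Equiv.Perm (Fin n)) :
    permLength (insertLast k σ) = (n - k) + permLength σ := by
  rw [← (isReducedWord_canonicalWord _).length_eq, length_canonicalWord_insertLast,
    (isReducedWord_canonicalWord _).length_eq]

lemma permLength_inv {n : ℕ} (σ : Equiv.Perm (Fin n)) : permLength σ⁻¹ = permLength σ := by
  rw [← (isReducedWord_canonicalWord σ).length_eq,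
    ← (isReducedWord_canonicalWord σ).reverse.length_eq, List.length_reverse]

lemma permBraid_insertLast {n : ℕ} (k : Fin (n + 1)) (σ : Equiv.Perm (Fin n)) :
    permBraid X (insertLast k σ) = addStrand X (permBraid X σ) ≫ cycleBraid X n k := by
  rw [← (isReducedWord_canonicalWord _).wordBraid_eq, wordBraid_canonicalWord_insertLast,
    (isReducedWord_canonicalWord _).wordBraid_eq]

lemma permBraid_insertLast_inv {n : ℕ} (k : Fin (n + 1)) (σ : Equiv.Perm (Fin n)) :
    permBraid X (insertLast k σ)⁻¹ = cycleBraid' X n k ≫ addStrand X (permBraid X σ⁻¹) := by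
  rw [← (isReducedWord_canonicalWord _).reverse.wordBraid_eq, canonicalWord_insertLast,
    List.reverse_append, wordBraid_append, ← List.map_reverse, wordBraid_map_letterCastSucc,
    (isReducedWord_canonicalWord _).reverse.wordBraid_eq, cycleBraid']

lemma permBraid_of_isEmpty_letters {n : ℕ} (hn : n ≤ 1) (σ : Equiv.Perm (Fin n)) :
    permBraid X σ = 𝟙 _ := by
  rw [permBraid]
  cases h : reducedWord σ with
  | nil => rfl
  | cons i w => exact absurd i.2 (by omega)

variable [Preadditive D]

/-- The braid `cycleBraid`, with the sign of its permutation. -/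
def signedCycle (n k : ℕ) : tpow X (n + 1) ⟶ tpow X (n + 1) :=
  ((-1 : ℤ) ^ (n - k)) • cycleBraid X n k

/-- The braid `cycleBraid'`, with the sign of its permutation. -/
def signedCycle' (n k : ℕ) : tpow X (n + 1) ⟶ tpow X (n + 1) :=
  ((-1 : ℤ) ^ (n - k)) • cycleBraid' X n k

lemma signedCycle_of_le {n k : ℕ} (h : n ≤ k) : signedCycle X n k = 𝟙 _ := by
  rw [signedCycle, cycleBraid_of_le X h, Nat.sub_eq_zero_of_le h, pow_zero, one_smul]

lemma signedCycle'_of_le {n k : ℕ} (h : n ≤ k) : signedCycle' X n k = 𝟙 _ := by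
  rw [signedCycle', cycleBraid'_of_le X h, Nat.sub_eq_zero_of_le h, pow_zero, one_smul]

variable [MonoidalPreadditive D]

lemma addStrand_zsmul {m n : ℕ} (a : ℤ) (f : tpow X m ⟶ tpow X n) :
    addStrand X (a • f) = a • addStrand X f :=
  map_zsmul ((tensoringRight D).obj X).mapAddHom a f

lemma addStrand_sum {m n : ℕ} {J : Type*} (s : Finset J) (f : J → (tpow X m ⟶ tpow X n)) :
    addStrand X (∑ i ∈ s, f i) = ∑ i ∈ s, addStrand X (f i) :=
  map_sum ((tensoringRight D).obj X).mapAddHom f s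

lemma signedPermBraid_insertLast {n : ℕ} (k : Fin (n + 1)) (σ : Equiv.Perm (Fin n)) :
    signedPermBraid X (insertLast k σ) =
      addStrand X (signedPermBraid X σ) ≫ signedCycle X n k := by
  rw [signedPermBraid, permLength_insertLast, permBraid_insertLast, signedPermBraid, signedCycle,
    addStrand_zsmul, Preadditive.zsmul_comp, Preadditive.comp_zsmul, ← mul_smul, ← pow_add,
    Nat.add_comm (n - k)]

lemma signedPermBraid_insertLast_inv {n : ℕ} (k : Fin (n + 1)) (σ : Equiv.Perm (Fin n)) :
    signedPermBraid X (insertLast k σ)⁻¹ =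
      signedCycle' X n k ≫ addStrand X (signedPermBraid X σ⁻¹) := by
  rw [signedPermBraid, permLength_inv, permLength_insertLast, permBraid_insertLast_inv,
    signedPermBraid, permLength_inv, signedCycle', addStrand_zsmul, Preadditive.zsmul_comp,
    Preadditive.comp_zsmul, ← mul_smul, ← pow_add]

lemma signedPermBraid_one (n : ℕ) : signedPermBraid X (1 : Equiv.Perm (Fin n)) = 𝟙 _ := by
  induction n with
  | zero =>
    have h : permLength (1 : Equiv.Perm (Fin 0)) = 0 := by
      rw [← (isReducedWord_canonicalWord _).length_eq]; rfl
    rw [signedPermBraid, permBraid_of_isEmpty_letters X (by omega), h, pow_zero, one_smul]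
  | succ n ih =>
    rw [← insertLast_last_one, signedPermBraid_insertLast, ih, signedCycle_of_le X (by simp),
      addStrand_id, Category.comp_id]

/-! ### The antisymmetrizer -/

lemma antisymmetrizer_zero : antisymmetrizer X 0 = 𝟙 _ := by
  rw [antisymmetrizer, Fintype.sum_unique]
  exact signedPermBraid_one X 0

/-- Permutations of `n + 1` numbers are sorted by the place of the last number. -/
lemma antisymmetrizer_succ (n : ℕ) : antisymmetrizer X (n + 1) =
    addStrand X (antisymmetrizer X n) ≫ ∑ k : Fin (n + 1), signedCycle X n k := by
  rw [antisymmetrizer, ← (insertLastEquiv n).sum_comp, Fintype.sum_prod_type, Preadditive.comp_sum]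
  refine Finset.sum_congr rfl fun k _ => ?_
  rw [antisymmetrizer, addStrand_sum, Preadditive.sum_comp]
  exact Finset.sum_congr rfl fun σ _ => signedPermBraid_insertLast X k σ

/-! ### The shuffle permutations -/

open Classical in
/-- The permutations which bring some numbers to the first `k` places and the remaining ones to the
others, in both cases without changing their order. -/
def shufflesAt (N k : ℕ) : Finset (Equiv.Perm (Fin N)) :=
  Finset.univ.filter fun σ => ∀ p q : Fin N, p < q → (q.1 < k ∨ k ≤ p.1) → σ⁻¹ p < σ⁻¹ q

lemma mem_shufflesAt {N k : ℕ} {σ : Equiv.Perm (Fin N)} : σ ∈ shufflesAt N k ↔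
    ∀ p q : Fin N, p < q → (q.1 < k ∨ k ≤ p.1) → σ⁻¹ p < σ⁻¹ q := by
  simp [shufflesAt]

lemma shuffles_eq (k l : ℕ) : shuffles k l = shufflesAt (k + l) k := by
  ext σ
  rw [mem_shufflesAt, shuffles, Finset.mem_filter]
  constructor
  · rintro ⟨-, h1, h2⟩ p q hpq h
    rcases h with h | h
    · exact @h1 ⟨p, by omega⟩ ⟨q, h⟩ hpq
    · have e : ∀ r : Fin (k + l), k ≤ r.1 → ∀ hr, Fin.natAdd k ⟨r.1 - k, hr⟩ = r :=
        fun r h1 hr => Fin.ext (by simp; omega)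
      have := @h2 ⟨p - k, by omega⟩ ⟨q - k, by omega⟩ (Fin.lt_def.2 (by simp; omega))
      simpa only [e p h, e q (by omega)] using this
  · intro h
    refine ⟨Finset.mem_univ _, fun p q hpq => h _ _ ?_ (Or.inl (by simp)),
      fun p q hpq => h _ _ ?_ (Or.inr (by simp))⟩
    · exact hpq
    · simpa using hpq

lemma shufflesAt_of_trivial {N k : ℕ} (h : k = 0 ∨ N ≤ k) : shufflesAt N k = {1} := by
  ext σ
  rw [mem_shufflesAt, Finset.mem_singleton]
  constructor
  · intro hσ
    have hm : StrictMono (σ⁻¹ : Equiv.Perm (Fin N)) := fun p q hpq => hσ p q hpq (by omega)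
    have : (hm.orderIsoOfSurjective _ (σ⁻¹).surjective) = OrderIso.refl _ :=
      Subsingleton.elim _ _
    refine inv_eq_one.1 (Equiv.ext fun p => ?_)
    exact congrArg (fun f : Fin N ≃o Fin N => f p) this
  · rintro rfl p q hpq _
    simpa using hpq

lemma val_succAbove {n : ℕ} (j : Fin (n + 1)) (r : Fin n) :
    (j.succAbove r).1 = if r.1 < j.1 then r.1 else r.1 + 1 := by
  simp only [Fin.succAbove, Fin.lt_def, Fin.val_castSucc]
  split_ifs <;> rfl

/-- A shuffle of `N + 1` numbers brings the last number to the last place, or to the last of the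
first `k + 1` places. -/
lemma insertLast_mem_shufflesAt {N k : ℕ} (hk : k < N) (j : Fin (N + 1)) (σ : Equiv.Perm (Fin N)) :
    insertLast j σ ∈ shufflesAt (N + 1) (k + 1) ↔
      (j.1 = N ∧ σ ∈ shufflesAt N (k + 1)) ∨ (j.1 = k ∧ σ ∈ shufflesAt N k) := by
  simp only [mem_shufflesAt]
  constructor
  · intro h
    have hj : j.1 = N ∨ j.1 = k := by
      by_contra! hc
      have := h j ⟨j + 1, by omega⟩ (Fin.lt_def.2 (by simp)) (by simp; omega)
      rw [insertLast_inv_self] at this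
      exact absurd this (Fin.le_last _).not_gt
    have key : ∀ p q : Fin N, p < q →
        ((j.succAbove q).1 < k + 1 ∨ k + 1 ≤ (j.succAbove p).1) → σ⁻¹ p < σ⁻¹ q := by
      intro p q hpq hc
      exact castSucc_inv_lt (h (j.succAbove p) (j.succAbove q)
        (by simpa using hpq) hc)
    simp only [val_succAbove] at key
    rcases hj with hj | hj
    · refine Or.inl ⟨hj, fun p q hpq hc => key p q hpq ?_⟩
      split_ifs <;> omega
    · refine Or.inr ⟨hj, fun p q hpq hc => key p q hpq ?_⟩
      split_ifs <;> omega
  · intro h p q hpq hc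
    have hp : p ≠ j := by
      rintro rfl
      rw [Fin.lt_def] at hpq
      omega
    obtain ⟨p, rfl⟩ := Fin.exists_succAbove_eq hp
    by_cases hq : q = j
    · rw [hq, insertLast_inv_self, insertLast_inv_succAbove]
      exact Fin.castSucc_lt_last _
    obtain ⟨q, rfl⟩ := Fin.exists_succAbove_eq hq
    rw [insertLast_inv_succAbove, insertLast_inv_succAbove, Fin.castSucc_lt_castSucc_iff]
    simp only [val_succAbove] at hc
    have hpq' : p < q := by simpa using hpq
    rcases h with ⟨hj, h⟩ | ⟨hj, h⟩
    · refine h p q hpq' ?_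
      split_ifs at hc <;> omega
    · refine h p q hpq' ?_
      rw [Fin.lt_def] at hpq'
      split_ifs at hc <;> omega

/-- The signed sum over the permutations `shufflesAt N k`. -/
def shuffleSumAt (N k : ℕ) : tpow X N ⟶ tpow X N :=
  ∑ σ ∈ shufflesAt N k, signedPermBraid X σ

/-- The signed sum over the inverses of the permutations `shufflesAt N k`. -/
def inverseShuffleSumAt (N k : ℕ) : tpow X N ⟶ tpow X N :=
  ∑ σ ∈ shufflesAt N k, signedPermBraid X σ⁻¹

lemma shuffleSum_eq (k l : ℕ) : shuffleSum X k l = shuffleSumAt X (k + l) k := by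
  rw [shuffleSum, shuffles_eq, shuffleSumAt]

lemma inverseShuffleSum_eq (k l : ℕ) :
    inverseShuffleSum X k l = inverseShuffleSumAt X (k + l) k := by
  rw [inverseShuffleSum, inverseShuffleSumAt, ← shuffles_eq]
  refine Finset.sum_nbij' (fun σ => σ⁻¹) (fun σ => σ⁻¹) ?_ ?_ ?_ ?_ ?_ <;>
    simp [inverseShuffles]

lemma shuffleSumAt_of_trivial {N k : ℕ} (h : k = 0 ∨ N ≤ k) : shuffleSumAt X N k = 𝟙 _ := by
  rw [shuffleSumAt, shufflesAt_of_trivial h, Finset.sum_singleton, signedPermBraid_one]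

lemma inverseShuffleSumAt_of_trivial {N k : ℕ} (h : k = 0 ∨ N ≤ k) :
    inverseShuffleSumAt X N k = 𝟙 _ := by
  rw [inverseShuffleSumAt, shufflesAt_of_trivial h, Finset.sum_singleton, inv_one,
    signedPermBraid_one]

lemma sum_shufflesAt_succ {M : Type*} [AddCommMonoid M] {N k : ℕ} (hk : k < N)
    (f : Equiv.Perm (Fin (N + 1)) → M) :
    ∑ τ ∈ shufflesAt (N + 1) (k + 1), f τ =
      ∑ σ ∈ shufflesAt N (k + 1), f (insertLast (Fin.last N) σ) +
        ∑ σ ∈ shufflesAt N k, f (insertLast ⟨k, by omega⟩ σ) := by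
  classical
  rw [← Finset.sum_ite_mem_eq, ← (insertLastEquiv N).sum_comp, Fintype.sum_prod_type,
    ← Finset.sum_ite_mem_eq (shufflesAt N (k + 1)), ← Finset.sum_ite_mem_eq (shufflesAt N k),
    Fintype.sum_eq_add (Fin.last N) ⟨k, by omega⟩ (by simp [Fin.ext_iff]; omega)]
  · congr 1 <;> refine Finset.sum_congr rfl fun σ _ => ?_
    · have := insertLast_mem_shufflesAt hk (Fin.last N) σ
      simp only [Fin.val_last, true_and, hk.ne', false_and, or_false] at this
      exact if_congr this rfl rfl
    · have := insertLast_mem_shufflesAt hk ⟨k, by omega⟩ σ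
      simp only [true_and, hk.ne, false_and, false_or] at this
      exact if_congr this rfl rfl
  · rintro j ⟨h1, h2⟩
    refine Finset.sum_eq_zero fun σ _ => if_neg ?_
    have := insertLast_mem_shufflesAt hk j σ
    simp only [ne_eq, Fin.ext_iff, Fin.val_last] at h1 h2
    simp only [h1, h2, false_and, or_false, iff_false] at this
    exact this

/-- The Pascal rule for shuffles. The last number goes to the last place, or to the last of the
first `k + 1` places. -/
lemma shuffleSumAt_succ {N k : ℕ} (hk : k < N) : shuffleSumAt X (N + 1) (k + 1) =
    addStrand X (shuffleSumAt X N (k + 1)) +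
      addStrand X (shuffleSumAt X N k) ≫ signedCycle X N k := by
  rw [shuffleSumAt, sum_shufflesAt_succ hk, shuffleSumAt, shuffleSumAt, addStrand_sum,
    addStrand_sum, Preadditive.sum_comp]
  simp only [signedPermBraid_insertLast, Fin.val_last, signedCycle_of_le X le_rfl,
    Category.comp_id]

lemma inverseShuffleSumAt_succ {N k : ℕ} (hk : k < N) : inverseShuffleSumAt X (N + 1) (k + 1) =
    addStrand X (inverseShuffleSumAt X N (k + 1)) +
      signedCycle' X N k ≫ addStrand X (inverseShuffleSumAt X N k) := by
  rw [inverseShuffleSumAt, sum_shufflesAt_succ hk, inverseShuffleSumAt, inverseShuffleSumAt,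
    addStrand_sum, addStrand_sum, Preadditive.comp_sum]
  simp only [signedPermBraid_insertLast_inv, Fin.val_last, signedCycle'_of_le X le_rfl,
    Category.id_comp]

lemma signedCycle_succ {n k : ℕ} (h : k ≤ n) : signedCycle X (n + 1) k =
    -(adjBraiding X (n + 2) n ≫ addStrand X (signedCycle X n k)) := by
  rw [signedCycle, cycleBraid_succ X h, signedCycle, addStrand_zsmul, Preadditive.comp_zsmul,
    Nat.succ_sub h, pow_succ, mul_neg_one, neg_smul]

lemma signedCycle'_succ {n k : ℕ} (h : k ≤ n) : signedCycle' X (n + 1) k =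
    -(addStrand X (signedCycle' X n k) ≫ adjBraiding X (n + 2) n) := by
  rw [signedCycle', cycleBraid'_succ X h, signedCycle', addStrand_zsmul, Preadditive.zsmul_comp,
    Nat.succ_sub h, pow_succ, mul_neg_one, neg_smul]

/-- Both sides are the signed sum over the permutations which bring the last number to an arbitrary
place and keep the order of the others. -/
lemma sum_signedCycle (N : ℕ) :
    ∑ k : Fin (N + 1), signedCycle X N k = inverseShuffleSumAt X (N + 1) N := by
  induction N with
  | zero =>
    rw [inverseShuffleSumAt_of_trivial X (Or.inl rfl), Fin.sum_univ_one]
    exact signedCycle_of_le X (Nat.zero_le _)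
  | succ N ih =>
    rw [Fin.sum_univ_castSucc, inverseShuffleSumAt_succ X (Nat.lt_succ_self N),
      inverseShuffleSumAt_of_trivial X (Or.inr le_rfl), addStrand_id, ← ih,
      add_comm (𝟙 _), Fin.val_last, signedCycle_of_le X le_rfl, signedCycle'_succ X le_rfl,
      signedCycle'_of_le X le_rfl, addStrand_id, Category.id_comp, Preadditive.neg_comp,
      addStrand_sum, Preadditive.comp_sum, ← Finset.sum_neg_distrib]
    congr 1
    exact Finset.sum_congr rfl fun k _ => signedCycle_succ X (Nat.le_of_lt_succ k.2)

/-- The recursion of the antisymmetrizers along products with one factor: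
`A_{N+1} = A^{(N,1)} ∘ (A_N ⊗ id)`. -/
lemma antisymmetrizer_succ' (N : ℕ) : antisymmetrizer X (N + 1) =
    addStrand X (antisymmetrizer X N) ≫ inverseShuffleSumAt X (N + 1) N := by
  rw [antisymmetrizer_succ, sum_signedCycle]

lemma revPerm_succ (n : ℕ) :
    (Fin.revPerm : Equiv.Perm (Fin (n + 1))) = insertLast 0 Fin.revPerm := by
  apply eq_insertLast
  · simp
  · intro p
    simp [Fin.rev_castSucc]

lemma signedPermBraid_revPerm_succ (n : ℕ) :
    signedPermBraid X (Fin.revPerm : Equiv.Perm (Fin (n + 1))) =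
      addStrand X (signedPermBraid X (Fin.revPerm : Equiv.Perm (Fin n))) ≫ signedCycle X n 0 := by
  rw [revPerm_succ, signedPermBraid_insertLast]
  rfl

lemma signedPermBraid_revPerm_succ' (n : ℕ) :
    signedPermBraid X (Fin.revPerm : Equiv.Perm (Fin (n + 1))) =
      signedCycle' X n 0 ≫ addStrand X (signedPermBraid X (Fin.revPerm : Equiv.Perm (Fin n))) := by
  have h : ∀ m, (Fin.revPerm : Equiv.Perm (Fin m))⁻¹ = Fin.revPerm := fun _ => rfl
  rw [← h, revPerm_succ, signedPermBraid_insertLast_inv, h]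
  rfl

end SignedSums

/-! ### Components of morphisms of graded objects -/

section GradedInterface

open GradedObject.Monoidal (ιTensorObj ιTensorObj₃ ιTensorObj₃')

variable {D : Type u} [Category.{v} D] [Abelian D] [MonoidalCategory D] [MonoidalPreadditive D]

lemma ιTensorObj_associator_hom (A B C : GradedObject ℕ D) {a b c ab bc k : ℕ} (h₁ : a + b = ab)
    (h₂ : ab + c = k) (h₃ : b + c = bc) (h₄ : a + bc = k) :
    ιTensorObj A B a b ab h₁ ▷ C c ≫ ιTensorObj (GradedObject.Monoidal.tensorObj A B) C ab c k h₂ ≫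
        (GradedObject.Monoidal.associator A B C).hom k =
      (α_ (A a) (B b) (C c)).hom ≫ A a ◁ ιTensorObj B C b c bc h₃ ≫
        ιTensorObj A (GradedObject.Monoidal.tensorObj B C) a bc k h₄ := by
  have := GradedObject.Monoidal.ιTensorObj₃'_associator_hom A B C a b c k (by omega)
  rwa [GradedObject.Monoidal.ιTensorObj₃'_eq _ _ _ a b c k _ ab h₁,
    GradedObject.Monoidal.ιTensorObj₃_eq _ _ _ a b c k _ bc h₃, Category.assoc] at this

lemma tensorObj₃_hom_ext (A B C : GradedObject ℕ D) {k : ℕ} {Z : D}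
    {f g : GradedObject.Monoidal.tensorObj (GradedObject.Monoidal.tensorObj A B) C k ⟶ Z}
    (h : ∀ a b ab c h₁ h₂, ιTensorObj A B a b ab h₁ ▷ C c ≫
        ιTensorObj (GradedObject.Monoidal.tensorObj A B) C ab c k h₂ ≫ f =
      ιTensorObj A B a b ab h₁ ▷ C c ≫
        ιTensorObj (GradedObject.Monoidal.tensorObj A B) C ab c k h₂ ≫ g) : f = g := by
  refine GradedObject.Monoidal.tensorObj₃'_ext (X₁ := A) (X₂ := B) (X₃ := C) f g ?_
  intro a b c hk
  rw [GradedObject.Monoidal.ιTensorObj₃'_eq _ _ _ a b c k _ _ rfl, Category.assoc, Category.assoc]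
  exact h a b _ c rfl hk

/-- The component of degree `n` of a graded object. -/
def deg (A : NGraded D) (n : ℕ) : D := A n

/-- The component of degree `n` of a morphism of graded objects. -/
def degMap {A B : NGraded D} (f : A ⟶ B) (n : ℕ) : deg A n ⟶ deg B n := f n

/-- The morphism of graded objects with given components. -/
def homOfDegMap {A B : NGraded D} (f : ∀ n, deg A n ⟶ deg B n) : A ⟶ B := f

variable {A A' B B' C : NGraded D}

lemma graded_hom_ext {f g : A ⟶ B} (h : ∀ n, degMap f n = degMap g n) : f = g := funext h

@[simp]
lemma degMap_id (n : ℕ) : degMap (𝟙 A) n = 𝟙 _ := rfl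

@[simp]
lemma degMap_comp (f : A ⟶ B) (g : B ⟶ C) (n : ℕ) :
    degMap (f ≫ g) n = degMap f n ≫ degMap g n := rfl

instance : Preadditive (NGraded D) where
  homGroup A B := inferInstanceAs (AddCommGroup (∀ n : ℕ, (deg A n ⟶ deg B n)))
  add_comp _ _ _ _ _ _ := funext fun _ => Preadditive.add_comp _ _ _ _ _ _
  comp_add _ _ _ _ _ _ := funext fun _ => Preadditive.comp_add _ _ _ _ _ _

@[simp]
lemma degMap_add (f g : A ⟶ B) (n : ℕ) : degMap (f + g) n = degMap f n + degMap g n := rfl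

@[simp]
lemma degMap_neg (f : A ⟶ B) (n : ℕ) : degMap (-f) n = -degMap f n := rfl

@[simp]
lemma degMap_zero (n : ℕ) : degMap (0 : A ⟶ B) n = 0 := rfl

/-- The inclusion of a summand `Aₙ ⊗ Bₘ` into the component of degree `k = n + m` of `A ⊗ B`. -/
def inc (A B : NGraded D) (n m k : ℕ) (h : n + m = k) : deg A n ⊗ deg B m ⟶ deg (A ⊗ B) k :=
  ιTensorObj A B n m k h

lemma tensor_hom_ext {k : ℕ} {Z : D} {f g : deg (A ⊗ B) k ⟶ Z}
    (h : ∀ n m h, inc A B n m k h ≫ f = inc A B n m k h ≫ g) : f = g :=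
  GradedObject.Monoidal.tensorObj_ext f g h

lemma inc_tensorHom (f : A ⟶ A') (g : B ⟶ B') (n m k : ℕ) (h : n + m = k) :
    inc A B n m k h ≫ degMap (f ⊗ₘ g) k = (degMap f n ⊗ₘ degMap g m) ≫ inc A' B' n m k h :=
  GradedObject.Monoidal.ι_tensorHom f g n m k h

lemma inc_whiskerLeft (g : B ⟶ B') (n m k : ℕ) (h : n + m = k) :
    inc A B n m k h ≫ degMap (A ◁ g) k = deg A n ◁ degMap g m ≫ inc A B' n m k h := by
  rw [← id_tensorHom, inc_tensorHom, degMap_id, id_tensorHom]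

lemma inc_whiskerRight (f : A ⟶ A') (n m k : ℕ) (h : n + m = k) :
    inc A B n m k h ≫ degMap (f ▷ B) k = degMap f n ▷ deg B m ≫ inc A' B n m k h := by
  rw [← tensorHom_id, inc_tensorHom, degMap_id, tensorHom_id]

lemma inc_associator_hom {a b c ab bc k : ℕ} (h₁ : a + b = ab) (h₂ : ab + c = k)
    (h₃ : b + c = bc) (h₄ : a + bc = k) :
    inc A B a b ab h₁ ▷ deg C c ≫ inc (A ⊗ B) C ab c k h₂ ≫ degMap (α_ A B C).hom k =
      (α_ (deg A a) (deg B b) (deg C c)).hom ≫ deg A a ◁ inc B C b c bc h₃ ≫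
        inc A (B ⊗ C) a bc k h₄ :=
  ιTensorObj_associator_hom A B C h₁ h₂ h₃ h₄

lemma tensor₃'_hom_ext {k : ℕ} {Z : D} {f g : deg ((A ⊗ B) ⊗ C) k ⟶ Z}
    (h : ∀ a b ab c h₁ h₂, inc A B a b ab h₁ ▷ deg C c ≫ inc (A ⊗ B) C ab c k h₂ ≫ f =
      inc A B a b ab h₁ ▷ deg C c ≫ inc (A ⊗ B) C ab c k h₂ ≫ g) : f = g :=
  tensorObj₃_hom_ext A B C h

lemma inc_associator_inv {a b c ab bc k : ℕ} (h₁ : a + b = ab) (h₂ : ab + c = k)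
    (h₃ : b + c = bc) (h₄ : a + bc = k) :
    deg A a ◁ inc B C b c bc h₃ ≫ inc A (B ⊗ C) a bc k h₄ ≫ degMap (α_ A B C).inv k =
      (α_ (deg A a) (deg B b) (deg C c)).inv ≫ inc A B a b ab h₁ ▷ deg C c ≫
        inc (A ⊗ B) C ab c k h₂ := by
  have := inc_associator_hom (A := A) (B := B) (C := C) h₁ h₂ h₃ h₄
  rw [Iso.eq_inv_comp, ← reassoc_of% this, ← degMap_comp, Iso.hom_inv_id, degMap_id,
    Category.comp_id]

lemma ι_signedBraiding [BraidedCategory D] (A B : GradedObject ℕ D) (n m k : ℕ) (h : n + m = k) :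
    ιTensorObj A B n m k h ≫ (signedBraiding A B).hom k = ((-1 : ℤ) ^ (n * m)) •
      ((β_ (A n) (B m)).hom ≫ ιTensorObj B A m n k ((add_comm m n).trans h)) := by
  simp [signedBraiding]

lemma inc_braiding [BraidedCategory D] (n m k : ℕ) (h : n + m = k) :
    inc A B n m k h ≫ degMap (β_ A B).hom k = ((-1 : ℤ) ^ (n * m)) •
      ((β_ (deg A n) (deg B m)).hom ≫ inc B A m n k ((add_comm m n).trans h)) :=
  ι_signedBraiding A B n m k h

variable (D) in
/-- The component of degree `0` of the unit object. -/
def unitZero : 𝟙_ D ≅ deg (𝟙_ (NGraded D)) 0 := (GradedObject.Monoidal.tensorUnit₀ :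
    (GradedObject.Monoidal.tensorUnit : GradedObject ℕ D) 0 ≅ 𝟙_ D).symm

lemma isZero_deg_unit {n : ℕ} (hn : n ≠ 0) : IsZero (deg (𝟙_ (NGraded D)) n) :=
  (isZero_zero D).of_iso
    ((GradedObject.Monoidal.isInitialTensorUnitApply (C := D) n hn).uniqueUpToIso
      (isZero_zero D).isInitial)

lemma degMap_leftUnitor_inv (k : ℕ) : degMap (λ_ A).inv k =
    (λ_ (deg A k)).inv ≫ (unitZero D).hom ▷ deg A k ≫ inc (𝟙_ _) A 0 k k (zero_add k) :=
  rfl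

lemma degMap_rightUnitor_inv (k : ℕ) : degMap (ρ_ A).inv k =
    (ρ_ (deg A k)).inv ≫ deg A k ◁ (unitZero D).hom ≫ inc A (𝟙_ _) k 0 k (add_zero k) :=
  rfl

lemma isZero_tensor_left {Y : D} (Z : D) (h : IsZero Z) : IsZero (Y ⊗ Z) := by
  rw [IsZero.iff_id_eq_zero] at h ⊢
  rw [← MonoidalCategory.whiskerLeft_id, h, MonoidalPreadditive.whiskerLeft_zero]

lemma isZero_tensor_right {Y : D} (Z : D) (h : IsZero Z) : IsZero (Z ⊗ Y) := by
  rw [IsZero.iff_id_eq_zero] at h ⊢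
  rw [← MonoidalCategory.id_whiskerRight, h, MonoidalPreadditive.zero_whiskerRight]

lemma inc_leftUnitor_hom (k : ℕ) :
    inc (𝟙_ _) A 0 k k (zero_add k) ≫ degMap (λ_ A).hom k =
      (unitZero D).inv ▷ deg A k ≫ (λ_ (deg A k)).hom := by
  have h := congrArg (fun f => degMap f k) (λ_ A).inv_hom_id
  simp only [degMap_comp, degMap_leftUnitor_inv, Category.assoc, degMap_id] at h
  rw [← cancel_epi ((λ_ (deg A k)).inv ≫ (unitZero D).hom ▷ deg A k), Category.assoc, h]
  simp

lemma inc_rightUnitor_hom (k : ℕ) :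
    inc A (𝟙_ _) k 0 k (add_zero k) ≫ degMap (ρ_ A).hom k =
      deg A k ◁ (unitZero D).inv ≫ (ρ_ (deg A k)).hom := by
  have h := congrArg (fun f => degMap f k) (ρ_ A).inv_hom_id
  simp only [degMap_comp, degMap_rightUnitor_inv, Category.assoc, degMap_id] at h
  rw [← cancel_epi ((ρ_ (deg A k)).inv ≫ deg A k ◁ (unitZero D).hom), Category.assoc, h]
  simp

lemma unit_tensor_hom_ext {k : ℕ} {Z : D} {f g : deg (𝟙_ (NGraded D) ⊗ A) k ⟶ Z}
    (h : inc (𝟙_ _) A 0 k k (zero_add k) ≫ f = inc (𝟙_ _) A 0 k k (zero_add k) ≫ g) : f = g := by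
  refine tensor_hom_ext fun n m hk => ?_
  by_cases hn : n = 0
  · subst hn
    obtain rfl : m = k := by omega
    exact h
  · exact (isZero_tensor_right _ (isZero_deg_unit hn)).eq_of_src _ _

lemma tensor_unit_hom_ext {k : ℕ} {Z : D} {f g : deg (A ⊗ 𝟙_ (NGraded D)) k ⟶ Z}
    (h : inc A (𝟙_ _) k 0 k (add_zero k) ≫ f = inc A (𝟙_ _) k 0 k (add_zero k) ≫ g) : f = g := by
  refine tensor_hom_ext fun m n hk => ?_
  by_cases hn : n = 0
  · subst hn
    obtain rfl : m = k := by omega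
    exact h
  · exact (isZero_tensor_left _ (isZero_deg_unit hn)).eq_of_src _ _

instance : MonoidalPreadditive (NGraded D) where
  whiskerLeft_zero {A B C} := graded_hom_ext fun k => tensor_hom_ext fun n m h => by
    simp [inc_whiskerLeft]
  zero_whiskerRight {A B C} := graded_hom_ext fun k => tensor_hom_ext fun n m h => by
    simp [inc_whiskerRight]
  whiskerLeft_add {A B C} f g := graded_hom_ext fun k => tensor_hom_ext fun n m h => by
    simp [inc_whiskerLeft]
  add_whiskerRight {A B C} f g := graded_hom_ext fun k => tensor_hom_ext fun n m h => by
    simp [inc_whiskerRight]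

/-- The projection of the component of degree `k = n + m` of `A ⊗ B` to the summand `Aₙ ⊗ Bₘ`. -/
def proj (A B : NGraded D) (n m k : ℕ) (h : n + m = k) : deg (A ⊗ B) k ⟶ deg A n ⊗ deg B m :=
  GradedObject.Monoidal.tensorObjDesc (X₁ := A) (X₂ := B) fun i j hij =>
    if e : i = n then eqToHom (by
      subst e
      obtain rfl : j = m := by omega
      rfl) else 0

lemma inc_proj_self (n m k : ℕ) (h : n + m = k) : inc A B n m k h ≫ proj A B n m k h = 𝟙 _ :=
  (GradedObject.Monoidal.ι_tensorObjDesc _ _ _ _).trans (dif_pos rfl)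

lemma inc_proj_of_ne {i j n m k : ℕ} (h : i + j = k) (h' : n + m = k) (hi : i ≠ n) :
    inc A B i j k h ≫ proj A B n m k h' = 0 :=
  (GradedObject.Monoidal.ι_tensorObjDesc _ _ _ _).trans (dif_neg hi)

lemma sum_proj_inc (k : ℕ) : ∑ n : Fin (k + 1), proj A B n (k - n) k (by omega) ≫
    inc A B n (k - n) k (by omega) = 𝟙 _ := by
  refine tensor_hom_ext fun n m h => ?_
  rw [Preadditive.comp_sum, Finset.sum_eq_single ⟨n, by omega⟩]
  · obtain rfl : m = k - n := by omega
    rw [← Category.assoc, inc_proj_self, Category.id_comp, Category.comp_id]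
  · intro j _ hj
    rw [← Category.assoc, inc_proj_of_ne h _ (fun e => hj (Fin.ext e.symm)), zero_comp]
  · simp

lemma hom_tensor_ext {k : ℕ} {Z : D} {f g : Z ⟶ deg (A ⊗ B) k}
    (h : ∀ n m h, f ≫ proj A B n m k h = g ≫ proj A B n m k h) : f = g := by
  rw [← Category.comp_id f, ← Category.comp_id g, ← sum_proj_inc, Preadditive.comp_sum,
    Preadditive.comp_sum]
  refine Finset.sum_congr rfl fun n _ => ?_
  rw [← Category.assoc, h, Category.assoc]

lemma tensorHom_proj (f : A ⟶ A') (g : B ⟶ B') (n m k : ℕ) (h : n + m = k) :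
    degMap (f ⊗ₘ g) k ≫ proj A' B' n m k h = proj A B n m k h ≫ (degMap f n ⊗ₘ degMap g m) := by
  refine tensor_hom_ext fun i j hij => ?_
  rw [← Category.assoc, inc_tensorHom, Category.assoc, ← Category.assoc (inc A B i j k hij)]
  by_cases hi : i = n
  · subst hi
    obtain rfl : j = m := by omega
    rw [inc_proj_self, inc_proj_self, Category.comp_id, Category.id_comp]
  · rw [inc_proj_of_ne _ _ hi, inc_proj_of_ne _ _ hi, zero_comp, comp_zero]

lemma whiskerLeft_proj (g : B ⟶ B') (n m k : ℕ) (h : n + m = k) :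
    degMap (A ◁ g) k ≫ proj A B' n m k h = proj A B n m k h ≫ deg A n ◁ degMap g m := by
  rw [← id_tensorHom, tensorHom_proj, degMap_id, id_tensorHom]

lemma whiskerRight_proj (f : A ⟶ A') (n m k : ℕ) (h : n + m = k) :
    degMap (f ▷ B) k ≫ proj A' B n m k h = proj A B n m k h ≫ degMap f n ▷ deg B m := by
  rw [← tensorHom_id, tensorHom_proj, degMap_id, tensorHom_id]

lemma associator_hom_proj {a b c ab bc k : ℕ} (h₁ : a + b = ab) (h₂ : ab + c = k)
    (h₃ : b + c = bc) (h₄ : a + bc = k) :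
    degMap (α_ A B C).hom k ≫ proj A (B ⊗ C) a bc k h₄ ≫ deg A a ◁ proj B C b c bc h₃ =
      proj (A ⊗ B) C ab c k h₂ ≫ proj A B a b ab h₁ ▷ deg C c ≫ (α_ _ _ _).hom := by
  refine tensor₃'_hom_ext fun i j ij l e₁ e₂ => ?_
  have E := inc_associator_hom (A := A) (B := B) (C := C) e₁ e₂ (b := j) rfl (by omega)
  rw [reassoc_of% E]
  by_cases hi : i = a
  · subst hi
    have z : inc A (B ⊗ C) i (j + l) k (by omega) ≫ proj A (B ⊗ C) i bc k h₄ =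
        eqToHom (by rw [show j + l = bc by omega]) := by
      obtain rfl : j + l = bc := by omega
      exact inc_proj_self _ _ _ _
    by_cases hj : j = b
    · subst hj
      obtain rfl : l = c := by omega
      obtain rfl : ij = ab := by omega
      obtain rfl : j + l = bc := by omega
      rw [reassoc_of% inc_proj_self (A := A) (B := B ⊗ C),
        ← MonoidalCategory.whiskerLeft_comp, inc_proj_self,
        reassoc_of% inc_proj_self (A := A ⊗ B) (B := C), ← comp_whiskerRight_assoc, inc_proj_self]
      simp
    · obtain rfl : bc = j + l := by omega
      rw [reassoc_of% inc_proj_self (A := A) (B := B ⊗ C),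
        ← MonoidalCategory.whiskerLeft_comp, inc_proj_of_ne rfl h₃ hj,
        reassoc_of% inc_proj_of_ne (A := A ⊗ B) (B := C) e₂ h₂ (by omega)]
      simp
  · rw [reassoc_of% inc_proj_of_ne (A := A) (B := B ⊗ C) (i := i) (j := j + l) (by omega) h₄ hi]
    by_cases hij : ij = ab
    · subst hij
      obtain rfl : l = c := by omega
      rw [reassoc_of% inc_proj_self (A := A ⊗ B) (B := C), ← comp_whiskerRight_assoc,
        inc_proj_of_ne e₁ h₁ hi]
      simp
    · rw [reassoc_of% inc_proj_of_ne (A := A ⊗ B) (B := C) e₂ h₂ hij]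
      simp

lemma hom_tensor₃_ext {k : ℕ} {Z : D} {f g : Z ⟶ deg (A ⊗ B ⊗ C) k}
    (h : ∀ a b c bc h₃ h₄, f ≫ proj A (B ⊗ C) a bc k h₄ ≫ deg A a ◁ proj B C b c bc h₃ =
      g ≫ proj A (B ⊗ C) a bc k h₄ ≫ deg A a ◁ proj B C b c bc h₃) : f = g := by
  refine hom_tensor_ext fun a bc h₄ => ?_
  have key : ∀ {Z : D} (f : Z ⟶ deg A a ⊗ deg (B ⊗ C) bc), f =
      ∑ n : Fin (bc + 1), (f ≫ deg A a ◁ proj B C n (bc - n) bc (by omega)) ≫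
        deg A a ◁ inc B C n (bc - n) bc (by omega) := fun f => by
    simp only [Category.assoc, ← MonoidalCategory.whiskerLeft_comp]
    rw [← Preadditive.comp_sum, ← _root_.CategoryTheory.whiskerLeft_sum, sum_proj_inc]
    simp
  rw [key (f ≫ _), key (g ≫ _)]
  refine Finset.sum_congr rfl fun n _ => ?_
  rw [Category.assoc f, Category.assoc g, h]

end GradedInterface

/-! ### Concatenation of tensor powers and the braiding -/

section Concatenation

variable {D : Type u} [Category.{v} D] [MonoidalCategory D] (X : D)

/-- The canonical isomorphism `X^{⊗ k} ⊗ X^{⊗ l} ≅ X^{⊗ N}` for `k + l = N`. -/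
def concat {k l N : ℕ} (h : k + l = N) : tpow X k ⊗ tpow X l ≅ tpow X N :=
  tpowMul X k l ≪≫ eqToIso (by rw [h])

lemma concat_rfl (k l : ℕ) : concat X (rfl : k + l = k + l) = tpowMul X k l := by
  ext; simp [concat]

lemma concat_zero (k : ℕ) : concat X (add_zero k) = ρ_ (tpow X k) :=
  concat_rfl X k 0

lemma concat_succ {k l N : ℕ} (h : k + l = N) :
    concat X (show k + (l + 1) = N + 1 by omega) =
      (α_ (tpow X k) (tpow X l) X).symm ≪≫ whiskerRightIso (concat X h) X := by
  subst h
  refine (concat_rfl X k (l + 1)).trans ?_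
  rw [concat_rfl]
  rfl

lemma concat_succ_hom {k l N : ℕ} (h : k + l = N) :
    (concat X (show k + (l + 1) = N + 1 by omega)).hom =
      (α_ (tpow X k) (tpow X l) X).inv ≫ (concat X h).hom ▷ X :=
  congrArg Iso.hom (concat_succ X h)

lemma concat_succ_inv {k l N : ℕ} (h : k + l = N) :
    (concat X (show k + (l + 1) = N + 1 by omega)).inv =
      (concat X h).inv ▷ X ≫ (α_ (tpow X k) (tpow X l) X).hom :=
  congrArg Iso.inv (concat_succ X h)

lemma zero_concat (l : ℕ) : concat X (zero_add l) = λ_ (tpow X l) := by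
  induction l with
  | zero => exact (concat_zero X 0).trans (Iso.ext unitors_equal.symm)
  | succ l ih =>
    refine (concat_succ X (zero_add l)).trans ?_
    rw [ih]
    exact Iso.ext (leftUnitor_tensor_hom _ _).symm

lemma concat_one (n : ℕ) : tpow X n ◁ (λ_ X).inv ≫ (concat X (rfl : n + 1 = n + 1)).hom =
    𝟙 (tpow X n ⊗ X) := by
  rw [concat_succ_hom X (add_zero n), concat_zero]
  have : tpow X n ◁ (λ_ X).inv ≫ (α_ (tpow X n) (𝟙_ D) X).inv ≫ (ρ_ (tpow X n)).hom ▷ X =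
      𝟙 (tpow X n ⊗ X) := by monoidal
  exact this

lemma concat_assoc {a b c ab bc N : ℕ} (h₁ : a + b = ab) (h₂ : ab + c = N) (h₃ : b + c = bc)
    (h₄ : a + bc = N) :
    (concat X h₁).hom ▷ tpow X c ≫ (concat X h₂).hom =
      (α_ _ _ _).hom ≫ tpow X a ◁ (concat X h₃).hom ≫ (concat X h₄).hom := by
  induction c generalizing bc N with
  | zero =>
    obtain rfl : N = ab := by omega
    obtain rfl : bc = b := by omega
    rw [concat_zero, concat_zero]
    have : (concat X h₁).hom ▷ 𝟙_ D ≫ (ρ_ _).hom =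
      (α_ (tpow X a) (tpow X bc) (𝟙_ D)).hom ≫ tpow X a ◁ (ρ_ (tpow X bc)).hom ≫
        (concat X h₁).hom := by simp
    exact this
  | succ c ih =>
    obtain ⟨bc, rfl⟩ : ∃ m, bc = m + 1 := ⟨bc - 1, by omega⟩
    obtain ⟨N, rfl⟩ : ∃ m, N = m + 1 := ⟨N - 1, by omega⟩
    have h2 : ab + c = N := by omega
    have h3 : b + c = bc := by omega
    have h4 : a + bc = N := by omega
    rw [concat_succ_hom X h2, concat_succ_hom X h3, concat_succ_hom X h4]
    have I := congrArg (fun f => (α_ _ _ _).inv ≫ f ▷ X) (ih h2 h3 h4)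
    simp only [comp_whiskerRight] at I
    have : (concat X h₁).hom ▷ (tpow X c ⊗ X) ≫ (α_ _ _ X).inv ≫ (concat X h2).hom ▷ X =
      (α_ _ _ _).hom ≫ tpow X a ◁ ((α_ (tpow X b) (tpow X c) X).inv ≫ (concat X h3).hom ▷ X) ≫
        (α_ _ _ _).inv ≫ (concat X h4).hom ▷ X := by
      rw [associator_inv_naturality_left_assoc, I]
      simp
    exact this

lemma concat_assoc_inv {a b c ab bc N : ℕ} (h₁ : a + b = ab) (h₂ : ab + c = N) (h₃ : b + c = bc)
    (h₄ : a + bc = N) :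
    (concat X h₂).inv ≫ (concat X h₁).inv ▷ tpow X c ≫ (α_ _ _ _).hom =
      (concat X h₄).inv ≫ tpow X a ◁ (concat X h₃).inv := by
  have e : whiskerRightIso (concat X h₁) (tpow X c) ≪≫ concat X h₂ =
      α_ _ _ _ ≪≫ whiskerLeftIso (tpow X a) (concat X h₃) ≪≫ concat X h₄ :=
    Iso.ext (concat_assoc X h₁ h₂ h₃ h₄)
  have := congrArg (fun i => i.inv ≫ (α_ (tpow X a) (tpow X b) (tpow X c)).hom) e
  simpa using this

variable [BraidedCategory D]

lemma comp_whiskerRight_assoc' {A B C E F : D} (p : A ⟶ B ⊗ X) (f : B ⟶ C) (g : C ⟶ E)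
    (q : E ⊗ X ⟶ F) : p ≫ (f ≫ g) ▷ X ≫ q = (p ≫ f ▷ X) ≫ g ▷ X ≫ q := by
  simp

/-- The braid `cycleBraid X N k` is the braiding of the last factor with the block of the `l`
factors before it. -/
lemma concat_inv_braiding {k l N : ℕ} (h : k + l = N) :
    (concat X h).inv ▷ X ≫ (α_ (tpow X k) (tpow X l) X).hom ≫
        tpow X k ◁ (β_ (tpow X l) X).hom ≫ (α_ (tpow X k) X (tpow X l)).inv =
      cycleBraid X N k ≫ (concat X (show k + 1 + l = N + 1 by omega)).inv := by
  induction l generalizing N with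
  | zero =>
    obtain rfl : k = N := h
    rw [cycleBraid_of_le X le_rfl, Category.id_comp, concat_zero, concat_zero]
    have : (ρ_ (tpow X k)).inv ▷ X ≫ (α_ (tpow X k) (𝟙_ D) X).hom ≫
        tpow X k ◁ (β_ (𝟙_ D) X).hom ≫ (α_ (tpow X k) X (𝟙_ D)).inv =
        (ρ_ (tpow X k ⊗ X)).inv := by
      rw [braiding_tensorUnit_left]
      monoidal
    exact this
  | succ l ih =>
    obtain ⟨N, rfl⟩ : ∃ m, N = m + 1 := ⟨N - 1, by omega⟩
    have h' : k + l = N := by omega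
    have h'' : k + 1 + l = N + 1 := by omega
    rw [cycleBraid_succ X (by omega), concat_succ_inv X h', concat_succ_inv X h'', adjBraiding_last]
    have I := congrArg (fun f => ((α_ (tpow X N) X X).hom ≫ tpow X N ◁ (β_ X X).hom ≫
      (α_ (tpow X N) X X).inv) ≫ f ▷ X ≫ (α_ _ _ _).hom) (ih h')
    have : ((concat X h').inv ▷ X ≫ (α_ (tpow X k) (tpow X l) X).hom) ▷ X ≫
          (α_ (tpow X k) (tpow X l ⊗ X) X).hom ≫ tpow X k ◁ (β_ (tpow X l ⊗ X) X).hom ≫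
            (α_ (tpow X k) X (tpow X l ⊗ X)).inv =
        ((α_ (tpow X N) X X).hom ≫ tpow X N ◁ (β_ X X).hom ≫ (α_ (tpow X N) X X).inv) ≫
          (((concat X h').inv ▷ X ≫ (α_ (tpow X k) (tpow X l) X).hom ≫
            tpow X k ◁ (β_ (tpow X l) X).hom ≫ (α_ (tpow X k) X (tpow X l)).inv) ▷ X) ≫
              (α_ (tpow X k ⊗ X) (tpow X l) X).hom := by
      -- The hexagon identity splits off the last factor of the block.
      simp only [comp_whiskerRight, Category.assoc, BraidedCategory.braiding_tensor_left_hom]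
      rw [← associator_inv_naturality_left_assoc, whisker_exchange_assoc,
        ← associator_naturality_left_assoc]
      monoidal
    exact this.trans (I.trans (comp_whiskerRight_assoc' X _ _ _ _))

/-- The braid `cycleBraid' X N k` is the braiding of the factor at the place `k` with the block of
the `l` factors which follow it. -/
lemma braiding_concat {k l N : ℕ} (h : k + l = N) :
    (α_ (tpow X k) X (tpow X l)).hom ≫ tpow X k ◁ (β_ X (tpow X l)).hom ≫
        (α_ (tpow X k) (tpow X l) X).inv ≫ (concat X h).hom ▷ X =
      (concat X (show k + 1 + l = N + 1 by omega)).hom ≫ cycleBraid' X N k := by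
  induction l generalizing N with
  | zero =>
    obtain rfl : k = N := h
    rw [cycleBraid'_of_le X le_rfl, Category.comp_id, concat_zero, concat_zero]
    have : (α_ (tpow X k) X (𝟙_ D)).hom ≫ tpow X k ◁ (β_ X (𝟙_ D)).hom ≫
        (α_ (tpow X k) (𝟙_ D) X).inv ≫ (ρ_ (tpow X k)).hom ▷ X = (ρ_ (tpow X k ⊗ X)).hom := by
      rw [braiding_tensorUnit_right]
      monoidal
    exact this
  | succ l ih =>
    obtain ⟨N, rfl⟩ : ∃ m, N = m + 1 := ⟨N - 1, by omega⟩
    have h' : k + l = N := by omega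
    have h'' : k + 1 + l = N + 1 := by omega
    rw [cycleBraid'_succ X (by omega), concat_succ_hom X h', concat_succ_hom X h'',
      adjBraiding_last]
    have I := congrArg (fun f => (α_ _ _ _).inv ≫ f ▷ X ≫ ((α_ (tpow X N) X X).hom ≫
      tpow X N ◁ (β_ X X).hom ≫ (α_ (tpow X N) X X).inv)) (ih h')
    have : (α_ (tpow X k) X (tpow X l ⊗ X)).hom ≫ tpow X k ◁ (β_ X (tpow X l ⊗ X)).hom ≫
          (α_ (tpow X k) (tpow X l ⊗ X) X).inv ≫
            ((α_ (tpow X k) (tpow X l) X).inv ≫ (concat X h').hom ▷ X) ▷ X =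
        (α_ (tpow X k ⊗ X) (tpow X l) X).inv ≫
          ((α_ (tpow X k) X (tpow X l)).hom ≫ tpow X k ◁ (β_ X (tpow X l)).hom ≫
            (α_ (tpow X k) (tpow X l) X).inv ≫ (concat X h').hom ▷ X) ▷ X ≫
          ((α_ (tpow X N) X X).hom ≫ tpow X N ◁ (β_ X X).hom ≫ (α_ (tpow X N) X X).inv) := by
      -- The hexagon identity splits off the last factor of the block.
      simp only [comp_whiskerRight, Category.assoc, BraidedCategory.braiding_tensor_right_hom]
      rw [associator_naturality_left_assoc, ← whisker_exchange_assoc,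
        associator_inv_naturality_left]
      monoidal
    exact this.trans (I.trans (comp_whiskerRight_assoc' X _ _ _ _))

lemma cycleBraid_zero (N : ℕ) : cycleBraid X N 0 =
    (β_ (tpow X N) X).hom ≫ (λ_ X).inv ▷ tpow X N ≫ (concat X (add_comm 1 N)).hom := by
  have h := concat_inv_braiding X (zero_add N)
  rw [zero_concat] at h
  rw [← (Iso.eq_comp_inv _).1 h]
  have : ∀ {A B : D} (f : (𝟙_ D ⊗ X) ⊗ A ⟶ B), (β_ A X).hom ≫ (λ_ X).inv ▷ A ≫ f =
      ((λ_ A).inv ▷ X ≫ (α_ (𝟙_ D) A X).hom ≫ 𝟙_ D ◁ (β_ A X).hom ≫ (α_ (𝟙_ D) X A).inv) ≫ f := by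
    intro A B f
    simp only [← Category.assoc]
    congr 1
    simp
  exact (this _).symm

end Concatenation

/-! ### Morphisms of graded objects to and from tensor products -/

section Components

variable {D : Type u} [Category.{v} D] [Abelian D] [MonoidalCategory D] [MonoidalPreadditive D]
variable {A B C : NGraded D}

lemma braiding_proj [BraidedCategory D] (n m k : ℕ) (h : n + m = k) :
    degMap (β_ A B).hom k ≫ proj B A m n k ((add_comm m n).trans h) =
      ((-1 : ℤ) ^ (n * m)) • (proj A B n m k h ≫ (β_ (deg A n) (deg B m)).hom) := by
  refine tensor_hom_ext fun i j hij => ?_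
  rw [← Category.assoc, inc_braiding, Preadditive.zsmul_comp, Category.assoc,
    Preadditive.comp_zsmul, ← Category.assoc (inc A B i j k hij)]
  by_cases hi : i = n
  · subst hi
    obtain rfl : j = m := by omega
    rw [inc_proj_self, inc_proj_self, Category.comp_id, Category.id_comp]
  · rw [inc_proj_of_ne _ _ hi, inc_proj_of_ne _ _ (show j ≠ m by omega), comp_zero, zero_comp,
      smul_zero, smul_zero]

lemma associator_inv_proj {a b c ab bc k : ℕ} (h₁ : a + b = ab) (h₂ : ab + c = k)
    (h₃ : b + c = bc) (h₄ : a + bc = k) :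
    degMap (α_ A B C).inv k ≫ proj (A ⊗ B) C ab c k h₂ ≫ proj A B a b ab h₁ ▷ deg C c =
      proj A (B ⊗ C) a bc k h₄ ≫ deg A a ◁ proj B C b c bc h₃ ≫ (α_ _ _ _).inv := by
  have h := associator_hom_proj (A := A) (B := B) (C := C) h₁ h₂ h₃ h₄
  rw [← Category.assoc, ← Category.assoc, Iso.eq_comp_inv, Category.assoc, Category.assoc, ← h,
    ← Category.assoc, ← degMap_comp, Iso.inv_hom_id, degMap_id, Category.id_comp]

lemma unit_hom_ext {f g : 𝟙_ (NGraded D) ⟶ A} (h : degMap f 0 = degMap g 0) : f = g := by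
  refine graded_hom_ext fun n => ?_
  by_cases hn : n = 0
  · subst hn; exact h
  · exact (isZero_deg_unit hn).eq_of_src _ _

lemma hom_unit_ext {f g : A ⟶ 𝟙_ (NGraded D)} (h : degMap f 0 = degMap g 0) : f = g := by
  refine graded_hom_ext fun n => ?_
  by_cases hn : n = 0
  · subst hn; exact h
  · exact (isZero_deg_unit hn).eq_of_tgt _ _

lemma ι_mulOfComponents {A B C : GradedObject ℕ D} (f : ∀ n m : ℕ, A n ⊗ B m ⟶ C (n + m))
    (n m k : ℕ) (h : n + m = k) : GradedObject.Monoidal.ιTensorObj A B n m k h ≫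
      mulOfComponents f k = f n m ≫ eqToHom (congrArg C h) := by
  simp [mulOfComponents]

lemma comulOfComponents_proj {f : ∀ n m : ℕ, deg C (n + m) ⟶ deg A n ⊗ deg B m}
    (n m k : ℕ) (h : n + m = k) :
    degMap (comulOfComponents (A := A) (B := B) (C := C) f : C ⟶ A ⊗ B) k ≫ proj A B n m k h =
      eqToHom (congrArg (deg C) h.symm) ≫ f n m := by
  change (∑ n : Fin (k + 1), eqToHom (congrArg (deg C) (Nat.add_sub_cancel' n.is_le).symm) ≫
    f n (k - n) ≫ inc A B n (k - n) k (Nat.add_sub_cancel' n.is_le)) ≫ proj A B n m k h = _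
  rw [Preadditive.sum_comp, Finset.sum_eq_single ⟨n, by omega⟩]
  · obtain rfl : m = k - n := by omega
    simp [inc_proj_self]
  · intro j _ hj
    rw [Category.assoc, Category.assoc, inc_proj_of_ne _ _ (fun e => hj (Fin.ext e)), comp_zero,
      comp_zero]
  · simp

/-! ### The generating object -/

open scoped ZeroObject

/-- The object `X`, placed in degree `1`. -/
def genObj (X : D) : NGraded D := fun n : ℕ =>
  match n with
  | 0 => (0 : D)
  | 1 => X
  | _ + 2 => (0 : D)

lemma isZero_deg_genObj (X : D) {n : ℕ} (hn : n ≠ 1) : IsZero (deg (genObj X) n) := by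
  match n with
  | 0 => exact isZero_zero D
  | 1 => exact absurd rfl hn
  | _ + 2 => exact isZero_zero D

/-- The morphism from `X` in degree `1` with the given component. -/
def ofGen {X : D} (f : X ⟶ deg A 1) : genObj X ⟶ A := homOfDegMap fun n =>
  match n with
  | 0 => 0
  | 1 => f
  | _ + 2 => 0

/-- The morphism to `X` in degree `1` with the given component. -/
def toGen {X : D} (f : deg A 1 ⟶ X) : A ⟶ genObj X := homOfDegMap fun n =>
  match n with
  | 0 => 0
  | 1 => f
  | _ + 2 => 0

lemma gen_hom_ext {X : D} {f g : genObj X ⟶ A} (h : degMap f 1 = degMap g 1) : f = g := by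
  refine graded_hom_ext fun n => ?_
  by_cases hn : n = 1
  · subst hn; exact h
  · exact (isZero_deg_genObj X hn).eq_of_src _ _

lemma tensor_gen_deg_ext {X : D} {n : ℕ} {Z : D} {f g : deg (A ⊗ genObj X) (n + 1) ⟶ Z}
    (h : inc A (genObj X) n 1 (n + 1) rfl ≫ f = inc A (genObj X) n 1 (n + 1) rfl ≫ g) : f = g := by
  refine tensor_hom_ext fun m l hml => ?_
  by_cases hl : l = 1
  · subst hl
    obtain rfl : m = n := by omega
    exact h
  · exact (isZero_tensor_left _ (isZero_deg_genObj X hl)).eq_of_src _ _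

lemma isZero_tensor_gen_zero (X : D) : IsZero (deg (A ⊗ genObj X) 0) := by
  rw [IsZero.iff_id_eq_zero]
  refine tensor_hom_ext fun m l hml => ?_
  exact (isZero_tensor_left _ (isZero_deg_genObj X (by omega))).eq_of_src _ _

lemma tensor_gen_hom_ext {X : D} {f g : A ⊗ genObj X ⟶ B}
    (h : ∀ n, inc A (genObj X) n 1 (n + 1) rfl ≫ degMap f (n + 1) =
      inc A (genObj X) n 1 (n + 1) rfl ≫ degMap g (n + 1)) : f = g := by
  refine graded_hom_ext fun n => ?_
  cases n with
  | zero => exact (isZero_tensor_gen_zero X).eq_of_src _ _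
  | succ n => exact tensor_gen_deg_ext (h n)

lemma hom_tensor_gen_ext {X : D} {f g : B ⟶ A ⊗ genObj X}
    (h : ∀ n, degMap f (n + 1) ≫ proj A (genObj X) n 1 (n + 1) rfl =
      degMap g (n + 1) ≫ proj A (genObj X) n 1 (n + 1) rfl) : f = g := by
  refine graded_hom_ext fun n => ?_
  cases n with
  | zero => exact (isZero_tensor_gen_zero X).eq_of_tgt _ _
  | succ n =>
    refine hom_tensor_ext fun m l hml => ?_
    by_cases hl : l = 1
    · subst hl
      obtain rfl : m = n := by omega
      exact h m
    · exact (isZero_tensor_left _ (isZero_deg_genObj X hl)).eq_of_tgt _ _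

lemma proj_inc_gen (X : D) (n : ℕ) :
    proj A (genObj X) n 1 (n + 1) rfl ≫ inc A (genObj X) n 1 (n + 1) rfl = 𝟙 _ :=
  tensor_gen_deg_ext (by rw [reassoc_of% inc_proj_self (A := A), Category.comp_id])

/-! ### The components of the structure morphisms -/

variable (X : D)

lemma inc_tensorMul (n m k : ℕ) (h : n + m = k) :
    inc (tensorAlg X) (tensorAlg X) n m k h ≫ degMap (tensorMul X) k = (concat X h).hom := by
  refine (ι_mulOfComponents (A := fun j => tpow X j) (B := fun j => tpow X j)
    (C := fun j => tpow X j) (fun n m => (tpowMul X n m).hom) n m k h).trans ?_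
  simp [concat]

lemma shuffleComul_proj (n m k : ℕ) (h : n + m = k) :
    degMap (shuffleComul X) k ≫ proj (shuffleAlg X) (shuffleAlg X) n m k h =
      (concat X h).inv := by
  refine (comulOfComponents_proj (A := shuffleAlg X) (B := shuffleAlg X) (C := shuffleAlg X)
    (f := fun n m => (tpowMul X n m).inv) n m k h).trans ?_
  simp only [concat, Iso.trans_inv, eqToIso.inv]
  rfl

variable [BraidedCategory D]

lemma inc_shuffleMul (n m k : ℕ) (h : n + m = k) :
    inc (shuffleAlg X) (shuffleAlg X) n m k h ≫ degMap (shuffleMul X) k =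
      (concat X h).hom ≫ inverseShuffleSumAt X k n := by
  refine (ι_mulOfComponents (A := fun j => tpow X j) (B := fun j => tpow X j)
    (C := fun j => tpow X j) (fun n m => (tpowMul X n m).hom ≫ inverseShuffleSum X n m)
    n m k h).trans ?_
  subst h
  simp [concat, inverseShuffleSum_eq]

lemma tensorComul_proj (n m k : ℕ) (h : n + m = k) :
    degMap (tensorComul X) k ≫ proj (tensorAlg X) (tensorAlg X) n m k h =
      shuffleSumAt X k n ≫ (concat X h).inv := by
  refine (comulOfComponents_proj (A := tensorAlg X) (B := tensorAlg X) (C := tensorAlg X)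
    (f := fun n m => shuffleSum X n m ≫ (tpowMul X n m).inv) n m k h).trans ?_
  subst h
  rw [shuffleSum_eq, concat_rfl]
  exact Category.id_comp _

end Components

/-! ### The algebra `T(X)` and its generators -/

section TensorHopf

variable {D : Type u} [Category.{v} D] [Abelian D] [MonoidalCategory D] [MonoidalPreadditive D]
variable (X : D)

lemma degMap_tensorOne : degMap (tensorOne X) 0 = (unitZero D).inv := rfl

lemma tensor_one_mul : tensorOne X ▷ tensorAlg X ≫ tensorMul X = (λ_ (tensorAlg X)).hom := by
  refine graded_hom_ext fun k => unit_tensor_hom_ext ?_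
  rw [degMap_comp, ← Category.assoc, inc_whiskerRight, inc_leftUnitor_hom, Category.assoc]
  erw [inc_tensorMul, zero_concat]
  rfl

lemma tensor_mul_one : tensorAlg X ◁ tensorOne X ≫ tensorMul X = (ρ_ (tensorAlg X)).hom := by
  refine graded_hom_ext fun k => tensor_unit_hom_ext ?_
  rw [degMap_comp, ← Category.assoc, inc_whiskerLeft, inc_rightUnitor_hom, Category.assoc]
  erw [inc_tensorMul, concat_zero]
  rfl

lemma tensor_mul_assoc : tensorMul X ▷ tensorAlg X ≫ tensorMul X =
    (α_ (tensorAlg X) (tensorAlg X) (tensorAlg X)).hom ≫ tensorAlg X ◁ tensorMul X ≫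
      tensorMul X := by
  refine graded_hom_ext fun k => tensor₃'_hom_ext fun a b ab c h₁ h₂ => ?_
  have hl : inc (tensorAlg X) (tensorAlg X) a b ab h₁ ▷ deg (tensorAlg X) c ≫
      inc (tensorAlg X ⊗ tensorAlg X) (tensorAlg X) ab c k h₂ ≫
      degMap (tensorMul X ▷ tensorAlg X ≫ tensorMul X) k =
      (concat X h₁).hom ▷ tpow X c ≫ (concat X h₂).hom := by
    rw [degMap_comp, ← Category.assoc (inc _ _ _ _ _ _), inc_whiskerRight, Category.assoc,
      ← comp_whiskerRight_assoc, inc_tensorMul, inc_tensorMul]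
    rfl
  have hr : inc (tensorAlg X) (tensorAlg X) a b ab h₁ ▷ deg (tensorAlg X) c ≫
      inc (tensorAlg X ⊗ tensorAlg X) (tensorAlg X) ab c k h₂ ≫
      degMap ((α_ (tensorAlg X) (tensorAlg X) (tensorAlg X)).hom ≫ tensorAlg X ◁ tensorMul X ≫
      tensorMul X) k =
      (α_ _ _ _).hom ≫ tpow X a ◁ (concat X (rfl : b + c = b + c)).hom ≫
        (concat X (by omega)).hom := by
    rw [degMap_comp, degMap_comp,
      reassoc_of% inc_associator_hom (A := tensorAlg X) (B := tensorAlg X) (C := tensorAlg X)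
        h₁ h₂ rfl (by omega), ← Category.assoc (inc _ _ _ _ _ _), inc_whiskerLeft, Category.assoc,
      ← MonoidalCategory.whiskerLeft_comp_assoc, inc_tensorMul, inc_tensorMul]
    rfl
  rw [hl, hr]
  exact concat_assoc X h₁ h₂ rfl (by omega)

/-- The algebra structure of `T(X)`. -/
instance tensorMon : MonObj (tensorAlg X) where
  one := tensorOne X
  mul := tensorMul X
  one_mul := tensor_one_mul X
  mul_one := tensor_mul_one X
  mul_assoc := tensor_mul_assoc X

lemma tensorMon_mul : μ[tensorAlg X] = tensorMul X := rfl

/-- The inclusion of the generators `X` of `T(X)`, in degree `1`. -/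
def genIncl : genObj X ⟶ tensorAlg X := ofGen (λ_ X).inv

/-- The identification of `X^{⊗ n} ⊗ X` with `X^{⊗ (n + 1)}`. The two objects agree by definition,
but not syntactically as components of graded objects. -/
def appendGen (n : ℕ) :
    deg (tensorAlg X) n ⊗ deg (genObj X) 1 ⟶ deg (tensorAlg X) (n + 1) :=
  𝟙 (tpow X n ⊗ X)

lemma inc_mulGen (n : ℕ) : inc (tensorAlg X) (genObj X) n 1 (n + 1) rfl ≫
    degMap (mulGen (genIncl X)) (n + 1) = appendGen X n := by
  rw [mulGen, degMap_comp, ← Category.assoc, inc_whiskerLeft, Category.assoc, tensorMon_mul,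
    inc_tensorMul]
  exact concat_one X n

lemma degMap_mulGen (n : ℕ) : degMap (mulGen (genIncl X)) (n + 1) =
    proj (tensorAlg X) (genObj X) n 1 (n + 1) rfl ≫ appendGen X n := by
  rw [← inc_mulGen, ← Category.assoc, proj_inc_gen, Category.id_comp]

lemma degMap_mulGen_zero : degMap (mulGen (genIncl X)) 0 = 0 :=
  (isZero_tensor_gen_zero X).eq_of_src _ _

/-- In degree `n` the `n`-fold monomial is a split epimorphism; its source contains `X^{⊗ n}`
as a direct summand, on which it is the identity. -/
lemma exists_monomial_section (n : ℕ) : ∃ (P : NGraded D) (p : P ⟶ tensorAlg X),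
    Monomial (genIncl X) p ∧ ∃ s : deg (tensorAlg X) n ⟶ deg P n, s ≫ degMap p n = 𝟙 _ := by
  induction n with
  | zero => exact ⟨_, _, Monomial.one, (unitZero D).hom, (unitZero D).hom_inv_id⟩
  | succ n ih =>
    obtain ⟨P, p, hp, s, hs⟩ := ih
    refine ⟨_, _, hp.mul, s ▷ deg (genObj X) 1 ≫ inc P (genObj X) n 1 (n + 1) rfl, ?_⟩
    have e : s ▷ deg (genObj X) 1 ≫ inc P (genObj X) n 1 (n + 1) rfl ≫
        degMap ((p ⊗ₘ genIncl X) ≫ μ[tensorAlg X]) (n + 1) =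
        (s ≫ degMap p n) ▷ deg (genObj X) 1 ≫ appendGen X n := by
      rw [MonoidalCategory.tensorHom_def, Category.assoc, degMap_comp,
        reassoc_of% inc_whiskerRight (A := P) (B := genObj X), inc_mulGen, comp_whiskerRight,
        Category.assoc]
    rw [hs, id_whiskerRight, Category.id_comp] at e
    exact (Category.assoc _ _ _).trans e

lemma generates_genIncl : Generates (genIncl X) := by
  intro W B f g h
  refine graded_hom_ext fun k => tensor_hom_ext fun n m hk => ?_
  obtain ⟨P, p, hp, s, hs⟩ := exists_monomial_section X m
  have key : ∀ f : W ⊗ tensorAlg X ⟶ B, inc W (tensorAlg X) n m k hk ≫ degMap f k =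
      deg W n ◁ s ≫ inc W P n m k hk ≫ degMap (W ◁ p ≫ f) k := by
    intro f
    rw [degMap_comp, reassoc_of% inc_whiskerLeft (A := W) (B := P),
      ← MonoidalCategory.whiskerLeft_comp_assoc]
    rw [hs, MonoidalCategory.whiskerLeft_id, Category.id_comp]
  rw [key f, key g, h p hp]

variable [BraidedCategory D]

lemma tensor_one_comul : tensorOne X ≫ tensorComul X =
    (λ_ (𝟙_ (NGraded D))).inv ≫ (tensorOne X ⊗ₘ tensorOne X) := by
  refine unit_hom_ext (hom_tensor_ext fun n m h => ?_)
  obtain rfl : n = 0 := by omega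
  obtain rfl : m = 0 := by omega
  rw [degMap_comp, Category.assoc, tensorComul_proj, degMap_comp, Category.assoc, tensorHom_proj,
    degMap_leftUnitor_inv, Category.assoc, Category.assoc,
    reassoc_of% inc_proj_self (A := 𝟙_ (NGraded D)) (B := 𝟙_ (NGraded D)),
    shuffleSumAt_of_trivial X (Or.inl rfl), concat_zero, degMap_tensorOne]
  have : (unitZero D).inv ≫ 𝟙 _ ≫ (ρ_ (𝟙_ D)).inv =
      (λ_ (deg (𝟙_ (NGraded D)) 0)).inv ≫ (unitZero D).hom ▷ deg (𝟙_ (NGraded D)) 0 ≫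
        ((unitZero D).inv ⊗ₘ (unitZero D).inv) := by
    rw [MonoidalCategory.tensorHom_def, ← comp_whiskerRight_assoc, Iso.hom_inv_id,
      id_whiskerRight, Category.id_comp, Category.id_comp, ← leftUnitor_inv_naturality,
      unitors_inv_equal]
  exact this

lemma degMap_mulSnd_proj (n m k : ℕ) (h : n + m = k) :
    degMap (mulSnd (mulGen (genIncl X))) (k + 1) ≫
        proj (tensorAlg X) (tensorAlg X) n (m + 1) (k + 1) (by omega) =
      proj (tensorAlg X ⊗ tensorAlg X) (genObj X) k 1 (k + 1) rfl ≫
        proj (tensorAlg X) (tensorAlg X) n m k h ▷ deg (genObj X) 1 ≫ (α_ _ _ _).hom ≫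
          deg (tensorAlg X) n ◁ appendGen X m := by
  rw [mulSnd, degMap_comp, Category.assoc, whiskerLeft_proj, degMap_mulGen,
    MonoidalCategory.whiskerLeft_comp, reassoc_of% associator_hom_proj (A := tensorAlg X)
      (B := tensorAlg X) (C := genObj X) h rfl (show m + 1 = m + 1 from rfl) (by omega)]

lemma degMap_mulSnd_proj_zero (k : ℕ) : degMap (mulSnd (mulGen (genIncl X))) k ≫
    proj (tensorAlg X) (tensorAlg X) k 0 k rfl = 0 := by
  rw [mulSnd, degMap_comp, Category.assoc, whiskerLeft_proj, degMap_mulGen_zero,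
    MonoidalPreadditive.whiskerLeft_zero, comp_zero, comp_zero]

lemma degMap_mulFst_proj (n m k : ℕ) (h : n + m = k) :
    degMap (mulFst (mulGen (genIncl X))) (k + 1) ≫
        proj (tensorAlg X) (tensorAlg X) (n + 1) m (k + 1) (by omega) =
      ((-1 : ℤ) ^ m) • (proj (tensorAlg X ⊗ tensorAlg X) (genObj X) k 1 (k + 1) rfl ≫
        proj (tensorAlg X) (tensorAlg X) n m k h ▷ deg (genObj X) 1 ≫ (α_ _ _ _).hom ≫
          deg (tensorAlg X) n ◁ (β_ (deg (tensorAlg X) m) (deg (genObj X) 1)).hom ≫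
            (α_ _ _ _).inv ≫ appendGen X n ▷ deg (tensorAlg X) m) := by
  have hb := braiding_proj (A := tensorAlg X) (B := genObj X) m 1 (m + 1) rfl
  rw [mul_one] at hb
  rw [mulFst, degMap_comp, degMap_comp, degMap_comp, Category.assoc, Category.assoc,
    Category.assoc, whiskerRight_proj, degMap_mulGen, comp_whiskerRight,
    reassoc_of% associator_inv_proj (A := tensorAlg X) (B := genObj X) (C := tensorAlg X)
      (a := n) (b := 1) (c := m) rfl (k := k + 1) (by omega) (bc := m + 1) (by omega) (by omega),
    reassoc_of% whiskerLeft_proj (A := tensorAlg X), ← MonoidalCategory.whiskerLeft_comp_assoc,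
    hb, whiskerLeft_zsmul, Preadditive.zsmul_comp, MonoidalCategory.whiskerLeft_comp,
    Preadditive.comp_zsmul, Preadditive.comp_zsmul, Category.assoc,
    reassoc_of% associator_hom_proj (A := tensorAlg X)
      (B := tensorAlg X) (C := genObj X) h rfl (show m + 1 = m + 1 from rfl) (by omega)]

lemma degMap_mulFst_proj_zero (k : ℕ) : degMap (mulFst (mulGen (genIncl X))) k ≫
    proj (tensorAlg X) (tensorAlg X) 0 k k (zero_add k) = 0 := by
  rw [mulFst, degMap_comp, degMap_comp, degMap_comp, Category.assoc, Category.assoc,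
    Category.assoc, whiskerRight_proj, degMap_mulGen_zero,
    MonoidalPreadditive.zero_whiskerRight, comp_zero, comp_zero, comp_zero, comp_zero]

end TensorHopf

/-! ### The Hopf algebra `T(X)` -/

section TensorHopf

variable {D : Type u} [Category.{v} D] [Abelian D] [MonoidalCategory D] [MonoidalPreadditive D]
variable [BraidedCategory D] (X : D)

lemma whiskerRight_concat_inv {n m N : ℕ} (h : n + m = N) (f : tpow X N ⟶ tpow X N) :
    (f ≫ (concat X h).inv) ▷ X ≫ (α_ (tpow X n) (tpow X m) X).hom =
      addStrand X f ≫ (concat X (show n + (m + 1) = N + 1 by omega)).inv := by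
  rw [concat_succ_inv X h]
  have : (f ≫ (concat X h).inv) ▷ X ≫ (α_ (tpow X n) (tpow X m) X).hom =
    f ▷ X ≫ (concat X h).inv ▷ X ≫ (α_ (tpow X n) (tpow X m) X).hom := by simp
  exact this

lemma whiskerRight_concat_inv_braiding {n m N : ℕ} (h : n + m = N) (f : tpow X N ⟶ tpow X N) :
    ((-1 : ℤ) ^ m) • ((f ≫ (concat X h).inv) ▷ X ≫ (α_ (tpow X n) (tpow X m) X).hom ≫
      tpow X n ◁ (β_ (tpow X m) X).hom ≫ (α_ (tpow X n) X (tpow X m)).inv) =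
      addStrand X f ≫ signedCycle X N n ≫ (concat X (show n + 1 + m = N + 1 by omega)).inv := by
  obtain rfl : m = N - n := by omega
  rw [signedCycle, Preadditive.zsmul_comp, ← concat_inv_braiding X h, comp_whiskerRight,
    Category.assoc (f ▷ X)]
  exact (Preadditive.comp_zsmul (f ▷ X) _ _).symm

/-- The component `X^{⊗ k} ⟶ X^{⊗ n} ⊗ X^{⊗ m}` of the coproduct of `T(X)`. -/
def comulComponent {n m k : ℕ} (h : n + m = k) :
    deg (tensorAlg X) k ⟶ deg (tensorAlg X) n ⊗ deg (tensorAlg X) m :=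
  shuffleSumAt X k n ≫ (concat X h).inv

/-- The part of a shuffle coproduct in which the last factor goes to the right. -/
def comulSnd {n m k : ℕ} (h : n + m = k) :
    deg (tensorAlg X) k ⊗ deg (genObj X) 1 ⟶ deg (tensorAlg X) n ⊗ deg (tensorAlg X) (m + 1) :=
  comulComponent X h ▷ deg (genObj X) 1 ≫ (α_ _ _ _).hom ≫ deg (tensorAlg X) n ◁ appendGen X m

/-- The part of a shuffle coproduct in which the last factor goes to the left. -/
def comulFst {n m k : ℕ} (h : n + m = k) :
    deg (tensorAlg X) k ⊗ deg (genObj X) 1 ⟶ deg (tensorAlg X) (n + 1) ⊗ deg (tensorAlg X) m :=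
  ((-1 : ℤ) ^ m) • (comulComponent X h ▷ deg (genObj X) 1 ≫ (α_ _ _ _).hom ≫
    deg (tensorAlg X) n ◁ (β_ (deg (tensorAlg X) m) (deg (genObj X) 1)).hom ≫
      (α_ _ _ _).inv ≫ appendGen X n ▷ deg (tensorAlg X) m)

/-- Appending the last factor to the second part of a shuffle is `addStrand`. -/
lemma comulSnd_eq {n m k : ℕ} (h : n + m = k) : comulSnd X h =
    (addStrand X (shuffleSumAt X k n) ≫ (concat X (show n + (m + 1) = k + 1 by omega)).inv :) := by
  rw [← whiskerRight_concat_inv X h]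
  have : ∀ {A B C E : D} (p : A ⟶ B) (q : B ⟶ C ⊗ E), p ≫ q ≫ C ◁ 𝟙 E = p ≫ q := by simp
  exact this _ _

/-- Moving the last factor past the second part of a shuffle is a cyclic braid; its sign is that of
the braiding of graded objects. -/
lemma comulFst_eq {n m k : ℕ} (h : n + m = k) : comulFst X h =
    (addStrand X (shuffleSumAt X k n) ≫ signedCycle X k n ≫
      (concat X (show n + 1 + m = k + 1 by omega)).inv :) := by
  rw [← whiskerRight_concat_inv_braiding X h]
  have : ∀ {A B C E F G : D} (p : A ⟶ B) (q : B ⟶ C) (r : C ⟶ G) (s : G ⟶ E ⊗ F),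
      ((-1 : ℤ) ^ m) • (p ≫ q ≫ r ≫ s ≫ 𝟙 E ▷ F) = ((-1 : ℤ) ^ m) • (p ≫ q ≫ r ≫ s) := by simp
  exact this _ _ _ _

lemma appendGen_comulComponent {n m k : ℕ} (h : n + (m + 1) = k) :
    appendGen X k ≫ comulComponent X (show n + 1 + (m + 1) = k + 1 by omega) =
      comulSnd X (show n + 1 + m = k by omega) + comulFst X h := by
  rw [comulSnd_eq, comulFst_eq]
  refine (Category.id_comp _).trans ?_
  rw [comulComponent, shuffleSumAt_succ X (by omega)]
  have : ∀ {A B : D} (p q r : A ⟶ A) (s : A ⟶ B), (p + q ≫ r) ≫ s = p ≫ s + q ≫ r ≫ s := by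
    simp
  exact this _ _ _ _

lemma appendGen_comulComponent_zero_left (k : ℕ) :
    appendGen X k ≫ comulComponent X (zero_add (k + 1)) = comulSnd X (zero_add k) := by
  rw [comulSnd_eq]
  refine (Category.id_comp _).trans ?_
  rw [comulComponent, shuffleSumAt_of_trivial X (Or.inl rfl),
    shuffleSumAt_of_trivial X (Or.inl rfl), addStrand_id]
  rfl

lemma appendGen_comulComponent_zero_right (k : ℕ) :
    appendGen X k ≫ comulComponent X (add_zero (k + 1)) = comulFst X (add_zero k) := by
  rw [comulFst_eq]
  refine (Category.id_comp _).trans ?_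
  rw [comulComponent, shuffleSumAt_of_trivial X (Or.inr le_rfl),
    shuffleSumAt_of_trivial X (Or.inr le_rfl), addStrand_id, signedCycle_of_le X le_rfl,
    Category.id_comp (𝟙 _ ≫ _)]
  rfl

lemma tensorComul_proj' {n m k : ℕ} (h : n + m = k) :
    degMap (tensorComul X) k ≫ proj (tensorAlg X) (tensorAlg X) n m k h = comulComponent X h :=
  tensorComul_proj X n m k h

lemma degMap_comul_mulSnd (n m N : ℕ) (h : n + m = N) :
    degMap (tensorComul X ▷ genObj X ≫ mulSnd (mulGen (genIncl X))) (N + 1) ≫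
        proj (tensorAlg X) (tensorAlg X) n (m + 1) (N + 1) (by omega) =
      proj (tensorAlg X) (genObj X) N 1 (N + 1) rfl ≫ comulSnd X h := by
  rw [degMap_comp, Category.assoc, degMap_mulSnd_proj X n m N h,
    reassoc_of% whiskerRight_proj (A := tensorAlg X) (B := genObj X), ← comp_whiskerRight_assoc,
    tensorComul_proj', comulSnd]

lemma degMap_comul_mulFst (n m N : ℕ) (h : n + m = N) :
    degMap (tensorComul X ▷ genObj X ≫ mulFst (mulGen (genIncl X))) (N + 1) ≫
        proj (tensorAlg X) (tensorAlg X) (n + 1) m (N + 1) (by omega) =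
      proj (tensorAlg X) (genObj X) N 1 (N + 1) rfl ≫ comulFst X h := by
  rw [degMap_comp, Category.assoc, degMap_mulFst_proj X n m N h, Preadditive.comp_zsmul,
    reassoc_of% whiskerRight_proj (A := tensorAlg X) (B := genObj X), ← comp_whiskerRight_assoc,
    tensorComul_proj', comulFst, Preadditive.comp_zsmul]

lemma tensor_mulGen_comul : mulGen (genIncl X) ≫ tensorComul X = tensorComul X ▷ genObj X ≫
    (mulSnd (mulGen (genIncl X)) + mulFst (mulGen (genIncl X))) := by
  refine graded_hom_ext fun k => ?_
  cases k with
  | zero => exact (isZero_tensor_gen_zero X).eq_of_src _ _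
  | succ N =>
    refine hom_tensor_ext fun n m h => ?_
    rw [degMap_comp, Category.assoc, tensorComul_proj', degMap_mulGen, Category.assoc,
      Preadditive.comp_add, degMap_add, Preadditive.add_comp]
    rcases n with _ | a
    · obtain rfl : m = N + 1 := by omega
      rw [degMap_comul_mulSnd X 0 N N (zero_add N), degMap_comp (tensorComul X ▷ genObj X) (mulFst
        _), Category.assoc, degMap_mulFst_proj_zero, comp_zero, add_zero,
        appendGen_comulComponent_zero_left]
    · rcases m with _ | b
      · obtain rfl : N = a := by omega
        rw [degMap_comul_mulFst X N 0 N rfl, degMap_comp (tensorComul X ▷ genObj X) (mulSnd _),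
          Category.assoc, degMap_mulSnd_proj_zero, comp_zero, zero_add,
          appendGen_comulComponent_zero_right]
      · rw [degMap_comul_mulSnd X (a + 1) b N (by omega),
          degMap_comul_mulFst X a (b + 1) N (by omega), ← Preadditive.comp_add,
          appendGen_comulComponent]

lemma antipodeComponent_zero : antipodeComponent X 0 = 𝟙 _ := by
  rw [antipodeComponent, pow_zero, one_smul, Subsingleton.elim Fin.revPerm 1]
  exact signedPermBraid_one X 0

/-- The order-reversing permutation brings the last number to the first place and reverses the
others. -/
lemma antipodeComponent_succ (n : ℕ) : antipodeComponent X (n + 1) =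
    -(((-1 : ℤ) ^ n) • (addStrand X (antipodeComponent X n) ≫ cycleBraid X n 0)) := by
  rw [antipodeComponent, signedPermBraid_revPerm_succ, antipodeComponent, signedCycle,
    addStrand_zsmul, Preadditive.zsmul_comp, Preadditive.comp_zsmul, smul_smul, smul_smul,
    Nat.sub_zero, ← neg_smul]
  congr 1
  ring

/-- The inverse form of `antipodeComponent_succ`: as the order-reversing permutation is its own
inverse, one may also bring the first factor to the last place and then reverse the others. -/
lemma antipodeComponent_succ' (n : ℕ) : antipodeComponent X (n + 1) =
    -(((-1 : ℤ) ^ n) • (cycleBraid' X n 0 ≫ addStrand X (antipodeComponent X n))) := by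
  rw [antipodeComponent, signedPermBraid_revPerm_succ', antipodeComponent, signedCycle',
    addStrand_zsmul, Preadditive.zsmul_comp, Preadditive.comp_zsmul, smul_smul, smul_smul,
    Nat.sub_zero, ← neg_smul]
  congr 1
  ring

lemma tensor_mulGen_antipode : mulGen (genIncl X) ≫ tensorAntipode X =
    -(tensorAntipode X ▷ genObj X ≫ (β_ (tensorAlg X) (genObj X)).hom ≫
      genIncl X ▷ tensorAlg X ≫ μ[tensorAlg X]) := by
  refine tensor_gen_hom_ext fun n => ?_
  have hb := inc_braiding (A := tensorAlg X) (B := genObj X) n 1 (n + 1) rfl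
  rw [mul_one] at hb
  rw [degMap_comp, ← Category.assoc, inc_mulGen, degMap_neg, Preadditive.comp_neg, degMap_comp,
    degMap_comp, degMap_comp, reassoc_of% inc_whiskerRight (A := tensorAlg X) (B := genObj X),
    reassoc_of% hb, Preadditive.zsmul_comp, Category.assoc,
    reassoc_of% inc_whiskerRight (A := genObj X) (B := tensorAlg X), tensorMon_mul,
    inc_tensorMul, Preadditive.comp_zsmul]
  have := antipodeComponent_succ X n
  rw [cycleBraid_zero] at this
  exact (Category.id_comp _).trans this

/-- The Hopf algebra structure of `T(X)`, in terms of its values on the products with a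
generator. -/
def tensorHopfData : TensorHopfData (genIncl X) where
  generates := generates_genIncl X
  counit := tensorCounit X
  comul := tensorComul X
  antipode := tensorAntipode X
  one_counit := unit_hom_ext (unitZero D).inv_hom_id
  mulGen_counit := hom_unit_ext ((isZero_tensor_gen_zero X).eq_of_src _ _)
  one_comul := tensor_one_comul X
  mulGen_comul := tensor_mulGen_comul X
  one_antipode := unit_hom_ext (by
    rw [degMap_comp]
    have : degMap (tensorAntipode X) 0 = 𝟙 (deg (tensorAlg X) 0) := antipodeComponent_zero X
    rw [this, Category.comp_id])
  mulGen_antipode := tensor_mulGen_antipode X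

end TensorHopf

/-! ### Hopf monoids of the opposite category -/

section Opposites

open Opposite

variable {C : Type u} [Category.{v} C] [MonoidalCategory C]

instance [Preadditive C] [MonoidalPreadditive C] : MonoidalPreadditive Cᵒᵖ where
  whiskerLeft_zero := Quiver.Hom.unop_inj MonoidalPreadditive.whiskerLeft_zero
  zero_whiskerRight := Quiver.Hom.unop_inj MonoidalPreadditive.zero_whiskerRight
  whiskerLeft_add _ _ := Quiver.Hom.unop_inj (MonoidalPreadditive.whiskerLeft_add _ _)
  add_whiskerRight _ _ := Quiver.Hom.unop_inj (MonoidalPreadditive.add_whiskerRight _ _)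

/-- A comonoid object is a monoid object of the opposite category. -/
abbrev monObjOp (M : C) [ComonObj M] : MonObj (op M) := Comon.ComonToMonOpOpObjMon ⟨M⟩

/-- A Hopf monoid of the opposite category is a Hopf monoid, with product and coproduct
exchanged. -/
abbrev hopfObjOfOp [BraidedCategory C] (M : C) [h : HopfObj (op M)] : HopfObj M where
  one := ε[op M].unop
  mul := Δ[op M].unop
  counit := η[op M].unop
  comul := μ[op M].unop
  antipode := h.antipode.unop
  one_mul := congrArg Quiver.Hom.unop (ComonObj.counit_comul (op M))
  mul_one := congrArg Quiver.Hom.unop (ComonObj.comul_counit (op M))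
  mul_assoc := by
    have := congrArg Quiver.Hom.unop (ComonObj.comul_assoc (op M))
    exact ((Iso.inv_comp_eq _).1 ((Category.assoc _ _ _).symm.trans this.symm))
  counit_comul := congrArg Quiver.Hom.unop (MonObj.one_mul (op M))
  comul_counit := congrArg Quiver.Hom.unop (MonObj.mul_one (op M))
  comul_assoc := by
    have := congrArg Quiver.Hom.unop (MonObj.mul_assoc_flip (op M))
    exact this.trans (Category.assoc _ _ _)
  mul_comul := by
    have := congrArg Quiver.Hom.unop (BimonObj.mul_comul (op M))
    simp only [unop_comp, BraidedCategory.unop_tensorμ, unop_tensorHom, Category.assoc] at this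
    exact this
  one_comul := congrArg Quiver.Hom.unop (BimonObj.mul_counit (op M))
  mul_counit := congrArg Quiver.Hom.unop (BimonObj.one_comul (op M))
  one_counit := congrArg Quiver.Hom.unop (BimonObj.one_counit (op M))
  antipode_left := (Category.assoc _ _ _).symm.trans
    (congrArg Quiver.Hom.unop (HopfObj.antipode_left (op M)))
  antipode_right := (Category.assoc _ _ _).symm.trans
    (congrArg Quiver.Hom.unop (HopfObj.antipode_right (op M)))

end Opposites

/-! ### The coalgebra `T°(X)` and its cogenerators -/

section ShuffleHopf

open Opposite

variable {D : Type u} [Category.{v} D] [Abelian D] [MonoidalCategory D] [MonoidalPreadditive D]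
variable (X : D)

lemma degMap_shuffleCounit : degMap (shuffleCounit X) 0 = (unitZero D).hom := rfl

/-- The component `X^{⊗ k} ⟶ X^{⊗ n} ⊗ X^{⊗ m}` of the coproduct of `T°(X)`. -/
def splitComponent {n m k : ℕ} (h : n + m = k) :
    deg (shuffleAlg X) k ⟶ deg (shuffleAlg X) n ⊗ deg (shuffleAlg X) m :=
  (concat X h).inv

lemma shuffleComul_proj' {n m k : ℕ} (h : n + m = k) :
    degMap (shuffleComul X) k ≫ proj (shuffleAlg X) (shuffleAlg X) n m k h = splitComponent X h :=
  shuffleComul_proj X n m k h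

lemma shuffle_counit_comul :
    shuffleComul X ≫ shuffleCounit X ▷ shuffleAlg X = (λ_ (shuffleAlg X)).inv := by
  refine graded_hom_ext fun k => hom_tensor_ext fun n m h => ?_
  by_cases hn : n = 0
  · subst hn
    obtain rfl : m = k := by omega
    rw [degMap_comp, Category.assoc, whiskerRight_proj, degMap_leftUnitor_inv,
      ← Category.assoc (degMap (shuffleComul X) m), shuffleComul_proj', Category.assoc,
      Category.assoc, inc_proj_self, Category.comp_id, splitComponent, zero_concat]
    rfl
  · exact (isZero_tensor_right _ (isZero_deg_unit hn)).eq_of_tgt _ _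

lemma shuffle_comul_counit :
    shuffleComul X ≫ shuffleAlg X ◁ shuffleCounit X = (ρ_ (shuffleAlg X)).inv := by
  refine graded_hom_ext fun k => hom_tensor_ext fun n m h => ?_
  by_cases hm : m = 0
  · subst hm
    obtain rfl : n = k := by omega
    rw [degMap_comp, Category.assoc, whiskerLeft_proj, degMap_rightUnitor_inv,
      ← Category.assoc (degMap (shuffleComul X) n), shuffleComul_proj', Category.assoc,
      Category.assoc, inc_proj_self, Category.comp_id, splitComponent, concat_zero]
    rfl
  · exact (isZero_tensor_left _ (isZero_deg_unit hm)).eq_of_tgt _ _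

lemma shuffle_comul_assoc : shuffleComul X ≫ shuffleAlg X ◁ shuffleComul X =
    shuffleComul X ≫ shuffleComul X ▷ shuffleAlg X ≫ (α_ _ _ _).hom := by
  refine graded_hom_ext fun k => hom_tensor₃_ext fun a b c bc h₃ h₄ => ?_
  have h₂ : a + b + c = k := by omega
  rw [degMap_comp, degMap_comp, degMap_comp, Category.assoc, Category.assoc, Category.assoc,
    associator_hom_proj rfl h₂ h₃ h₄, reassoc_of% whiskerLeft_proj (A := shuffleAlg X),
    reassoc_of% whiskerRight_proj (B := shuffleAlg X), ← MonoidalCategory.whiskerLeft_comp,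
    ← comp_whiskerRight_assoc, shuffleComul_proj', shuffleComul_proj',
    ← Category.assoc (degMap (shuffleComul X) k), ← Category.assoc (degMap (shuffleComul X) k),
    shuffleComul_proj', shuffleComul_proj']
  exact (concat_assoc_inv X rfl h₂ h₃ h₄).symm

/-- The coalgebra structure of `T°(X)`. -/
abbrev shuffleComon : ComonObj (shuffleAlg X) where
  counit := shuffleCounit X
  comul := shuffleComul X
  counit_comul := shuffle_counit_comul X
  comul_counit := shuffle_comul_counit X
  comul_assoc := shuffle_comul_assoc X

/-- `T°(X)` as a monoid object of the opposite category. -/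
instance shuffleMonOp : MonObj (op (shuffleAlg X)) :=
  letI := shuffleComon X
  monObjOp (shuffleAlg X)

/-- The projection of `T°(X)` to `X`, in degree `1`. -/
def genProj : shuffleAlg X ⟶ genObj X := toGen (λ_ X).hom

/-- The deconcatenation of the last factor. -/
def splitGen : shuffleAlg X ⟶ shuffleAlg X ⊗ genObj X :=
  shuffleComul X ≫ shuffleAlg X ◁ genProj X

/-- The identification of `X^{⊗ (n + 1)}` with `X^{⊗ n} ⊗ X`. -/
def detachGen (n : ℕ) :
    deg (shuffleAlg X) (n + 1) ⟶ deg (shuffleAlg X) n ⊗ deg (genObj X) 1 :=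
  𝟙 (tpow X n ⊗ X)

lemma splitGen_proj (n : ℕ) : degMap (splitGen X) (n + 1) ≫
    proj (shuffleAlg X) (genObj X) n 1 (n + 1) rfl = detachGen X n := by
  rw [splitGen, degMap_comp, Category.assoc, whiskerLeft_proj, ← Category.assoc,
    shuffleComul_proj']
  have h := congrArg Iso.inv (concat_succ X (add_zero n))
  have e : splitComponent X (rfl : n + 1 = n + 1) =
      ((ρ_ (tpow X n)).inv ▷ X ≫ (α_ (tpow X n) (𝟙_ D) X).hom :) := by
    refine h.trans ?_
    rw [concat_zero]
    rfl
  rw [e]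
  have : ((ρ_ (tpow X n)).inv ▷ X ≫ (α_ (tpow X n) (𝟙_ D) X).hom) ≫ tpow X n ◁ (λ_ X).hom =
      𝟙 _ := by monoidal
  exact this

lemma degMap_splitGen (n : ℕ) : degMap (splitGen X) (n + 1) =
    detachGen X n ≫ inc (shuffleAlg X) (genObj X) n 1 (n + 1) rfl := by
  rw [← splitGen_proj, Category.assoc, proj_inc_gen, Category.comp_id]

lemma degMap_splitGen_zero : degMap (splitGen X) 0 = 0 :=
  (isZero_tensor_gen_zero X).eq_of_tgt _ _

/-- In degree `n` the `n`-fold comonomial, the iterated coproduct followed by projections to `X`, is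
a split monomorphism. -/
lemma exists_comonomial_retraction (n : ℕ) : ∃ (P : (NGraded D)ᵒᵖ) (q : P ⟶ op (shuffleAlg X)),
    Monomial (genProj X).op q ∧
      ∃ r : deg P.unop n ⟶ deg (shuffleAlg X) n, degMap q.unop n ≫ r = 𝟙 _ := by
  induction n with
  | zero => exact ⟨_, _, Monomial.one, (unitZero D).inv, (unitZero D).hom_inv_id⟩
  | succ n ih =>
    obtain ⟨P, q, hq, r, hr⟩ := ih
    refine ⟨_, _, hq.mul, proj P.unop (genObj X) n 1 (n + 1) rfl ≫ r ▷ deg (genObj X) 1, ?_⟩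
    have e : ((q ⊗ₘ (genProj X).op) ≫ μ[op (shuffleAlg X)]).unop =
        splitGen X ≫ q.unop ▷ genObj X := by
      rw [splitGen, Category.assoc, ← MonoidalCategory.tensorHom_def']
      rfl
    have e' : degMap (splitGen X ≫ q.unop ▷ genObj X) (n + 1) ≫
        proj P.unop (genObj X) n 1 (n + 1) rfl ≫ r ▷ deg (genObj X) 1 = detachGen X n := by
      rw [degMap_comp, Category.assoc, reassoc_of% whiskerRight_proj (B := genObj X),
        ← comp_whiskerRight, hr, id_whiskerRight, Category.comp_id]
      exact splitGen_proj X n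
    rw [e]
    exact e'

lemma generates_genProj_op : Generates (genProj X).op := by
  intro W B f g h
  refine Quiver.Hom.unop_inj (graded_hom_ext fun k => hom_tensor_ext fun n m hk => ?_)
  obtain ⟨P, q, hq, r, hr⟩ := exists_comonomial_retraction X m
  have key : ∀ f : W ⊗ op (shuffleAlg X) ⟶ B,
      degMap f.unop k ≫ proj W.unop (shuffleAlg X) n m k hk =
      degMap (W ◁ q ≫ f).unop k ≫ proj W.unop P.unop n m k hk ≫ deg W.unop n ◁ r := by
    intro f
    rw [unop_comp, unop_whiskerLeft, degMap_comp, Category.assoc,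
      reassoc_of% whiskerLeft_proj (A := W.unop), ← MonoidalCategory.whiskerLeft_comp, hr,
      MonoidalCategory.whiskerLeft_id, Category.comp_id]
  exact (key f).trans ((congrArg (fun t => degMap t.unop k ≫ _) (h q hq)).trans (key g).symm)

end ShuffleHopf

/-! ### The Hopf algebra `T°(X)` -/

section ShuffleHopf

open Opposite

lemma cycleBraid'_zero {D : Type u} [Category.{v} D] [MonoidalCategory D] [BraidedCategory D]
    (X : D) (N : ℕ) : cycleBraid' X N 0 =
    (concat X (add_comm 1 N)).inv ≫ (λ_ X).hom ▷ tpow X N ≫ (β_ X (tpow X N)).hom := by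
  have h := braiding_concat X (zero_add N)
  rw [zero_concat] at h
  rw [← (Iso.inv_comp_eq _).2 h]
  have : ∀ {A B : D} (f : B ⟶ (𝟙_ D ⊗ X) ⊗ A), f ≫ (λ_ X).hom ▷ A ≫ (β_ X A).hom =
      f ≫ (α_ (𝟙_ D) X A).hom ≫ 𝟙_ D ◁ (β_ X A).hom ≫ (α_ (𝟙_ D) A X).inv ≫
        (λ_ A).hom ▷ X := by
    intro A B f
    simp
  exact (this _).symm

variable {D : Type u} [Category.{v} D] [Abelian D] [MonoidalCategory D] [MonoidalPreadditive D]
variable [BraidedCategory D] (X : D)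

lemma concat_hom_whiskerRight {n m N : ℕ} (h : n + m = N) (f : tpow X N ⟶ tpow X N) :
    (α_ (tpow X n) (tpow X m) X).inv ≫ ((concat X h).hom ≫ f) ▷ X =
      (concat X (show n + (m + 1) = N + 1 by omega)).hom ≫ addStrand X f := by
  rw [concat_succ_hom X h]
  have : (α_ (tpow X n) (tpow X m) X).inv ≫ ((concat X h).hom ≫ f) ▷ X =
    ((α_ (tpow X n) (tpow X m) X).inv ≫ (concat X h).hom ▷ X) ≫ f ▷ X := by simp
  exact this

lemma braiding_concat_hom_whiskerRight {n m N : ℕ} (h : n + m = N) (f : tpow X N ⟶ tpow X N) :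
    ((-1 : ℤ) ^ m) • ((α_ (tpow X n) X (tpow X m)).hom ≫ tpow X n ◁ (β_ X (tpow X m)).hom ≫
      (α_ (tpow X n) (tpow X m) X).inv ≫ ((concat X h).hom ≫ f) ▷ X) =
      (concat X (show n + 1 + m = N + 1 by omega)).hom ≫ signedCycle' X N n ≫ addStrand X f := by
  obtain rfl : m = N - n := by omega
  rw [signedCycle', Preadditive.zsmul_comp, Preadditive.comp_zsmul, ← Category.assoc (concat X
    _).hom, ← braiding_concat X h, comp_whiskerRight]
  have : ∀ {A B C E F G : D} (p : A ⟶ B) (q : B ⟶ C) (r : C ⟶ E) (s : E ⟶ F) (t : F ⟶ G),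
    ((-1 : ℤ) ^ (N - n)) • (p ≫ q ≫ r ≫ s ≫ t) =
      ((-1 : ℤ) ^ (N - n)) • ((p ≫ q ≫ r ≫ s) ≫ t) := by simp
  exact this _ _ _ _ _

/-- The component `X^{⊗ n} ⊗ X^{⊗ m} ⟶ X^{⊗ k}` of the product of `T°(X)`. -/
def mulComponent {n m k : ℕ} (h : n + m = k) :
    deg (shuffleAlg X) n ⊗ deg (shuffleAlg X) m ⟶ deg (shuffleAlg X) k :=
  (concat X h).hom ≫ inverseShuffleSumAt X k n

/-- The part of a shuffle product which ends with the last factor of the second argument. -/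
def mulSndComponent {n m k : ℕ} (h : n + m = k) :
    deg (shuffleAlg X) n ⊗ deg (shuffleAlg X) (m + 1) ⟶ deg (shuffleAlg X) k ⊗ deg (genObj X) 1 :=
  deg (shuffleAlg X) n ◁ detachGen X m ≫ (α_ _ _ _).inv ≫ mulComponent X h ▷ deg (genObj X) 1

/-- The part of a shuffle product which ends with the last factor of the first argument. -/
def mulFstComponent {n m k : ℕ} (h : n + m = k) :
    deg (shuffleAlg X) (n + 1) ⊗ deg (shuffleAlg X) m ⟶ deg (shuffleAlg X) k ⊗ deg (genObj X) 1 :=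
  ((-1 : ℤ) ^ m) • (detachGen X n ▷ deg (shuffleAlg X) m ≫ (α_ _ _ _).hom ≫
    deg (shuffleAlg X) n ◁ (β_ (deg (genObj X) 1) (deg (shuffleAlg X) m)).hom ≫
      (α_ _ _ _).inv ≫ mulComponent X h ▷ deg (genObj X) 1)

lemma mulSndComponent_eq {n m k : ℕ} (h : n + m = k) : mulSndComponent X h =
    ((concat X (show n + (m + 1) = k + 1 by omega)).hom ≫
      addStrand X (inverseShuffleSumAt X k n) :) := by
  rw [← concat_hom_whiskerRight X h]
  have : ∀ {A B C E : D} (q : C ⊗ E ⟶ A) (p : A ⟶ B), C ◁ 𝟙 E ≫ q ≫ p = q ≫ p := by simp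
  exact this _ _

lemma mulFstComponent_eq {n m k : ℕ} (h : n + m = k) : mulFstComponent X h =
    ((concat X (show n + 1 + m = k + 1 by omega)).hom ≫ signedCycle' X k n ≫
      addStrand X (inverseShuffleSumAt X k n) :) := by
  rw [← braiding_concat_hom_whiskerRight X h]
  have : ∀ {E F A : D} (p : E ⊗ F ⟶ A),
      ((-1 : ℤ) ^ m) • (𝟙 E ▷ F ≫ p) = ((-1 : ℤ) ^ m) • p := by simp
  exact this _

lemma mulComponent_detachGen {n m k : ℕ} (h : n + (m + 1) = k) :
    mulComponent X (show n + 1 + (m + 1) = k + 1 by omega) ≫ detachGen X k =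
      mulSndComponent X (show n + 1 + m = k by omega) + mulFstComponent X h := by
  rw [mulSndComponent_eq, mulFstComponent_eq]
  refine (Category.comp_id _).trans ?_
  rw [mulComponent, inverseShuffleSumAt_succ X (by omega)]
  have : ∀ {A B : D} (p q r : A ⟶ A) (s : B ⟶ A), s ≫ (p + q ≫ r) = s ≫ p + s ≫ q ≫ r := by
    simp
  exact this _ _ _ _

lemma mulComponent_detachGen_zero_left (k : ℕ) :
    mulComponent X (zero_add (k + 1)) ≫ detachGen X k = mulSndComponent X (zero_add k) := by
  rw [mulSndComponent_eq]
  refine (Category.comp_id _).trans ?_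
  rw [mulComponent, inverseShuffleSumAt_of_trivial X (Or.inl rfl),
    inverseShuffleSumAt_of_trivial X (Or.inl rfl), addStrand_id]
  rfl

lemma mulComponent_detachGen_zero_right (k : ℕ) :
    mulComponent X (add_zero (k + 1)) ≫ detachGen X k = mulFstComponent X (add_zero k) := by
  rw [mulFstComponent_eq]
  refine (Category.comp_id _).trans ?_
  rw [mulComponent, inverseShuffleSumAt_of_trivial X (Or.inr le_rfl),
    inverseShuffleSumAt_of_trivial X (Or.inr le_rfl), addStrand_id, signedCycle'_of_le X le_rfl,
    Category.id_comp (𝟙 _)]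
  rfl

lemma inc_shuffleMul' {n m k : ℕ} (h : n + m = k) :
    inc (shuffleAlg X) (shuffleAlg X) n m k h ≫ degMap (shuffleMul X) k = mulComponent X h :=
  inc_shuffleMul X n m k h

/-- `a ⊗ bx ↦ (a ⊗ b) ⊗ x`. -/
def splitSnd : shuffleAlg X ⊗ shuffleAlg X ⟶ (shuffleAlg X ⊗ shuffleAlg X) ⊗ genObj X :=
  shuffleAlg X ◁ splitGen X ≫ (α_ _ _ _).inv

/-- `ax ⊗ b ↦ a ⊗ Ψ(x ⊗ b)`. -/
def splitFst : shuffleAlg X ⊗ shuffleAlg X ⟶ (shuffleAlg X ⊗ shuffleAlg X) ⊗ genObj X :=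
  splitGen X ▷ shuffleAlg X ≫ (α_ _ _ _).hom ≫
    shuffleAlg X ◁ (β_ (genObj X) (shuffleAlg X)).hom ≫ (α_ _ _ _).inv

lemma inc_splitSnd_mul {n m k : ℕ} (h : n + m = k) :
    inc (shuffleAlg X) (shuffleAlg X) n (m + 1) (k + 1) (by omega) ≫
        degMap (splitSnd X ≫ shuffleMul X ▷ genObj X) (k + 1) =
      mulSndComponent X h ≫ inc (shuffleAlg X) (genObj X) k 1 (k + 1) rfl := by
  rw [splitSnd, Category.assoc, degMap_comp, degMap_comp,
    reassoc_of% inc_whiskerLeft (A := shuffleAlg X), degMap_splitGen,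
    MonoidalCategory.whiskerLeft_comp, Category.assoc,
    reassoc_of% inc_associator_inv (A := shuffleAlg X) (B := shuffleAlg X) (C := genObj X) h
      (rfl : k + 1 = k + 1) rfl (by omega), inc_whiskerRight, ← comp_whiskerRight_assoc,
    inc_shuffleMul', mulSndComponent, Category.assoc, Category.assoc]

lemma inc_splitSnd_zero (k : ℕ) : inc (shuffleAlg X) (shuffleAlg X) k 0 k (add_zero k) ≫
    degMap (splitSnd X) k = 0 := by
  rw [splitSnd, degMap_comp, reassoc_of% inc_whiskerLeft (A := shuffleAlg X),
    degMap_splitGen_zero, MonoidalPreadditive.whiskerLeft_zero, zero_comp]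

lemma inc_splitFst_mul {n m k : ℕ} (h : n + m = k) :
    inc (shuffleAlg X) (shuffleAlg X) (n + 1) m (k + 1) (by omega) ≫
        degMap (splitFst X ≫ shuffleMul X ▷ genObj X) (k + 1) =
      mulFstComponent X h ≫ inc (shuffleAlg X) (genObj X) k 1 (k + 1) rfl := by
  have hb := inc_braiding (A := genObj X) (B := shuffleAlg X) 1 m (m + 1) (add_comm 1 m)
  rw [one_mul] at hb
  rw [splitFst, Category.assoc, Category.assoc, Category.assoc, degMap_comp, degMap_comp,
    degMap_comp, degMap_comp,
    reassoc_of% inc_whiskerRight (B := shuffleAlg X), degMap_splitGen,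
    comp_whiskerRight, Category.assoc,
    reassoc_of% inc_associator_hom (A := shuffleAlg X) (B := genObj X) (C := shuffleAlg X)
      (rfl : n + 1 = n + 1) (show n + 1 + m = k + 1 by omega) (add_comm 1 m) (by omega),
    reassoc_of% inc_whiskerLeft (A := shuffleAlg X), ← MonoidalCategory.whiskerLeft_comp_assoc,
    hb, whiskerLeft_zsmul, Preadditive.zsmul_comp, MonoidalCategory.whiskerLeft_comp,
    Category.assoc,
    reassoc_of% inc_associator_inv (A := shuffleAlg X) (B := shuffleAlg X) (C := genObj X) h
      (rfl : k + 1 = k + 1) rfl (by omega), inc_whiskerRight, ← comp_whiskerRight_assoc,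
    inc_shuffleMul', mulFstComponent, Preadditive.comp_zsmul, Preadditive.comp_zsmul,
    Preadditive.zsmul_comp]
  simp only [Category.assoc]

lemma inc_splitFst_zero (k : ℕ) : inc (shuffleAlg X) (shuffleAlg X) 0 k k (zero_add k) ≫
    degMap (splitFst X) k = 0 := by
  rw [splitFst, degMap_comp, reassoc_of% inc_whiskerRight (B := shuffleAlg X),
    degMap_splitGen_zero, MonoidalPreadditive.zero_whiskerRight, zero_comp]

/-- The Pascal rule for the shuffle product: the last factor of a shuffle product is the last factor
of one of the two arguments. -/
lemma shuffle_mul_splitGen : shuffleMul X ≫ splitGen X =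
    (splitSnd X + splitFst X) ≫ shuffleMul X ▷ genObj X := by
  refine graded_hom_ext fun k => ?_
  cases k with
  | zero => exact (isZero_tensor_gen_zero X).eq_of_tgt _ _
  | succ N =>
    refine tensor_hom_ext fun n m h => ?_
    rw [Preadditive.add_comp, degMap_add, Preadditive.comp_add, degMap_comp, ← Category.assoc,
      inc_shuffleMul', degMap_splitGen, ← Category.assoc]
    rcases n with _ | a
    · obtain rfl : m = N + 1 := by omega
      rw [inc_splitSnd_mul X (zero_add N), degMap_comp (splitFst X),
        reassoc_of% inc_splitFst_zero, zero_comp, add_zero, mulComponent_detachGen_zero_left]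
    · rcases m with _ | b
      · obtain rfl : N = a := by omega
        rw [inc_splitFst_mul X (add_zero N), degMap_comp (splitSnd X),
          reassoc_of% inc_splitSnd_zero, zero_comp, zero_add, mulComponent_detachGen_zero_right]
      · rw [inc_splitSnd_mul X (show a + 1 + b = N by omega),
          inc_splitFst_mul X (show a + (b + 1) = N by omega), ← Preadditive.add_comp,
          mulComponent_detachGen]

lemma shuffle_one_splitGen : shuffleOne X ≫ splitGen X = 0 :=
  unit_hom_ext (by rw [degMap_comp, degMap_splitGen_zero, comp_zero, degMap_zero])

lemma shuffle_mul_counit : shuffleMul X ≫ shuffleCounit X =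
    (shuffleCounit X ⊗ₘ shuffleCounit X) ≫ (λ_ (𝟙_ (NGraded D))).hom := by
  refine hom_unit_ext (tensor_hom_ext fun n m h => ?_)
  obtain rfl : n = 0 := by omega
  obtain rfl : m = 0 := by omega
  rw [degMap_comp, ← Category.assoc, inc_shuffleMul, degMap_comp, ← Category.assoc,
    inc_tensorHom, Category.assoc, inc_leftUnitor_hom,
    inverseShuffleSumAt_of_trivial X (Or.inl rfl), concat_zero, degMap_shuffleCounit]
  have : ((ρ_ (𝟙_ D)).hom ≫ 𝟙 _) ≫ (unitZero D).hom =
      ((unitZero D).hom ⊗ₘ (unitZero D).hom) ≫ (unitZero D).inv ▷ deg (𝟙_ (NGraded D)) 0 ≫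
        (λ_ (deg (𝟙_ (NGraded D)) 0)).hom := by
    rw [MonoidalCategory.tensorHom_def', Category.assoc (_ ◁ _), ← comp_whiskerRight_assoc,
      Iso.hom_inv_id, id_whiskerRight, Category.id_comp, Category.comp_id, leftUnitor_naturality,
      unitors_equal]
  exact this

lemma shuffle_antipode_splitGen : shuffleAntipode X ≫ splitGen X =
    -(shuffleComul X ≫ genProj X ▷ shuffleAlg X ≫ (β_ (genObj X) (shuffleAlg X)).hom ≫
      shuffleAntipode X ▷ genObj X) := by
  refine hom_tensor_gen_ext fun n => ?_
  have hb := braiding_proj (A := genObj X) (B := shuffleAlg X) 1 n (n + 1) (add_comm 1 n)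
  rw [one_mul] at hb
  rw [degMap_comp, Category.assoc, splitGen_proj, degMap_neg, Preadditive.neg_comp, degMap_comp,
    degMap_comp, degMap_comp, Category.assoc, Category.assoc, Category.assoc, whiskerRight_proj,
    reassoc_of% hb, Preadditive.zsmul_comp, Category.assoc, Preadditive.comp_zsmul,
    reassoc_of% whiskerRight_proj (B := shuffleAlg X), Preadditive.comp_zsmul,
    ← Category.assoc (degMap (shuffleComul X) _), shuffleComul_proj']
  have := antipodeComponent_succ' X n
  rw [cycleBraid'_zero] at this
  have e : ∀ {A B C E F : D} (p : A ⟶ B) (q : B ⟶ C) (r : C ⟶ E) (s : E ⟶ F),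
      -(((-1 : ℤ) ^ n) • ((p ≫ q ≫ r) ≫ s)) = -(((-1 : ℤ) ^ n) • (p ≫ q ≫ r ≫ s)) := by simp
  exact (Category.comp_id _).trans (this.trans (e _ _ _ _))

/-- The Hopf algebra structure of `T°(X)`, as a structure on the opposite of `T°(X)` which is
determined by its values on the products with a generator. -/
def shuffleHopfData : TensorHopfData (genProj X).op where
  generates := generates_genProj_op X
  counit := (shuffleOne X).op
  comul := (shuffleMul X).op
  antipode := (shuffleAntipode X).op
  one_counit := congrArg Quiver.Hom.op (unit_hom_ext (unitZero D).inv_hom_id :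
    shuffleOne X ≫ shuffleCounit X = 𝟙 _)
  mulGen_counit := congrArg Quiver.Hom.op (shuffle_one_splitGen X)
  one_comul := congrArg Quiver.Hom.op (shuffle_mul_counit X)
  mulGen_comul := by
    refine (congrArg Quiver.Hom.op (shuffle_mul_splitGen X)).trans ?_
    have h : ((mulSnd (mulGen (genProj X).op) + mulFst (mulGen (genProj X).op)).unop) =
        splitSnd X + splitFst X := by
      rw [unop_add, splitSnd, splitFst]
      congr 1
      simp only [mulFst, unop_comp, Category.assoc]
      rfl
    rw [← h]
    rfl
  one_antipode := congrArg Quiver.Hom.op (hom_unit_ext (by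
    rw [degMap_comp]
    have : degMap (shuffleAntipode X) 0 = 𝟙 (deg (shuffleAlg X) 0) := antipodeComponent_zero X
    rw [this, Category.id_comp]) : shuffleAntipode X ≫ shuffleCounit X = shuffleCounit X)
  mulGen_antipode := by
    refine (congrArg Quiver.Hom.op (shuffle_antipode_splitGen X)).trans ?_
    refine Quiver.Hom.unop_inj ?_
    simp only [unop_neg, unop_comp, Category.assoc]
    rfl

end ShuffleHopf

/-! ### Hopf monoid structures on images -/

section Image

variable {C : Type u} [Category.{v} C] [MonoidalCategory C]

/-- A subobject of a monoid object which is closed under the unit and the product is a monoid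
object. -/
abbrev monObjOfMono {E M : C} [MonObj M] (j : E ⟶ M) [Mono j] (one : 𝟙_ C ⟶ E) (mul : E ⊗ E ⟶ E)
    (h1 : one ≫ j = η[M]) (hm : mul ≫ j = (j ⊗ₘ j) ≫ μ[M]) : MonObj E where
  one := one
  mul := mul
  one_mul := by
    have e : one ▷ E ≫ (j ⊗ₘ j) = 𝟙_ C ◁ j ≫ η[M] ▷ M := by
      rw [MonoidalCategory.tensorHom_def, ← comp_whiskerRight_assoc, h1, whisker_exchange]
    rw [← cancel_mono j, Category.assoc, hm, reassoc_of% e, MonObj.one_mul, leftUnitor_naturality]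
  mul_one := by
    have e : E ◁ one ≫ (j ⊗ₘ j) = j ▷ 𝟙_ C ≫ M ◁ η[M] := by
      rw [MonoidalCategory.tensorHom_def', ← MonoidalCategory.whiskerLeft_comp_assoc, h1,
        whisker_exchange]
    rw [← cancel_mono j, Category.assoc, hm, reassoc_of% e, MonObj.mul_one, rightUnitor_naturality]
  mul_assoc := by
    have e1 : mul ▷ E ≫ (j ⊗ₘ j) = ((j ⊗ₘ j) ⊗ₘ j) ≫ μ[M] ▷ M := by
      rw [← tensorHom_id, ← tensorHom_id, tensorHom_comp_tensorHom, tensorHom_comp_tensorHom, hm,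
        Category.id_comp, Category.comp_id]
    have e2 : E ◁ mul ≫ (j ⊗ₘ j) = (j ⊗ₘ (j ⊗ₘ j)) ≫ M ◁ μ[M] := by
      rw [← id_tensorHom, ← id_tensorHom, tensorHom_comp_tensorHom, tensorHom_comp_tensorHom, hm,
        Category.id_comp, Category.comp_id]
    rw [← cancel_mono j]
    simp only [Category.assoc, hm, reassoc_of% e1, reassoc_of% e2, MonObj.mul_assoc,
      associator_naturality_assoc]

/-- A quotient object of a comonoid object to which the counit and the coproduct descend is a
comonoid object. -/
abbrev comonObjOfEpi {E M : C} [ComonObj M] (p : M ⟶ E) [Epi p] (counit : E ⟶ 𝟙_ C)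
    (comul : E ⟶ E ⊗ E) (h1 : p ≫ counit = ε[M]) (hm : p ≫ comul = Δ[M] ≫ (p ⊗ₘ p)) :
    ComonObj E where
  counit := counit
  comul := comul
  counit_comul := by
    have e : (p ⊗ₘ p) ≫ counit ▷ E = ε[M] ▷ M ≫ 𝟙_ C ◁ p := by
      rw [MonoidalCategory.tensorHom_def', Category.assoc, ← comp_whiskerRight, h1,
        whisker_exchange]
    rw [← cancel_epi p, reassoc_of% hm, e, ComonObj.counit_comul_assoc, leftUnitor_inv_naturality]
  comul_counit := by
    have e : (p ⊗ₘ p) ≫ E ◁ counit = M ◁ ε[M] ≫ p ▷ 𝟙_ C := by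
      rw [MonoidalCategory.tensorHom_def, Category.assoc, ← MonoidalCategory.whiskerLeft_comp, h1,
        whisker_exchange]
    rw [← cancel_epi p, reassoc_of% hm, e, ComonObj.comul_counit_assoc, rightUnitor_inv_naturality]
  comul_assoc := by
    have e1 : (p ⊗ₘ p) ≫ comul ▷ E = Δ[M] ▷ M ≫ ((p ⊗ₘ p) ⊗ₘ p) := by
      rw [← tensorHom_id, ← tensorHom_id, tensorHom_comp_tensorHom, tensorHom_comp_tensorHom, hm,
        Category.id_comp, Category.comp_id]
    have e2 : (p ⊗ₘ p) ≫ E ◁ comul = M ◁ Δ[M] ≫ (p ⊗ₘ (p ⊗ₘ p)) := by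
      rw [← id_tensorHom, ← id_tensorHom, tensorHom_comp_tensorHom, tensorHom_comp_tensorHom, hm,
        Category.id_comp, Category.comp_id]
    rw [← cancel_epi p, reassoc_of% hm, reassoc_of% hm, e2, reassoc_of% e1,
      ComonObj.comul_assoc_assoc, associator_naturality]

variable [BraidedCategory C]

/-- Structure morphisms on an object `E` through which a morphism of Hopf monoids `T ⟶ S` factors
as an epimorphism `p` followed by a monomorphism `j`; they are compatible with those of `T`,
and the unit and the product are compatible with those of `S`. -/
structure HopfFactorization {T E S : C} [HopfObj T] [MonObj S] (p : T ⟶ E) (j : E ⟶ S) where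
  one : 𝟙_ C ⟶ E
  mul : E ⊗ E ⟶ E
  counit : E ⟶ 𝟙_ C
  comul : E ⟶ E ⊗ E
  antipode : E ⟶ E
  one_eq : η[T] ≫ p = one
  mul_eq : μ[T] ≫ p = (p ⊗ₘ p) ≫ mul
  counit_eq : p ≫ counit = ε[T]
  comul_eq : p ≫ comul = Δ[T] ≫ (p ⊗ₘ p)
  antipode_eq : p ≫ antipode = HopfObj.antipode ≫ p
  one_incl : one ≫ j = η[S]
  mul_incl : mul ≫ j = (j ⊗ₘ j) ≫ μ[S]

namespace HopfFactorization

variable {T E S : C} [HopfObj T] [MonObj S] {p : T ⟶ E} {j : E ⟶ S} [Epi p] [Epi (p ⊗ₘ p)]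
  [Mono j] (d : HopfFactorization p j)

/-- The bimonoid structure of the middle object of a factorization. -/
abbrev toBimonObj : BimonObj E where
  toMonObj := monObjOfMono j d.one d.mul d.one_incl d.mul_incl
  toComonObj := comonObjOfEpi p d.counit d.comul d.counit_eq d.comul_eq
  mul_comul := by
    change d.mul ≫ d.comul = (d.comul ⊗ₘ d.comul) ≫ tensorμ E E E E ≫ (d.mul ⊗ₘ d.mul)
    rw [← cancel_epi (p ⊗ₘ p), ← reassoc_of% d.mul_eq, d.comul_eq, BimonObj.mul_comul_assoc,
      tensorHom_comp_tensorHom_assoc, d.comul_eq, tensorHom_comp_tensorHom, d.mul_eq,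
      ← tensorHom_comp_tensorHom_assoc, tensorμ_natural_assoc, tensorHom_comp_tensorHom]
  one_comul := by
    change d.one ≫ d.comul = (λ_ _).inv ≫ (d.one ⊗ₘ d.one)
    rw [← d.one_eq, Category.assoc, d.comul_eq, BimonObj.one_comul_assoc, MonObj.tensorObj.one_def,
      Category.assoc, tensorHom_comp_tensorHom]
  mul_counit := by
    change d.mul ≫ d.counit = (d.counit ⊗ₘ d.counit) ≫ (λ_ _).hom
    rw [← cancel_epi (p ⊗ₘ p), ← reassoc_of% d.mul_eq, d.counit_eq, BimonObj.mul_counit,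
      tensorHom_comp_tensorHom_assoc, d.counit_eq, Comon.tensorObj_counit]
  one_counit := by
    change d.one ≫ d.counit = 𝟙 _
    rw [← d.one_eq, Category.assoc, d.counit_eq, BimonObj.one_counit]

/-- The Hopf monoid structure of the middle object of a factorization. -/
abbrev toHopfObj : HopfObj E where
  toBimonObj := d.toBimonObj
  antipode := d.antipode
  antipode_left := by
    change d.comul ≫ d.antipode ▷ E ≫ d.mul = d.counit ≫ d.one
    have e : (p ⊗ₘ p) ≫ d.antipode ▷ E = HopfObj.antipode ▷ T ≫ (p ⊗ₘ p) := by
      rw [← tensorHom_id, ← tensorHom_id, tensorHom_comp_tensorHom, tensorHom_comp_tensorHom,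
        d.antipode_eq, Category.id_comp, Category.comp_id]
    rw [← cancel_epi p, reassoc_of% d.comul_eq, reassoc_of% e, ← d.mul_eq,
      HopfObj.antipode_left_assoc, reassoc_of% d.counit_eq, d.one_eq]
  antipode_right := by
    change d.comul ≫ E ◁ d.antipode ≫ d.mul = d.counit ≫ d.one
    have e : (p ⊗ₘ p) ≫ E ◁ d.antipode = T ◁ HopfObj.antipode ≫ (p ⊗ₘ p) := by
      rw [← id_tensorHom, ← id_tensorHom, tensorHom_comp_tensorHom, tensorHom_comp_tensorHom,
        d.antipode_eq, Category.id_comp, Category.comp_id]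
    rw [← cancel_epi p, reassoc_of% d.comul_eq, reassoc_of% e, ← d.mul_eq,
      HopfObj.antipode_right_assoc, reassoc_of% d.counit_eq, d.one_eq]

lemma isBimonHom_proj : letI := d.toHopfObj; IsBimonHom p :=
  letI := d.toHopfObj
  { one_hom := d.one_eq
    mul_hom := d.mul_eq
    hom_counit := d.counit_eq
    hom_comul := d.comul_eq }

lemma isBimonHom_incl {T E S : C} [HopfObj T] [BimonObj S] {p : T ⟶ E}
    {j : E ⟶ S} [Epi p] [Epi (p ⊗ₘ p)] [Mono j] (d : HopfFactorization p j)
    [IsBimonHom (p ≫ j)] : letI := d.toHopfObj; IsBimonHom j :=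
  letI := d.toHopfObj
  { one_hom := d.one_incl
    mul_hom := d.mul_incl
    hom_counit := by
      rw [← cancel_epi p, ← Category.assoc, IsComonHom.hom_counit (p ≫ j)]
      exact d.counit_eq.symm
    hom_comul := by
      have h := IsComonHom.hom_comul (p ≫ j)
      rw [← tensorHom_comp_tensorHom, ← reassoc_of% d.comul_eq, Category.assoc] at h
      exact (cancel_epi p).1 h }

end HopfFactorization

/-- A Hopf monoid structure is determined by its structure morphisms. -/
lemma hopfObj_ext {E : C} {h h' : HopfObj E} (h1 : h.one = h'.one) (h2 : h.mul = h'.mul)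
    (h3 : h.counit = h'.counit) (h4 : h.comul = h'.comul) (h5 : h.antipode = h'.antipode) :
    h = h' := by
  rcases h with @⟨@⟨@⟨_, _⟩, @⟨_, _⟩⟩, _⟩
  rcases h' with @⟨@⟨@⟨_, _⟩, @⟨_, _⟩⟩, _⟩
  cases h1; cases h2; cases h3; cases h4; cases h5
  rfl

/-- There is at most one Hopf monoid structure on a quotient for which the projection is a
morphism of bimonoids. -/
lemma hopfObj_unique_of_epi {T E : C} [HopfObj T] (p : T ⟶ E) [Epi p] [Epi (p ⊗ₘ p)]
    (h h' : HopfObj E) (hp : letI := h; IsBimonHom p) (hp' : letI := h'; IsBimonHom p) :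
    h = h' := by
  have a1 := @IsMonHom.one_hom _ _ _ _ _ _ h.toMonObj p hp.toIsMonHom
  have a2 := @IsMonHom.mul_hom _ _ _ _ _ _ h.toMonObj p hp.toIsMonHom
  have a3 := @IsComonHom.hom_counit _ _ _ _ _ _ h.toComonObj p hp.toIsComonHom
  have a4 := @IsComonHom.hom_comul _ _ _ _ _ _ h.toComonObj p hp.toIsComonHom
  have a5 := @HopfObj.hom_antipode _ _ _ _ _ _ _ h p hp
  have b1 := @IsMonHom.one_hom _ _ _ _ _ _ h'.toMonObj p hp'.toIsMonHom
  have b2 := @IsMonHom.mul_hom _ _ _ _ _ _ h'.toMonObj p hp'.toIsMonHom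
  have b3 := @IsComonHom.hom_counit _ _ _ _ _ _ h'.toComonObj p hp'.toIsComonHom
  have b4 := @IsComonHom.hom_comul _ _ _ _ _ _ h'.toComonObj p hp'.toIsComonHom
  have b5 := @HopfObj.hom_antipode _ _ _ _ _ _ _ h' p hp'
  refine hopfObj_ext (a1.symm.trans b1) ?_ ?_ ?_ ?_
  · exact (cancel_epi (p ⊗ₘ p)).1 (a2.symm.trans b2)
  · exact (cancel_epi p).1 (a3.trans b3.symm)
  · exact (cancel_epi p).1 (a4.trans b4.symm)
  · exact (cancel_epi p).1 (a5.trans b5.symm)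

end Image

/-! ### The morphism `Â(X)` is a morphism of bialgebras -/

section Antisym

variable {D : Type u} [Category.{v} D] [Abelian D] [MonoidalCategory D] [MonoidalPreadditive D]
variable [BraidedCategory D] (X : D)

/-- The Hopf algebra `T(X)`. -/
instance tensorHopf : HopfObj (tensorAlg X) := (tensorHopfData X).toHopfObj

/-- The Hopf algebra `T°(X)`. -/
instance shuffleHopf : HopfObj (shuffleAlg X) :=
  letI := (shuffleHopfData X).toHopfObj
  hopfObjOfOp (shuffleAlg X)

lemma shuffleHopf_mul : μ[shuffleAlg X] = shuffleMul X := rfl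

lemma shuffleHopf_comul : Δ[shuffleAlg X] = shuffleComul X := rfl

lemma antisymmetrizer_one : antisymmetrizer X 1 = 𝟙 _ := by
  rw [antisymmetrizer_succ', antisymmetrizer_zero, addStrand_id,
    inverseShuffleSumAt_of_trivial X (Or.inl rfl)]
  exact Category.id_comp _

lemma degMap_antisym_zero : degMap (antisym X) 0 = 𝟙 (deg (tensorAlg X) 0) :=
  antisymmetrizer_zero X

lemma degMap_antisym_one : degMap (antisym X) 1 = 𝟙 (deg (tensorAlg X) 1) :=
  antisymmetrizer_one X

/-- The inclusion of `X` in degree `1` of `T°(X)`. -/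
def genInclShuffle : genObj X ⟶ shuffleAlg X := ofGen (λ_ X).inv

lemma genIncl_antisym : genIncl X ≫ antisym X = genInclShuffle X := by
  refine gen_hom_ext ?_
  rw [degMap_comp, degMap_antisym_one]
  exact Category.comp_id _

/-- `A_{n+1} = A^{(n,1)} ∘ (A_n ⊗ A_1)`. -/
lemma appendGen_antisym (n : ℕ) : appendGen X n ≫ degMap (antisym X) (n + 1) =
    (degMap (antisym X) n ⊗ₘ degMap (genInclShuffle X) 1) ≫
      mulComponent X (rfl : n + 1 = n + 1) := by
  have e : ∀ {A B Y Z W : D} (f : A ⟶ B) (g : X ⟶ Y) (c : B ⊗ Y ⟶ Z) (d : Z ⟶ W) (k : B ⊗ X ⟶ Z),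
      B ◁ g ≫ c = k → (f ⊗ₘ g) ≫ c ≫ d = (f ▷ X ≫ k) ≫ d := by
    intro A B Y Z W f g c d k h
    rw [← h, MonoidalCategory.tensorHom_def]
    simp only [Category.assoc]
  refine (Category.id_comp _).trans ((antisymmetrizer_succ' X n).trans ?_)
  refine Eq.trans ?_ (e (antisymmetrizer X n) (λ_ X).inv (concat X (rfl : n + 1 = n + 1)).hom
    (inverseShuffleSumAt X (n + 1) n) _ (concat_one X n)).symm
  exact congrArg (· ≫ inverseShuffleSumAt X (n + 1) n) (Category.comp_id _).symm

instance isMonHom_antisym : IsMonHom (antisym X) := by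
  refine (generates_genIncl X).isMonHom _ (unit_hom_ext ?_) (tensor_gen_hom_ext fun n => ?_)
  · rw [degMap_comp, degMap_antisym_zero]
    exact Category.comp_id _
  · rw [← Category.assoc, degMap_comp, ← Category.assoc, inc_mulGen, appendGen_antisym,
      genIncl_antisym, degMap_comp, ← Category.assoc, inc_tensorHom, Category.assoc,
      shuffleHopf_mul, inc_shuffleMul']

lemma antisym_counit : antisym X ≫ ε[shuffleAlg X] = ε[tensorAlg X] := by
  refine hom_unit_ext ?_
  rw [degMap_comp, degMap_antisym_zero]
  exact Category.id_comp _

/-- The elements of degree `1` of `T°(X)` are primitive. -/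
lemma genInclShuffle_comul :
    genInclShuffle X ≫ Δ[shuffleAlg X] = genInclShuffle X ≫ prim (shuffleAlg X) := by
  refine gen_hom_ext ?_
  rw [degMap_comp, degMap_comp]
  congr 1
  refine hom_tensor_ext fun n m h => ?_
  rw [shuffleHopf_comul, shuffleComul_proj', prim, degMap_add, Preadditive.add_comp, degMap_comp,
    degMap_comp, Category.assoc, Category.assoc, whiskerRight_proj, whiskerLeft_proj,
    degMap_leftUnitor_inv, degMap_rightUnitor_inv, Category.assoc, Category.assoc, Category.assoc,
    Category.assoc]
  have eL : ∀ {A : D}, (λ_ A).inv = (λ_ A).inv ≫ ((unitZero D).hom ≫ (unitZero D).inv) ▷ A := by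
    simp
  have eR : ∀ {A : D}, (ρ_ A).inv = (ρ_ A).inv ≫ A ◁ ((unitZero D).hom ≫ (unitZero D).inv) := by
    simp
  obtain rfl | hn := Nat.eq_zero_or_pos n
  · obtain rfl : m = 1 := by omega
    rw [reassoc_of% inc_proj_self (A := 𝟙_ (NGraded D)) (B := shuffleAlg X),
      reassoc_of% inc_proj_of_ne (A := shuffleAlg X) (B := 𝟙_ (NGraded D)) _ _ one_ne_zero,
      zero_comp, comp_zero, comp_zero, add_zero, ← comp_whiskerRight, splitComponent, zero_concat]
    exact eL
  · obtain rfl : m = 0 := by omega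
    obtain rfl : n = 1 := by omega
    rw [reassoc_of% inc_proj_self (A := shuffleAlg X) (B := 𝟙_ (NGraded D)),
      reassoc_of% inc_proj_of_ne (A := 𝟙_ (NGraded D)) (B := shuffleAlg X) _ _ zero_ne_one,
      zero_comp, comp_zero, comp_zero, zero_add, ← MonoidalCategory.whiskerLeft_comp,
      splitComponent, concat_zero]
    exact eR

lemma antisym_comul :
    antisym X ≫ Δ[shuffleAlg X] = Δ[tensorAlg X] ≫ (antisym X ⊗ₘ antisym X) := by
  have h1 : IsMonHom Δ[tensorAlg X] := ⟨BimonObj.one_comul _, BimonObj.mul_comul _⟩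
  have h2 : IsMonHom Δ[shuffleAlg X] := ⟨BimonObj.one_comul _, BimonObj.mul_comul _⟩
  refine (generates_genIncl X).monHom_ext _ _ ?_
  have h3 : genIncl X ≫ Δ[tensorAlg X] = genIncl X ≫ prim (tensorAlg X) :=
    (tensorHopfData X).gen_comul
  rw [reassoc_of% h3, prim_naturality, ← Category.assoc, ← Category.assoc, genIncl_antisym,
    genInclShuffle_comul]

instance isBimonHom_antisym : IsBimonHom (antisym X) where
  hom_counit := antisym_counit X
  hom_comul := antisym_comul X

end Antisym

/-! ### The Hopf algebra `T^∧(X)` -/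

section Exterior

variable {D : Type u} [Category.{v} D] [Abelian D] [MonoidalCategory D] [MonoidalPreadditive D]

lemma epi_of_degMap {A B : NGraded D} (f : A ⟶ B) (hf : ∀ n, Epi (degMap f n)) : Epi f :=
  ⟨fun _ _ h => graded_hom_ext fun n => (cancel_epi (degMap f n)).1 (congrArg (degMap · n) h)⟩

lemma mono_of_degMap {A B : NGraded D} (f : A ⟶ B) (hf : ∀ n, Mono (degMap f n)) : Mono f :=
  ⟨fun _ _ h => graded_hom_ext fun n => (cancel_mono (degMap f n)).1 (congrArg (degMap · n) h)⟩

/-- Epimorphisms and monomorphisms of an abelian category lift against each other, hence so do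
morphisms of graded objects whose components are epimorphisms and monomorphisms. -/
lemma exists_graded_lift {A B C E : NGraded D} (p : A ⟶ B) (j : C ⟶ E)
    (hp : ∀ n, Epi (degMap p n)) (hj : ∀ n, Mono (degMap j n)) (f : A ⟶ C) (g : B ⟶ E)
    (h : f ≫ j = p ≫ g) : ∃ l : B ⟶ C, p ≫ l = f ∧ l ≫ j = g := by
  have sq (n : ℕ) : CommSq (degMap f n) (degMap p n) (degMap j n) (degMap g n) :=
    ⟨congrArg (degMap · n) h⟩
  have hl (n : ℕ) : (sq n).HasLift := by
    have := hp n
    have := strongEpi_of_epi (degMap p n)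
    have := hj n
    infer_instance
  exact ⟨homOfDegMap fun n => (sq n).lift, graded_hom_ext fun n => (sq n).fac_left,
    graded_hom_ext fun n => (sq n).fac_right⟩

lemma epi_degMap_tensorHom [∀ Y : D, PreservesFiniteColimits (tensorLeft Y)]
    [∀ Y : D, PreservesFiniteColimits (tensorRight Y)] {A A' B B' : NGraded D} (f : A ⟶ A')
    (g : B ⟶ B') (hf : ∀ n, Epi (degMap f n)) (hg : ∀ n, Epi (degMap g n)) (k : ℕ) :
    Epi (degMap (f ⊗ₘ g) k) := by
  refine ⟨fun u v h => tensor_hom_ext fun n m hk => ?_⟩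
  have h1 : Epi (degMap f n ▷ deg B m) := (tensorRight (deg B m)).map_epi (degMap f n)
  have h2 : Epi (deg A' n ◁ degMap g m) := (tensorLeft (deg A' n)).map_epi (degMap g m)
  rw [← cancel_epi (deg A' n ◁ degMap g m), ← cancel_epi (degMap f n ▷ deg B m),
    ← MonoidalCategory.tensorHom_def_assoc, ← MonoidalCategory.tensorHom_def_assoc,
    ← reassoc_of% inc_tensorHom f g n m k hk, ← reassoc_of% inc_tensorHom f g n m k hk, h]

lemma mono_degMap_tensorHom [∀ Y : D, PreservesFiniteLimits (tensorLeft Y)]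
    [∀ Y : D, PreservesFiniteLimits (tensorRight Y)] {A A' B B' : NGraded D} (f : A ⟶ A')
    (g : B ⟶ B') (hf : ∀ n, Mono (degMap f n)) (hg : ∀ n, Mono (degMap g n)) (k : ℕ) :
    Mono (degMap (f ⊗ₘ g) k) := by
  refine ⟨fun u v h => hom_tensor_ext fun n m hk => ?_⟩
  have h1 : Mono (degMap f n ▷ deg B m) := (tensorRight (deg B m)).map_mono (degMap f n)
  have h2 : Mono (deg A' n ◁ degMap g m) := (tensorLeft (deg A' n)).map_mono (degMap g m)
  rw [← cancel_mono (degMap f n ▷ deg B m), ← cancel_mono (deg A' n ◁ degMap g m)]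
  simp only [Category.assoc]
  rw [← MonoidalCategory.tensorHom_def, ← tensorHom_proj, reassoc_of% h]

variable [BraidedCategory D] (X : D)

lemma epi_degMap_exteriorProj (n : ℕ) : Epi (degMap (exteriorProj X) n) :=
  inferInstanceAs (Epi (Abelian.coimage.π (antisymmetrizer X n)))

lemma mono_degMap_exteriorIncl (n : ℕ) : Mono (degMap (exteriorIncl X) n) :=
  inferInstanceAs (Mono (Abelian.factorThruCoimage (antisymmetrizer X n)))

instance epi_exteriorProj : Epi (exteriorProj X) :=
  epi_of_degMap _ (epi_degMap_exteriorProj X)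

instance mono_exteriorIncl : Mono (exteriorIncl X) :=
  mono_of_degMap _ (mono_degMap_exteriorIncl X)

lemma exteriorProj_incl : exteriorProj X ≫ exteriorIncl X = antisym X :=
  graded_hom_ext fun n => Abelian.coimage.fac (antisymmetrizer X n)

instance epi_exteriorProj_tensorHom [∀ Y : D, PreservesFiniteColimits (tensorLeft Y)]
    [∀ Y : D, PreservesFiniteColimits (tensorRight Y)] :
    Epi (exteriorProj X ⊗ₘ exteriorProj X) :=
  epi_of_degMap _
    (epi_degMap_tensorHom _ _ (epi_degMap_exteriorProj X) (epi_degMap_exteriorProj X))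

/-- The product, coproduct and antipode of `T^∧(X)` are the diagonals of the squares which express
that `Â(X)` respects the structure morphisms of `T(X)` and `T°(X)`. -/
lemma nonempty_hopfFactorization
    [∀ Y : D, PreservesFiniteLimits (tensorLeft Y)]
    [∀ Y : D, PreservesFiniteColimits (tensorLeft Y)]
    [∀ Y : D, PreservesFiniteLimits (tensorRight Y)]
    [∀ Y : D, PreservesFiniteColimits (tensorRight Y)] :
    Nonempty (HopfFactorization (exteriorProj X) (exteriorIncl X)) := by
  have hp := epi_degMap_exteriorProj X
  have hj := mono_degMap_exteriorIncl X
  have hf := exteriorProj_incl X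
  obtain ⟨mul, m1, m2⟩ := exists_graded_lift (exteriorProj X ⊗ₘ exteriorProj X) (exteriorIncl X)
    (epi_degMap_tensorHom _ _ hp hp) hj (μ ≫ exteriorProj X)
    ((exteriorIncl X ⊗ₘ exteriorIncl X) ≫ μ) (by
      rw [Category.assoc, hf, tensorHom_comp_tensorHom_assoc, hf, IsMonHom.mul_hom])
  obtain ⟨comul, c1, -⟩ := exists_graded_lift (exteriorProj X)
    (exteriorIncl X ⊗ₘ exteriorIncl X) hp (mono_degMap_tensorHom _ _ hj hj)
    (Δ ≫ (exteriorProj X ⊗ₘ exteriorProj X)) (exteriorIncl X ≫ Δ) (by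
      rw [Category.assoc, tensorHom_comp_tensorHom, ← Category.assoc (exteriorProj X), hf,
        IsComonHom.hom_comul])
  obtain ⟨antipode, a1, -⟩ := exists_graded_lift (exteriorProj X) (exteriorIncl X) hp hj
    (HopfObj.antipode ≫ exteriorProj X) (exteriorIncl X ≫ HopfObj.antipode) (by
      rw [Category.assoc, ← Category.assoc (exteriorProj X), hf, HopfObj.hom_antipode])
  exact ⟨{
    one := η ≫ exteriorProj X
    mul := mul
    counit := exteriorIncl X ≫ ε
    comul := comul
    antipode := antipode
    one_eq := rfl
    mul_eq := m1.symm
    counit_eq := by rw [← Category.assoc, hf, IsComonHom.hom_counit]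
    comul_eq := c1
    antipode_eq := a1
    one_incl := by rw [Category.assoc, hf, IsMonHom.one_hom]
    mul_incl := m2 }⟩

end Exterior

end

end BraidedExterior

theorem mainTheorem8 {D : Type*} [Category* D] [Abelian D] [MonoidalCategory D]
    [MonoidalPreadditive D] [BraidedCategory D]
    [∀ Y : D, PreservesFiniteLimits (tensorLeft Y)]
    [∀ Y : D, PreservesFiniteColimits (tensorLeft Y)]
    [∀ Y : D, PreservesFiniteLimits (tensorRight Y)]
    [∀ Y : D, PreservesFiniteColimits (tensorRight Y)]
    (X : D) :
    ∃ (hT : HopfObj (BraidedExterior.tensorAlg X)) (hS : HopfObj (BraidedExterior.shuffleAlg X)),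
      (hT.one = BraidedExterior.tensorOne X ∧
        hT.mul = BraidedExterior.tensorMul X ∧
        hT.counit = BraidedExterior.tensorCounit X ∧
        hT.comul = BraidedExterior.tensorComul X ∧
        hT.antipode = BraidedExterior.tensorAntipode X) ∧
      (hS.one = BraidedExterior.shuffleOne X ∧
        hS.mul = BraidedExterior.shuffleMul X ∧
        hS.counit = BraidedExterior.shuffleCounit X ∧
        hS.comul = BraidedExterior.shuffleComul X ∧
        hS.antipode = BraidedExterior.shuffleAntipode X) ∧
      IsBimonHom (BraidedExterior.antisym X) ∧
      ∃ hE : HopfObj (BraidedExterior.exteriorAlg X),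
        IsBimonHom (BraidedExterior.exteriorProj X) ∧
        IsBimonHom (BraidedExterior.exteriorIncl X) ∧
        ∀ hE' : HopfObj (BraidedExterior.exteriorAlg X),
          IsBimonHom (BraidedExterior.exteriorProj X) → hE' = hE := by
  obtain ⟨d⟩ := BraidedExterior.nonempty_hopfFactorization X
  have : IsBimonHom (BraidedExterior.exteriorProj X ≫ BraidedExterior.exteriorIncl X) := by
    rw [BraidedExterior.exteriorProj_incl]
    infer_instance
  exact ⟨BraidedExterior.tensorHopf X, BraidedExterior.shuffleHopf X, ⟨rfl, rfl, rfl, rfl, rfl⟩,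
    ⟨rfl, rfl, rfl, rfl, rfl⟩, BraidedExterior.isBimonHom_antisym X, d.toHopfObj,
    d.isBimonHom_proj, d.isBimonHom_incl, fun h hp =>
      BraidedExterior.hopfObj_unique_of_epi (BraidedExterior.exteriorProj X) h d.toHopfObj hp
        d.isBimonHom_proj⟩
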